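/- Let $\mathfrak g=\mathfrak g_{\bar 0}\oplus\mathfrak g_{\bar 1}$ be a basic simple finite-dimensional Lie superalgebra over $\mathbb C$, i.e. $\mathfrak g$ is simple, $\mathfrak g_{\bar 0}$ is a reductive Lie algebra, and $\mathfrak g$ carries an even invariant non-degenerate supersymmetric bilinear form. Assume that $\mathfrak g$ is not isomorphic to $D(2,1;a)$ with $a\in\mathbb C\setminus\mathbb R$. (Here $D(2,1;a)$ is the Lie superalgebra with even part $sl_2\oplus sl_2\oplus sl_2$ and odd part $\mathbb C^2\otimes\mathbb C^2\otimes\mathbb C^2$, on which the even part acts naturally, with $[u_1\otimes u_2\otimes u_3,v_1\otimes v_2\otimes v_3]=\sum_i\sigma_i\,\omega(u_j,v_j)\,\omega(u_k,v_k)\,p_i(u_i,v_i)$, where $\{i,j,k\}=\{1,2,3\}$, $\omega$ is the standard symplectic form on $\mathbb C^2$, $p_i(u,v)\in sl_2$ (the $i$-th summand) is given by $p_i(u,v)z=\omega(v,z)u+\omega(u,z)v$, and $(\sigma_1,\sigma_2,\sigma_3)=(-1-a,1,a)$.) Let $e,x,f\in\mathfrak g_{\bar 0}$, $x\neq0$,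 be an $sl_2$-triple, normalized by $[x,e]=e$, $[x,f]=-f$, $[e,f]=x$; put $\mathfrak s=\mathrm{span}\{e,x,f\}$, let $\mathfrak g^\natural$ be the centralizer of $\mathfrak s$ in $\mathfrak g$, and let $\mathfrak g_j$ be the eigenspace of $\mathrm{ad}\,x$ with eigenvalue $j\in\frac12\mathbb Z$. Suppose that $$\mathfrak g_{\bar 0}=\mathfrak s\oplus\mathfrak g^\natural,$$ and that the triple is minimal: $\mathfrak g_j=0$ for $|j|>1$ and $\mathfrak g_{-1}=\mathbb C f$. Then $\mathfrak g$ has an almost compact conjugate-linear involution, i.e. there is a conjugate-linear map $\phi:\mathfrak g\to\mathfrak g$ preserving parity and bracket, with $\phi^2=\mathrm{id}$, such that (i) $\phi(e)=e$, $\phi(x)=x$, $\phi(f)=f$; (ii) $\phi$ restricts to a compact involution of $\mathfrak g^\natural$: $\phi(\mathfrak g^\natural)=\mathfrak g^\natural$, and the real form $\{a\in\mathfrak g^\natural\mid\phi(a)=a\}$ of $\mathfrak g^\natural$ is compact, in the sense that it acts on $\mathfrak g$ by skew-Hermitian operators with respect to some positive definite Hermitian form on $\mathfrak g$. -/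

import Mathlib

/-- The sign `(-1)^{ij}` for parities `i, j ∈ ℤ/2ℤ`. -/
def superSign (i j : ZMod 2) : ℂ := if i = 1 ∧ j = 1 then -1 else 1

/-- A complex Lie superalgebra structure on the vector space `V`: a `ℤ/2ℤ`-grading
`V = part 0 ⊕ part 1` with a bilinear, parity-additive bracket which is super-skewsymmetric and
satisfies the super Jacobi identity. -/
structure LieSuperalgebra (V : Type*) [AddCommGroup V] [Module ℂ V] where
  bracket : V →ₗ[ℂ] V →ₗ[ℂ] V
  part : ZMod 2 → Submodule ℂ V
  isCompl : IsCompl (part 0) (part 1)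
  bracket_mem : ∀ (i j : ZMod 2) (a b : V), a ∈ part i → b ∈ part j →
    bracket a b ∈ part (i + j)
  skew : ∀ (i j : ZMod 2) (a b : V), a ∈ part i → b ∈ part j →
    bracket a b = -(superSign i j • bracket b a)
  jacobi : ∀ (i j k : ZMod 2) (a b c : V), a ∈ part i → b ∈ part j → c ∈ part k →
    bracket a (bracket b c) = bracket (bracket a b) c + superSign i j • bracket b (bracket a c)

namespace LieSuperalgebra

variable {V : Type*} [AddCommGroup V] [Module ℂ V]

/-- The even part. -/
def even (G : LieSuperalgebra V) : Submodule ℂ V := G.part 0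

/-- The even part is a Lie algebra for the restricted bracket. -/
instance evenLieRing (G : LieSuperalgebra V) : LieRing G.even where
  bracket a b := ⟨G.bracket a b, by
    have h := G.bracket_mem 0 0 a b a.2 b.2
    rwa [add_zero] at h⟩
  add_lie a b c := Subtype.ext (by simp)
  lie_add a b c := Subtype.ext (by simp)
  lie_self a := Subtype.ext (by
    have h := G.skew 0 0 a a a.2 a.2
    simp only [superSign, zero_ne_one, and_self, if_false, one_smul] at h
    have h2 : (2 : ℂ) • G.bracket (a : V) (a : V) = 0 := by
      rw [two_smul]
      nth_rewrite 1 [h]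
      exact neg_add_cancel _
    exact (smul_eq_zero.mp h2).resolve_left two_ne_zero)
  leibniz_lie a b c := Subtype.ext (by
    have h := G.jacobi 0 0 0 a b c a.2 b.2 c.2
    simpa [superSign] using h)

instance evenLieAlgebra (G : LieSuperalgebra V) : LieAlgebra ℂ G.even where
  lie_smul t a b := Subtype.ext ((G.bracket (a : V)).map_smul t (b : V))

/-- A (graded) ideal: a graded subspace stable under bracketing with all elements. -/
def IsIdeal (G : LieSuperalgebra V) (I : Submodule ℂ V) : Prop :=
  I ≤ (I ⊓ G.part 0) ⊔ (I ⊓ G.part 1) ∧ ∀ a : V, ∀ b ∈ I, G.bracket a b ∈ I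

/-- Simple: the bracket is not identically zero and there are no proper nonzero ideals. -/
def IsSimple (G : LieSuperalgebra V) : Prop :=
  (∃ a b : V, G.bracket a b ≠ 0) ∧ ∀ I : Submodule ℂ V, G.IsIdeal I → I = ⊥ ∨ I = ⊤

/-- `β` is an even, supersymmetric, invariant, nondegenerate bilinear form. -/
structure IsBasicForm (G : LieSuperalgebra V) (β : V →ₗ[ℂ] V →ₗ[ℂ] ℂ) : Prop where
  even_form : ∀ a ∈ G.part 0, ∀ b ∈ G.part 1, β a b = 0
  supersymm : ∀ (i j : ZMod 2) (a b : V), a ∈ G.part i → b ∈ G.part j →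
    β a b = superSign i j * β b a
  invariant : ∀ a b c : V, β (G.bracket a b) c = β a (G.bracket b c)
  nondegenerate : ∀ a : V, (∀ b : V, β a b = 0) → a = 0

/-- Basic simple Lie superalgebra: simple, with reductive even part, and carrying a nondegenerate
even supersymmetric invariant bilinear form. (`HasCentralRadical` is Mathlib's form of
"reductive" in characteristic zero.) -/
structure IsBasicSimple (G : LieSuperalgebra V) : Prop where
  simple : G.IsSimple
  reductive : LieAlgebra.HasCentralRadical ℂ G.even
  exists_form : ∃ β : V →ₗ[ℂ] V →ₗ[ℂ] ℂ, G.IsBasicForm β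

/-- An `sl₂`-triple of even elements, normalized by `[x,e] = e`, `[x,f] = -f`, `[e,f] = x`. -/
structure IsSl2Triple (G : LieSuperalgebra V) (e x f : V) : Prop where
  e_mem : e ∈ G.even
  x_mem : x ∈ G.even
  f_mem : f ∈ G.even
  x_ne_zero : x ≠ 0
  lie_x_e : G.bracket x e = e
  lie_x_f : G.bracket x f = -f
  lie_e_f : G.bracket e f = x

/-- The centralizer in the whole superalgebra of a set of vectors. -/
def centralizer (G : LieSuperalgebra V) (S : Set V) : Submodule ℂ V where
  carrier := {a | ∀ s ∈ S, G.bracket s a = 0}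
  add_mem' := fun ha hb s hs => by simp [ha s hs, hb s hs]
  zero_mem' := fun s _ => map_zero _
  smul_mem' := fun c a ha s hs => by simp [ha s hs]

/-- The span `𝔰` of the triple. -/
def tripleSpan (e x f : V) : Submodule ℂ V := Submodule.span ℂ {e, x, f}

/-- `𝔤^♮`, the centralizer of `𝔰 = span {e, x, f}` in `𝔤`. -/
def gNatural (G : LieSuperalgebra V) (e x f : V) : Submodule ℂ V :=
  G.centralizer (tripleSpan e x f : Set V)

/-- The decomposition `𝔤_even = 𝔰 ⊕ 𝔤^♮`. -/
def EvenSplits (G : LieSuperalgebra V) (e x f : V) : Prop :=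
  Disjoint (tripleSpan e x f) (G.gNatural e x f) ∧
    tripleSpan e x f ⊔ G.gNatural e x f = G.even

/-- The datum is minimal: for the grading of `𝔤` by the eigenvalues of `ad x` (which are
half-integers for an `sl₂`-triple) one has `𝔤_j = 0` for `|j| > 1`, and `𝔤_{-1} = ℂ f`. -/
def IsMinimal (G : LieSuperalgebra V) (x f : V) : Prop :=
  (∀ n : ℤ, 2 < |n| → Module.End.eigenspace (G.bracket x) ((n : ℂ) / 2) = ⊥) ∧
    Module.End.eigenspace (G.bracket x) (-1) = Submodule.span ℂ {f}

/-- A conjugate-linear involution: a conjugate-linear, parity-preserving, bracket-preserving map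
whose square is the identity. -/
structure IsConjInvolution (G : LieSuperalgebra V) (φ : V →ₛₗ[starRingEnd ℂ] V) : Prop where
  involutive : ∀ a : V, φ (φ a) = a
  map_part : ∀ (i : ZMod 2) (a : V), a ∈ G.part i → φ a ∈ G.part i
  map_bracket : ∀ a b : V, φ (G.bracket a b) = G.bracket (φ a) (φ b)

/-- `φ` restricts to a compact involution of the subalgebra `L`: it preserves `L`, and the real
form `{a ∈ L | φ a = a}` of `L` acts on `𝔤` by skew-Hermitian operators for some positive definite
Hermitian form, that is, the group generated by its adjoint action lies in a
compact (unitary) group. -/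
def IsCompactOn (G : LieSuperalgebra V) (φ : V →ₛₗ[starRingEnd ℂ] V) (L : Submodule ℂ V) : Prop :=
  (∀ a ∈ L, φ a ∈ L) ∧
    ∃ H : InnerProductSpace.Core ℂ V, ∀ a ∈ L, φ a = a →
      ∀ u v : V, H.inner (G.bracket a u) v = -H.inner u (G.bracket a v)

/-- An almost compact conjugate-linear involution: it fixes `e, x, f` and is a compact involution
of `𝔤^♮`. -/
structure IsAlmostCompact (G : LieSuperalgebra V) (e x f : V)
    (φ : V →ₛₗ[starRingEnd ℂ] V) : Prop where
  conjInvolution : G.IsConjInvolution φ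
  map_e : φ e = e
  map_x : φ x = x
  map_f : φ f = f
  compact : G.IsCompactOn φ (G.gNatural e x f)

/-- Isomorphism of Lie superalgebras. -/
def Isomorphic {W : Type*} [AddCommGroup W] [Module ℂ W]
    (G : LieSuperalgebra V) (G' : LieSuperalgebra W) : Prop :=
  ∃ ψ : V ≃ₗ[ℂ] W, (∀ a b : V, ψ (G.bracket a b) = G'.bracket (ψ a) (ψ b)) ∧
    ∀ (i : ZMod 2) (a : V), a ∈ G.part i → ψ a ∈ G'.part i

end LieSuperalgebra

/-! ### The Lie superalgebras `D(2,1;a)`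

The even part is `sl₂ × sl₂ × sl₂`, the odd part is `ℂ² ⊗ ℂ² ⊗ ℂ²`, with the brackets
`[A, v] = A · v` and
`[u₀⊗u₁⊗u₂, v₀⊗v₁⊗v₂] = ∑ᵢ σᵢ ω(uⱼ,vⱼ) ω(uₖ,vₖ) pᵢ(uᵢ,vᵢ)` (`{i,j,k} = {0,1,2}`), where `ω` is the
standard symplectic form of `ℂ²`, `p(u,v) z = ω(v,z) u + ω(u,z) v`, and
`(σ₀,σ₁,σ₂) = (-1-a, 1, a)`. -/

namespace D21

/-- The even part `sl₂ × sl₂ × sl₂`. -/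
abbrev Even : Type := Fin 3 → LieAlgebra.SpecialLinear.sl (Fin 2) ℂ

/-- The odd part `ℂ² ⊗ ℂ² ⊗ ℂ²`, in coordinates. -/
abbrev Odd : Type := Fin 2 → Fin 2 → Fin 2 → ℂ

/-- The matrix of the symplectic form, `ω(u,v) = ∑ u_p ε_pq v_q`. -/
def ε : Matrix (Fin 2) (Fin 2) ℂ := !![0, 1; -1, 0]

/-- Action of `sl₂ × sl₂ × sl₂` on `ℂ² ⊗ ℂ² ⊗ ℂ²`. -/
def act (A : Even) (v : Odd) : Odd := fun i j k =>
  ∑ m, ((A 0).1 i m * v m j k + (A 1).1 j m * v i m k + (A 2).1 k m * v i j m)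

/-- Matrix of `ω ω p₀` on the tensors `v, w`. -/
def oddMat₀ (v w : Odd) : Matrix (Fin 2) (Fin 2) ℂ := fun p q =>
  ∑ m, ∑ j, ∑ j', ∑ k, ∑ k', ε j j' * ε k k' * ε m q *
    (v p j k * w m j' k' + w p j' k' * v m j k)

/-- Transposition of the first tensor factor with the second one. -/
def swap₁ (v : Odd) : Odd := fun i j k => v j i k

/-- Transposition of the first tensor factor with the third one. -/
def swap₂ (v : Odd) : Odd := fun i j k => v k j i

lemma oddMat₀_apply (v w : Odd) (p q : Fin 2) : oddMat₀ v w p q =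
    ∑ m, ε m q * ((v p 0 0 * w m 1 1 + w p 1 1 * v m 0 0) - (v p 0 1 * w m 1 0 + w p 1 0 * v m 0 1)
      - (v p 1 0 * w m 0 1 + w p 0 1 * v m 1 0) + (v p 1 1 * w m 0 0 + w p 0 0 * v m 1 1)) := by
  unfold oddMat₀
  refine Finset.sum_congr rfl fun m _ => ?_
  simp [ε, Fin.sum_univ_two]
  ring

lemma oddMat₀_trace (v w : Odd) : (oddMat₀ v w).trace = 0 := by
  simp [Matrix.trace, oddMat₀_apply, ε, Fin.sum_univ_two]
  ring

/-- `ω ω p₀` with values in `sl₂`. -/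
def oddSl (v w : Odd) : LieAlgebra.SpecialLinear.sl (Fin 2) ℂ :=
  ⟨oddMat₀ v w, by
    rw [LieAlgebra.SpecialLinear.sl]
    exact (oddMat₀_trace v w)⟩

/-- The bracket of two odd elements. -/
def oddBr (a : ℂ) (v w : Odd) : Even :=
  ![(-1 - a) • oddSl v w, oddSl (swap₁ v) (swap₁ w), a • oddSl (swap₂ v) (swap₂ w)]

/-- The bracket of `D(2,1;a)`. -/
def brFun (a : ℂ) (X Y : Even × Odd) : Even × Odd :=
  ((fun i => ⁅X.1 i, Y.1 i⁆) + oddBr a X.2 Y.2, act X.1 Y.2 - act Y.1 X.2)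

lemma act_add_left (A B : Even) (v : Odd) : act (A + B) v = act A v + act B v := by
  ext i j k
  simp [act, Fin.sum_univ_two]
  ring

lemma act_smul_left (c : ℂ) (A : Even) (v : Odd) : act (c • A) v = c • act A v := by
  ext i j k
  simp [act, Fin.sum_univ_two]
  ring

lemma act_add_right (A : Even) (v w : Odd) : act A (v + w) = act A v + act A w := by
  ext i j k
  simp [act, Fin.sum_univ_two]
  ring

lemma act_smul_right (c : ℂ) (A : Even) (v : Odd) : act A (c • v) = c • act A v := by
  ext i j k
  simp [act, Fin.sum_univ_two]
  ring

lemma oddSl_symm (v w : Odd) : oddSl v w = oddSl w v := by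
  apply Subtype.ext
  ext p q
  fin_cases p <;> fin_cases q <;> simp [oddSl, oddMat₀_apply, ε, Fin.sum_univ_two] <;> ring

lemma oddMat₀_add_left (u v w : Odd) : oddMat₀ (u + v) w = oddMat₀ u w + oddMat₀ v w := by
  ext p q
  simp only [oddMat₀_apply, Matrix.add_apply, Pi.add_apply, ← Finset.sum_add_distrib]
  exact Finset.sum_congr rfl fun _ _ => by ring

lemma oddMat₀_smul_left (c : ℂ) (v w : Odd) : oddMat₀ (c • v) w = c • oddMat₀ v w := by
  ext p q
  simp only [oddMat₀_apply, Matrix.smul_apply, Pi.smul_apply, smul_eq_mul, Finset.mul_sum]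
  exact Finset.sum_congr rfl fun _ _ => by ring

lemma oddSl_add_left (u v w : Odd) : oddSl (u + v) w = oddSl u w + oddSl v w :=
  Subtype.ext (oddMat₀_add_left u v w)

lemma oddSl_smul_left (c : ℂ) (v w : Odd) : oddSl (c • v) w = c • oddSl v w :=
  Subtype.ext (oddMat₀_smul_left c v w)

lemma oddBr_symm (a : ℂ) (v w : Odd) : oddBr a v w = oddBr a w v := by
  simp only [oddBr, oddSl_symm v w, oddSl_symm (swap₁ v), oddSl_symm (swap₂ v)]

lemma oddBr_add_left (a : ℂ) (u v w : Odd) : oddBr a (u + v) w = oddBr a u w + oddBr a v w := by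
  have h1 : swap₁ (u + v) = swap₁ u + swap₁ v := rfl
  have h2 : swap₂ (u + v) = swap₂ u + swap₂ v := rfl
  funext i
  fin_cases i <;> simp [oddBr, h1, h2, oddSl_add_left]

lemma oddBr_smul_left (a c : ℂ) (v w : Odd) : oddBr a (c • v) w = c • oddBr a v w := by
  have h1 : swap₁ (c • v) = c • swap₁ v := rfl
  have h2 : swap₂ (c • v) = c • swap₂ v := rfl
  funext i
  fin_cases i <;> simp [oddBr, h1, h2, oddSl_smul_left, smul_comm c]

lemma brFun_add_left (a : ℂ) (X Y Z : Even × Odd) :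
    brFun a (X + Y) Z = brFun a X Z + brFun a Y Z := by
  refine Prod.ext ?_ ?_
  · funext i
    simp [brFun, oddBr_add_left]
    abel
  · simp [brFun, act_add_left, act_add_right]
    abel

lemma brFun_smul_left (a c : ℂ) (X Z : Even × Odd) :
    brFun a (c • X) Z = c • brFun a X Z := by
  refine Prod.ext ?_ ?_
  · funext i
    simp [brFun, oddBr_smul_left]
  · simp [brFun, act_smul_left, act_smul_right, smul_sub]

lemma brFun_add_right (a : ℂ) (X Y Z : Even × Odd) :
    brFun a X (Y + Z) = brFun a X Y + brFun a X Z := by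
  refine Prod.ext ?_ ?_
  · funext i
    simp [brFun, oddBr_symm a X.2, oddBr_add_left]
    abel
  · simp [brFun, act_add_left, act_add_right]
    abel

lemma brFun_smul_right (a c : ℂ) (X Z : Even × Odd) :
    brFun a X (c • Z) = c • brFun a X Z := by
  refine Prod.ext ?_ ?_
  · funext i
    simp [brFun, oddBr_symm a X.2, oddBr_smul_left]
  · simp [brFun, act_smul_left, act_smul_right, smul_sub]

/-- The bracket of `D(2,1;a)` as a bilinear map. -/
def br (a : ℂ) : (Even × Odd) →ₗ[ℂ] (Even × Odd) →ₗ[ℂ] (Even × Odd) :=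
  LinearMap.mk₂ ℂ (brFun a) (brFun_add_left a) (brFun_smul_left a) (brFun_add_right a)
    (brFun_smul_right a)

/-- The `ℤ/2ℤ`-grading. -/
def part (i : ZMod 2) : Submodule ℂ (Even × Odd) :=
  if i = 0 then Submodule.prod ⊤ ⊥ else Submodule.prod ⊥ ⊤

lemma mem_part_zero (X : Even × Odd) : X ∈ part 0 ↔ X.2 = 0 := by
  simp [part, Submodule.mem_prod]

lemma mem_part_one (X : Even × Odd) : X ∈ part 1 ↔ X.1 = 0 := by
  simp [part, Submodule.mem_prod]

lemma act_zero_left (v : Odd) : act 0 v = 0 := by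
  have h := act_smul_left 0 0 v
  simpa using h

lemma act_zero_right (A : Even) : act A 0 = 0 := by
  have h := act_smul_right 0 A 0
  simpa using h

lemma oddBr_zero_left (a : ℂ) (v : Odd) : oddBr a 0 v = 0 := by
  have h := oddBr_smul_left a 0 0 v
  simpa using h

lemma oddBr_zero_right (a : ℂ) (v : Odd) : oddBr a v 0 = 0 := by
  rw [oddBr_symm, oddBr_zero_left]

lemma sl_val_one_one (A : LieAlgebra.SpecialLinear.sl (Fin 2) ℂ) : A.1 1 1 = -A.1 0 0 := by
  have h : A.1.trace = 0 := A.2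
  rw [Matrix.trace_fin_two] at h
  linear_combination h

/-- `V` is a representation of the even part. -/
lemma act_lie (A B : Even) (v : Odd) :
    act (fun i => ⁅A i, B i⁆) v = act A (act B v) - act B (act A v) := by
  ext i j k
  simp [act, Fin.sum_univ_two, LieRing.of_associative_ring_bracket, Matrix.mul_apply]
  ring

lemma act_neg_right (A : Even) (v : Odd) : act A (-v) = -act A v := by
  have h := act_smul_right (-1) A v
  simpa using h

lemma oddBr_neg_left (a : ℂ) (v w : Odd) : oddBr a (-v) w = -oddBr a v w := by
  have h := oddBr_smul_left a (-1) v w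
  simpa using h

lemma oddBr_neg_right (a : ℂ) (v w : Odd) : oddBr a v (-w) = -oddBr a v w := by
  rw [oddBr_symm, oddBr_neg_left, oddBr_symm]

/-- Equivariance of the first component of the odd bracket. -/
lemma oddSl_equivariant (A : Even) (v w : Odd) :
    ⁅A 0, oddSl v w⁆ = oddSl (act A v) w + oddSl v (act A w) := by
  have h0 := sl_val_one_one (A 0)
  have h1 := sl_val_one_one (A 1)
  have h2 := sl_val_one_one (A 2)
  apply Subtype.ext
  ext p q
  fin_cases p <;> fin_cases q <;>
    simp [oddSl, oddMat₀_apply, act, ε, Fin.sum_univ_two, LieRing.of_associative_ring_bracket,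
      Matrix.mul_apply, h0, h1, h2] <;> ring

lemma oddBr_equivariant (a : ℂ) (A : Even) (v w : Odd) :
    (fun i => ⁅A i, oddBr a v w i⁆) = oddBr a (act A v) w + oddBr a v (act A w) := by
  have s1 : ∀ u, swap₁ (act A u) = act ![A 1, A 0, A 2] (swap₁ u) := by
    intro u
    ext i j k
    simp [swap₁, act, Fin.sum_univ_two]
    ring
  have s2 : ∀ u, swap₂ (act A u) = act ![A 2, A 1, A 0] (swap₂ u) := by
    intro u
    ext i j k
    simp [swap₂, act, Fin.sum_univ_two]
    ring
  have e0 := oddSl_equivariant A v w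
  have e1 := oddSl_equivariant ![A 1, A 0, A 2] (swap₁ v) (swap₁ w)
  have e2 := oddSl_equivariant ![A 2, A 1, A 0] (swap₂ v) (swap₂ w)
  simp only [Matrix.cons_val_zero] at e1 e2
  funext i
  fin_cases i
  · simp [oddBr, e0]
  · simp [oddBr, s1, e1]
  · simp [oddBr, s2, e2]

lemma act_oddBr_apply (a : ℂ) (u v w : Odd) (i j k : Fin 2) : act (oddBr a u v) w i j k =
    ∑ m, ((-1 - a) * oddMat₀ u v i m * w m j k + oddMat₀ (swap₁ u) (swap₁ v) j m * w i m k
      + a * oddMat₀ (swap₂ u) (swap₂ v) k m * w i j m) := rfl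

/-- The Jacobi identity for three odd elements. -/
lemma act_oddBr_cyclic (a : ℂ) (u v w : Odd) :
    act (oddBr a u v) w + act (oddBr a v w) u + act (oddBr a w u) v = 0 := by
  ext i j k
  simp only [Pi.add_apply, Pi.zero_apply, act_oddBr_apply, oddMat₀_apply, swap₁, swap₂, ε]
  fin_cases i <;> fin_cases j <;> fin_cases k <;>
    simp [Fin.sum_univ_two] <;> ring

lemma mem_part_cases (i : ZMod 2) : i = 0 ∨ i = 1 := by
  revert i
  decide

end D21

/-- The Lie superalgebra `D(2,1;a)`. -/
def D21 (a : ℂ) : LieSuperalgebra (D21.Even × D21.Odd) where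
  bracket := D21.br a
  part := D21.part
  isCompl := by
    refine IsCompl.of_eq ?_ ?_
    · rw [eq_bot_iff]
      rintro X ⟨h0, h1⟩
      exact Prod.ext ((D21.mem_part_one X).1 h1) ((D21.mem_part_zero X).1 h0)
    · rw [eq_top_iff]
      rintro ⟨A, v⟩ -
      refine Submodule.mem_sup.2 ⟨(A, 0), (D21.mem_part_zero _).2 rfl, (0, v),
        (D21.mem_part_one _).2 rfl, ?_⟩
      simp
  bracket_mem := by
    rintro i j ⟨A, v⟩ ⟨B, w⟩ hX hY
    change D21.brFun a (A, v) (B, w) ∈ _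
    rcases D21.mem_part_cases i with rfl | rfl <;> rcases D21.mem_part_cases j with rfl | rfl
    · obtain rfl : v = 0 := (D21.mem_part_zero _).1 hX
      obtain rfl : w = 0 := (D21.mem_part_zero _).1 hY
      exact (D21.mem_part_zero _).2 (by simp [D21.brFun, D21.act_zero_right])
    · obtain rfl : v = 0 := (D21.mem_part_zero _).1 hX
      obtain rfl : B = 0 := (D21.mem_part_one _).1 hY
      refine (D21.mem_part_one _).2 (funext fun i => ?_)
      simp [D21.brFun, D21.oddBr_zero_left]
    · obtain rfl : A = 0 := (D21.mem_part_one _).1 hX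
      obtain rfl : w = 0 := (D21.mem_part_zero _).1 hY
      refine (D21.mem_part_one _).2 (funext fun i => ?_)
      simp [D21.brFun, D21.oddBr_zero_right]
    · obtain rfl : A = 0 := (D21.mem_part_one _).1 hX
      obtain rfl : B = 0 := (D21.mem_part_one _).1 hY
      exact (D21.mem_part_zero _).2 (by simp [D21.brFun, D21.act_zero_left])
  skew := by
    rintro i j ⟨A, v⟩ ⟨B, w⟩ hX hY
    change D21.brFun a (A, v) (B, w) = -(superSign i j • D21.brFun a (B, w) (A, v))
    rcases D21.mem_part_cases i with rfl | rfl <;> rcases D21.mem_part_cases j with rfl | rfl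
    · obtain rfl : v = 0 := (D21.mem_part_zero _).1 hX
      obtain rfl : w = 0 := (D21.mem_part_zero _).1 hY
      refine Prod.ext (funext fun i => ?_) ?_
      · simp [D21.brFun, D21.oddBr_zero_left, superSign]
      · simp [D21.brFun, superSign]
    · obtain rfl : v = 0 := (D21.mem_part_zero _).1 hX
      obtain rfl : B = 0 := (D21.mem_part_one _).1 hY
      refine Prod.ext (funext fun i => ?_) ?_
      · simp [D21.brFun, D21.oddBr_zero_left, D21.oddBr_zero_right, superSign]
      · simp [D21.brFun, superSign]
    · obtain rfl : A = 0 := (D21.mem_part_one _).1 hX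
      obtain rfl : w = 0 := (D21.mem_part_zero _).1 hY
      refine Prod.ext (funext fun i => ?_) ?_
      · simp [D21.brFun, D21.oddBr_zero_left, D21.oddBr_zero_right, superSign]
      · simp [D21.brFun, superSign]
    · obtain rfl : A = 0 := (D21.mem_part_one _).1 hX
      obtain rfl : B = 0 := (D21.mem_part_one _).1 hY
      refine Prod.ext (funext fun i => ?_) ?_
      · simp [D21.brFun, superSign, D21.oddBr_symm a v]
      · simp [D21.brFun, superSign, D21.act_zero_left]
  jacobi := by
    rintro i j k ⟨A, u⟩ ⟨B, v⟩ ⟨C, w⟩ hX hY hZ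
    change D21.brFun a (A, u) (D21.brFun a (B, v) (C, w)) =
      D21.brFun a (D21.brFun a (A, u) (B, v)) (C, w) +
        superSign i j • D21.brFun a (B, v) (D21.brFun a (A, u) (C, w))
    have z : (fun _ : Fin 3 => (0 : LieAlgebra.SpecialLinear.sl (Fin 2) ℂ)) = 0 := rfl
    have eq : ∀ (A : D21.Even) (v w : D21.Odd) (l : Fin 3), ⁅A l, D21.oddBr a v w l⁆ =
        D21.oddBr a (D21.act A v) w l + D21.oddBr a v (D21.act A w) l := fun A v w l =>
      congrFun (D21.oddBr_equivariant a A v w) l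
    have al := D21.act_lie
    rcases D21.mem_part_cases i with rfl | rfl <;> rcases D21.mem_part_cases j with rfl | rfl <;>
      rcases D21.mem_part_cases k with rfl | rfl <;>
      simp only [D21.mem_part_zero, D21.mem_part_one] at hX hY hZ <;> subst hX hY hZ <;>
      refine Prod.ext (funext fun l => ?_) ?_ <;>
      simp [D21.brFun, superSign, D21.oddBr_zero_left, D21.oddBr_zero_right,
        D21.act_zero_left, D21.act_zero_right, z, al, D21.oddBr_symm a]
    · rw [D21.act_neg_right]
      abel
    · rw [eq, D21.oddBr_symm a w]
    · rw [D21.act_neg_right, D21.act_neg_right]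
      abel
    · rw [eq, D21.oddBr_neg_right, D21.oddBr_symm a w]
      simp
    · rw [← lie_skew, eq, D21.oddBr_neg_right, D21.oddBr_neg_right, D21.oddBr_symm a v]
      simp
    · have h := D21.act_oddBr_cyclic a u v w
      rw [D21.oddBr_symm a w u] at h
      linear_combination (exp := 1) -h

/-! Minimality and the splitting force the odd part to be `U ⊕ [f, U]`, where `U` is the space of
odd vectors of weight `1/2` (`weight_of_primitive`, `odd_weight`, `bracket_x_bracket_x`). The
relation `[m, n] = ⟨m, n⟩ e` puts a nondegenerate symmetric form on `U`, and `[m, [f, n]]`,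
corrected by a multiple of `x`, gives elements `R(m, n)` of `𝔤^♮` acting on `U` by skew operators.
Write `R(m, n) = m ∧ n + T(m, n)`, where the wedge alone would give `osp(N|2)`, `N = dim U`. The
Jacobi identity makes `T` a four-form annihilated by all the operators `R(m, n)`. Simplicity makes
`𝔤^♮` act faithfully on `U` and be spanned by the `R(m, n)`, so `𝔤` is recovered from `T`
(`exists_isModel`). If `T` has real coordinates in some orthonormal frame of `U`, conjugation of
coordinates is the required involution: its fixed points in `𝔤^♮` are real skew-symmetric, hence
skew-Hermitian, matrices (`exists_isAlmostCompact`).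

It remains to find a frame in which `T` is real. The coordinate tensors of `T` in all frames form a
set stable under `O(N, ℂ)`. The key is a rigidity identity (`eq_of_lieAct_eq_zero`): for `N ≠ 4`,
two four-forms, each annihilated by the curvature operators of the other, are equal. A tensor of
minimal norm in the closure of this set is orthogonal to its orbit directions, in the manner of
Kempf and Ness; this makes the tensor and its conjugate annihilated by each other's curvature, so
the tensor is real (`conj_eq_of_minimal`). The linearized form of the same identity shows that a
slice transversal to the orbit contains no other invariant form nearby (`exists_slice`), so the
minimal tensor belongs to the set itself and not only to its closure (`exists_conj_eq`).

For `N = 4` the form is `c` times the volume form, and the curvature scales the two `sl₂` ideals of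
`so(4)` by `1 - c` and `1 + c`. If `c ≠ ±1` this is `D(2,1;a)` with `a = (1 + c)/(1 - c)`
(`isomorphic_D21`), and the hypothesis on `a` makes `c` real; `c = ±1` is real already. -/

/-! ### Four-tensors over `ℂ` -/

/-- Four-tensors in coordinates, with their standard Hermitian norm. -/
abbrev Tensor4 (ι : Type*) : Type _ := EuclideanSpace ℂ (ι × ι × ι × ι)

namespace Tensor4

set_option linter.unusedSectionVars false

variable {ι : Type*} [Fintype ι]

/-- Total antisymmetry. -/
structure IsAlternating (T : Tensor4 ι) : Prop where
  swap_one_two : ∀ i j k l, T (j, i, k, l) = -T (i, j, k, l)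
  swap_two_three : ∀ i j k l, T (i, k, j, l) = -T (i, j, k, l)
  swap_three_four : ∀ i j k l, T (i, j, l, k) = -T (i, j, k, l)

/-- A matrix acting on the first index. -/
def slotOne : Matrix ι ι ℂ →ₗ[ℂ] Tensor4 ι →ₗ[ℂ] Tensor4 ι :=
  LinearMap.mk₂ ℂ (fun A T => WithLp.toLp 2 fun x => ∑ p, A x.1 p * T (p, x.2.1, x.2.2.1, x.2.2.2))
    (fun A B T => by ext x; simp [add_mul, Finset.sum_add_distrib])
    (fun c A T => by ext x; simp [Finset.mul_sum, mul_assoc])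
    (fun A S T => by ext x; simp [mul_add, Finset.sum_add_distrib])
    (fun c A T => by ext x; simp [Finset.mul_sum, mul_left_comm])

/-- A matrix acting on the second index. -/
def slotTwo : Matrix ι ι ℂ →ₗ[ℂ] Tensor4 ι →ₗ[ℂ] Tensor4 ι :=
  LinearMap.mk₂ ℂ
    (fun A T => WithLp.toLp 2 fun x => ∑ p, A x.2.1 p * T (x.1, p, x.2.2.1, x.2.2.2))
    (fun A B T => by ext x; simp [add_mul, Finset.sum_add_distrib])
    (fun c A T => by ext x; simp [Finset.mul_sum, mul_assoc])
    (fun A S T => by ext x; simp [mul_add, Finset.sum_add_distrib])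
    (fun c A T => by ext x; simp [Finset.mul_sum, mul_left_comm])

/-- A matrix acting on the third index. -/
def slotThree : Matrix ι ι ℂ →ₗ[ℂ] Tensor4 ι →ₗ[ℂ] Tensor4 ι :=
  LinearMap.mk₂ ℂ
    (fun A T => WithLp.toLp 2 fun x => ∑ p, A x.2.2.1 p * T (x.1, x.2.1, p, x.2.2.2))
    (fun A B T => by ext x; simp [add_mul, Finset.sum_add_distrib])
    (fun c A T => by ext x; simp [Finset.mul_sum, mul_assoc])
    (fun A S T => by ext x; simp [mul_add, Finset.sum_add_distrib])
    (fun c A T => by ext x; simp [Finset.mul_sum, mul_left_comm])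

/-- A matrix acting on the fourth index. -/
def slotFour : Matrix ι ι ℂ →ₗ[ℂ] Tensor4 ι →ₗ[ℂ] Tensor4 ι :=
  LinearMap.mk₂ ℂ
    (fun A T => WithLp.toLp 2 fun x => ∑ p, A x.2.2.2 p * T (x.1, x.2.1, x.2.2.1, p))
    (fun A B T => by ext x; simp [add_mul, Finset.sum_add_distrib])
    (fun c A T => by ext x; simp [Finset.mul_sum, mul_assoc])
    (fun A S T => by ext x; simp [mul_add, Finset.sum_add_distrib])
    (fun c A T => by ext x; simp [Finset.mul_sum, mul_left_comm])

@[simp] lemma slotOne_apply (A : Matrix ι ι ℂ) (T : Tensor4 ι) (x) :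
    slotOne A T x = ∑ p, A x.1 p * T (p, x.2.1, x.2.2.1, x.2.2.2) := rfl

@[simp] lemma slotTwo_apply (A : Matrix ι ι ℂ) (T : Tensor4 ι) (x) :
    slotTwo A T x = ∑ p, A x.2.1 p * T (x.1, p, x.2.2.1, x.2.2.2) := rfl

@[simp] lemma slotThree_apply (A : Matrix ι ι ℂ) (T : Tensor4 ι) (x) :
    slotThree A T x = ∑ p, A x.2.2.1 p * T (x.1, x.2.1, p, x.2.2.2) := rfl

@[simp] lemma slotFour_apply (A : Matrix ι ι ℂ) (T : Tensor4 ι) (x) :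
    slotFour A T x = ∑ p, A x.2.2.2 p * T (x.1, x.2.1, x.2.2.1, p) := rfl

/-! Each slot is a representation of the algebra of matrices, and different slots commute. -/

lemma slotOne_mul (A B : Matrix ι ι ℂ) (T : Tensor4 ι) :
    slotOne (A * B) T = slotOne A (slotOne B T) := by
  ext x
  simp only [slotOne_apply, Matrix.mul_apply, Finset.sum_mul, Finset.mul_sum, mul_assoc]
  exact Finset.sum_comm

lemma slotTwo_mul (A B : Matrix ι ι ℂ) (T : Tensor4 ι) :
    slotTwo (A * B) T = slotTwo A (slotTwo B T) := by
  ext x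
  simp only [slotTwo_apply, Matrix.mul_apply, Finset.sum_mul, Finset.mul_sum, mul_assoc]
  exact Finset.sum_comm

lemma slotThree_mul (A B : Matrix ι ι ℂ) (T : Tensor4 ι) :
    slotThree (A * B) T = slotThree A (slotThree B T) := by
  ext x
  simp only [slotThree_apply, Matrix.mul_apply, Finset.sum_mul, Finset.mul_sum, mul_assoc]
  exact Finset.sum_comm

lemma slotFour_mul (A B : Matrix ι ι ℂ) (T : Tensor4 ι) :
    slotFour (A * B) T = slotFour A (slotFour B T) := by
  ext x
  simp only [slotFour_apply, Matrix.mul_apply, Finset.sum_mul, Finset.mul_sum, mul_assoc]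
  exact Finset.sum_comm

lemma slotOne_slotTwo (A B : Matrix ι ι ℂ) (T : Tensor4 ι) :
    slotOne A (slotTwo B T) = slotTwo B (slotOne A T) := by
  ext x
  simp only [slotOne_apply, slotTwo_apply, Finset.mul_sum, mul_left_comm]
  exact Finset.sum_comm

lemma slotOne_slotThree (A B : Matrix ι ι ℂ) (T : Tensor4 ι) :
    slotOne A (slotThree B T) = slotThree B (slotOne A T) := by
  ext x
  simp only [slotOne_apply, slotThree_apply, Finset.mul_sum, mul_left_comm]
  exact Finset.sum_comm

lemma slotOne_slotFour (A B : Matrix ι ι ℂ) (T : Tensor4 ι) :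
    slotOne A (slotFour B T) = slotFour B (slotOne A T) := by
  ext x
  simp only [slotOne_apply, slotFour_apply, Finset.mul_sum, mul_left_comm]
  exact Finset.sum_comm

lemma slotTwo_slotThree (A B : Matrix ι ι ℂ) (T : Tensor4 ι) :
    slotTwo A (slotThree B T) = slotThree B (slotTwo A T) := by
  ext x
  simp only [slotTwo_apply, slotThree_apply, Finset.mul_sum, mul_left_comm]
  exact Finset.sum_comm

lemma slotTwo_slotFour (A B : Matrix ι ι ℂ) (T : Tensor4 ι) :
    slotTwo A (slotFour B T) = slotFour B (slotTwo A T) := by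
  ext x
  simp only [slotTwo_apply, slotFour_apply, Finset.mul_sum, mul_left_comm]
  exact Finset.sum_comm

lemma slotThree_slotFour (A B : Matrix ι ι ℂ) (T : Tensor4 ι) :
    slotThree A (slotFour B T) = slotFour B (slotThree A T) := by
  ext x
  simp only [slotThree_apply, slotFour_apply, Finset.mul_sum, mul_left_comm]
  exact Finset.sum_comm

/-- The derivation action of a matrix on four-tensors. -/
def lieAct : Matrix ι ι ℂ →ₗ[ℂ] Tensor4 ι →ₗ[ℂ] Tensor4 ι :=
  slotOne + slotTwo + slotThree + slotFour

lemma lieAct_eq (A : Matrix ι ι ℂ) (T : Tensor4 ι) :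
    lieAct A T = slotOne A T + slotTwo A T + slotThree A T + slotFour A T := rfl

lemma lieAct_apply (A : Matrix ι ι ℂ) (T : Tensor4 ι) (i j k l : ι) :
    lieAct A T (i, j, k, l) = ∑ p, A i p * T (p, j, k, l) + ∑ p, A j p * T (i, p, k, l) +
      ∑ p, A k p * T (i, j, p, l) + ∑ p, A l p * T (i, j, k, p) := rfl

lemma lieAct_lie (A B : Matrix ι ι ℂ) (T : Tensor4 ι) :
    lieAct (A * B - B * A) T = lieAct A (lieAct B T) - lieAct B (lieAct A T) := by
  simp only [lieAct_eq, map_sub, map_add, LinearMap.sub_apply, slotOne_mul, slotTwo_mul,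
    slotThree_mul, slotFour_mul, slotOne_slotTwo, slotOne_slotThree, slotOne_slotFour,
    slotTwo_slotThree, slotTwo_slotFour, slotThree_slotFour]
  abel

/-- The action of a matrix on all four indices. -/
def act (g : Matrix ι ι ℂ) (T : Tensor4 ι) : Tensor4 ι :=
  slotOne g (slotTwo g (slotThree g (slotFour g T)))

lemma act_mul (g h : Matrix ι ι ℂ) (T : Tensor4 ι) : act (g * h) T = act g (act h T) := by
  simp only [act, slotOne_mul, slotTwo_mul, slotThree_mul, slotFour_mul, slotOne_slotTwo,
    slotOne_slotThree, slotOne_slotFour, slotTwo_slotThree, slotTwo_slotFour, slotThree_slotFour]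

lemma inner_slotOne (A : Matrix ι ι ℂ) (S T : Tensor4 ι) :
    inner ℂ (slotOne A S) T = inner ℂ S (slotOne A.conjTranspose T) := by
  simp only [PiLp.inner_apply, RCLike.inner_apply, slotOne_apply, map_sum, map_mul,
    Finset.mul_sum, Finset.sum_mul, Matrix.conjTranspose_apply]
  rw [← Fintype.sum_prod_type', ← Fintype.sum_prod_type']
  -- Exchanging the summation index with the contracted index is an involution of the domain of
  -- summation.
  exact Fintype.sum_equiv
    ⟨fun y => ((y.2, y.1.2.1, y.1.2.2.1, y.1.2.2.2), y.1.1),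
      fun y => ((y.2, y.1.2.1, y.1.2.2.1, y.1.2.2.2), y.1.1), fun _ => rfl, fun _ => rfl⟩
    _ _ fun y => mul_left_comm _ _ _ |>.trans (mul_assoc _ _ _).symm

lemma inner_slotTwo (A : Matrix ι ι ℂ) (S T : Tensor4 ι) :
    inner ℂ (slotTwo A S) T = inner ℂ S (slotTwo A.conjTranspose T) := by
  simp only [PiLp.inner_apply, RCLike.inner_apply, slotTwo_apply, map_sum, map_mul,
    Finset.mul_sum, Finset.sum_mul, Matrix.conjTranspose_apply]
  rw [← Fintype.sum_prod_type', ← Fintype.sum_prod_type']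
  exact Fintype.sum_equiv
    ⟨fun y => ((y.1.1, y.2, y.1.2.2.1, y.1.2.2.2), y.1.2.1),
      fun y => ((y.1.1, y.2, y.1.2.2.1, y.1.2.2.2), y.1.2.1), fun _ => rfl, fun _ => rfl⟩
    _ _ fun y => mul_left_comm _ _ _ |>.trans (mul_assoc _ _ _).symm

lemma inner_slotThree (A : Matrix ι ι ℂ) (S T : Tensor4 ι) :
    inner ℂ (slotThree A S) T = inner ℂ S (slotThree A.conjTranspose T) := by
  simp only [PiLp.inner_apply, RCLike.inner_apply, slotThree_apply, map_sum, map_mul,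
    Finset.mul_sum, Finset.sum_mul, Matrix.conjTranspose_apply]
  rw [← Fintype.sum_prod_type', ← Fintype.sum_prod_type']
  exact Fintype.sum_equiv
    ⟨fun y => ((y.1.1, y.1.2.1, y.2, y.1.2.2.2), y.1.2.2.1),
      fun y => ((y.1.1, y.1.2.1, y.2, y.1.2.2.2), y.1.2.2.1), fun _ => rfl, fun _ => rfl⟩
    _ _ fun y => mul_left_comm _ _ _ |>.trans (mul_assoc _ _ _).symm

lemma inner_slotFour (A : Matrix ι ι ℂ) (S T : Tensor4 ι) :
    inner ℂ (slotFour A S) T = inner ℂ S (slotFour A.conjTranspose T) := by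
  simp only [PiLp.inner_apply, RCLike.inner_apply, slotFour_apply, map_sum, map_mul,
    Finset.mul_sum, Finset.sum_mul, Matrix.conjTranspose_apply]
  rw [← Fintype.sum_prod_type', ← Fintype.sum_prod_type']
  exact Fintype.sum_equiv
    ⟨fun y => ((y.1.1, y.1.2.1, y.1.2.2.1, y.2), y.1.2.2.2),
      fun y => ((y.1.1, y.1.2.1, y.1.2.2.1, y.2), y.1.2.2.2), fun _ => rfl, fun _ => rfl⟩
    _ _ fun y => mul_left_comm _ _ _ |>.trans (mul_assoc _ _ _).symm

lemma inner_lieAct (A : Matrix ι ι ℂ) (S T : Tensor4 ι) :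
    inner ℂ (lieAct A S) T = inner ℂ S (lieAct A.conjTranspose T) := by
  simp only [lieAct_eq, inner_add_left, inner_add_right, inner_slotOne, inner_slotTwo,
    inner_slotThree, inner_slotFour]

/-- Complex conjugation of the coordinates. -/
def conj (T : Tensor4 ι) : Tensor4 ι := WithLp.toLp 2 fun x => starRingEnd ℂ (T x)

@[simp] lemma conj_apply (T : Tensor4 ι) (x) : conj T x = starRingEnd ℂ (T x) := rfl

lemma conj_lieAct (A : Matrix ι ι ℂ) (T : Tensor4 ι) :
    conj (lieAct A T) = lieAct (A.map (starRingEnd ℂ)) (conj T) := by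
  ext ⟨i, j, k, l⟩
  simp [lieAct_apply]

/-! ### Alternating four-forms, their curvature operators, and rigidity -/

section Form

variable [DecidableEq ι]

/-- The matrix with entries `T a b k l`. -/
def formMatrix (T : Tensor4 ι) (a b : ι) : Matrix ι ι ℂ := Matrix.of fun k l => T (a, b, k, l)

/-- The elementary skew-symmetric matrix `E_ab - E_ba`. -/
def wedgeMatrix (a b : ι) : Matrix ι ι ℂ :=
  Matrix.of fun k l => (if a = k then 1 else 0) * (if b = l then 1 else 0) -
    (if a = l then 1 else 0) * (if b = k then 1 else 0)

/-- The operators `a ∧ b + T(a, b)`. -/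
def curvature (T : Tensor4 ι) (a b : ι) : Matrix ι ι ℂ := wedgeMatrix a b + formMatrix T a b

lemma curvature_apply (T : Tensor4 ι) (a b k l : ι) : curvature T a b k l =
    (if a = k then 1 else 0) * (if b = l then 1 else 0) -
    (if a = l then 1 else 0) * (if b = k then 1 else 0) + T (a, b, k, l) := rfl

/-- The four-form is invariant under its curvature operators. -/
def IsInvariant (T : Tensor4 ι) : Prop := ∀ a b, lieAct (curvature T a b) T = 0

lemma IsAlternating.transpose_formMatrix {T : Tensor4 ι} (hT : T.IsAlternating) (a b : ι) :
    (formMatrix T a b).transpose = -formMatrix T a b := by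
  ext k l
  exact hT.swap_three_four a b k l

lemma transpose_wedgeMatrix (a b : ι) : (wedgeMatrix a b).transpose = -wedgeMatrix a b := by
  ext k l
  simp [wedgeMatrix]

lemma IsAlternating.transpose_curvature {T : Tensor4 ι} (hT : T.IsAlternating) (a b : ι) :
    (curvature T a b).transpose = -curvature T a b := by
  rw [curvature, Matrix.transpose_add, hT.transpose_formMatrix, transpose_wedgeMatrix, neg_add]

/-- The contraction of `S ⊗ T` over one index of each of the two index pairs. -/
def pairContract (S T : Tensor4 ι) (i j k l : ι) : ℂ := ∑ p, ∑ q, S (i, j, p, q) * T (p, q, k, l)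

lemma IsAlternating.swap_pairs {T : Tensor4 ι} (hT : T.IsAlternating) (i j k l : ι) :
    T (k, l, i, j) = T (i, j, k, l) := by
  rw [hT.swap_two_three k i l j, hT.swap_one_two i k l j, hT.swap_three_four i k j l,
    hT.swap_two_three i j k l]
  simp

lemma IsAlternating.apply_self_one_two {T : Tensor4 ι} (hT : T.IsAlternating) (i k l : ι) :
    T (i, i, k, l) = 0 := self_eq_neg.mp (hT.swap_one_two i i k l)

lemma IsAlternating.apply_self_two_three {T : Tensor4 ι} (hT : T.IsAlternating) (i j l : ι) :
    T (i, j, j, l) = 0 := self_eq_neg.mp (hT.swap_two_three i j j l)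

/-- The first slot contributes `1 - N` and, by antisymmetry, each of the other three slots
contributes `1`. This total `4 - N` is the reason why dimension four is exceptional. -/
lemma sum_lieAct_wedgeMatrix {T : Tensor4 ι} (hT : T.IsAlternating) (a j k l : ι) :
    ∑ b, lieAct (wedgeMatrix a b) T (b, j, k, l) = (4 - Fintype.card ι) * T (a, j, k, l) := by
  have h1 : T (j, a, k, l) = -T (a, j, k, l) := hT.swap_one_two _ _ _ _
  have h2 : ∀ b i j l, T (j, i, b, l) = -T (b, i, j, l) := fun b i j l => by
    rw [hT.swap_one_two i j b l, hT.swap_two_three i b j l, hT.swap_one_two b i j l, neg_neg]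
  have h3 : T (l, j, k, a) = -T (a, j, k, l) := by
    rw [hT.swap_three_four l j a k, h2 a j l k, hT.swap_three_four a j k l]
    simp
  have z1 : ∀ b, T (b, b, k, l) = 0 := fun b => hT.apply_self_one_two b k l
  have z2 : ∀ b, T (b, j, b, l) = 0 := fun b => self_eq_neg.mp (h2 b j b l)
  have z3 : ∀ b, T (b, j, k, b) = 0 := fun b => by
    rw [hT.swap_three_four b j b k, self_eq_neg.mp (h2 b j b k), neg_zero]
  simp only [lieAct_apply, wedgeMatrix, Matrix.of_apply, sub_mul, Finset.sum_add_distrib,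
    Finset.sum_sub_distrib, ite_mul, one_mul, zero_mul, Finset.sum_ite_eq,
    Finset.mem_univ, if_true, Finset.sum_ite_irrel, Finset.sum_const_zero, z1, z2, z3,
    ite_self, Finset.sum_ite_eq', h1, h2 a j k l, h3, Finset.sum_const, Finset.card_univ,
    nsmul_eq_mul]
  ring

/-- The first slot vanishes because `S` is evaluated on a repeated index; each of the other slots is
a contraction over two indices. -/
lemma sum_lieAct_formMatrix {S T : Tensor4 ι} (hS : S.IsAlternating) (hT : T.IsAlternating)
    (a j k l : ι) : ∑ b, lieAct (formMatrix S a b) T (b, j, k, l) =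
      - pairContract S T a j k l + pairContract S T a k j l - pairContract S T a l j k := by
  have h1 : ∀ b p, S (a, b, b, p) = 0 := fun b p => hS.apply_self_two_three a b p
  have h3 : ∀ b p, T (b, j, p, l) = -T (b, p, j, l) := fun b p => hT.swap_two_three _ _ _ _
  have h4 : ∀ b p, T (b, j, k, p) = T (b, p, j, k) := fun b p => by
    rw [hT.swap_three_four, hT.swap_two_three, neg_neg]
  have h5 : ∀ m b p, S (a, b, m, p) = -S (a, m, b, p) := fun m b p => hS.swap_two_three _ _ _ _
  simp only [lieAct_apply, formMatrix, Matrix.of_apply, h1, h3, h4, h5 j, h5 k, h5 l,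
    Finset.sum_add_distrib, pairContract, neg_mul, mul_neg, Finset.sum_neg_distrib, neg_neg,
    zero_mul, Finset.sum_const_zero]
  ring

lemma sum_lieAct_curvature {S T : Tensor4 ι} (hS : S.IsAlternating) (hT : T.IsAlternating)
    (a j k l : ι) : ∑ b, lieAct (curvature S a b) T (b, j, k, l) =
      (4 - Fintype.card ι) * T (a, j, k, l) - pairContract S T a j k l +
        pairContract S T a k j l - pairContract S T a l j k := by
  simp only [curvature, map_add, LinearMap.add_apply, PiLp.add_apply, Finset.sum_add_distrib,
    sum_lieAct_wedgeMatrix hT, sum_lieAct_formMatrix hS hT]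
  ring

/-- Rigidity identity: two four-forms, each of them invariant under the curvature operators of the
other one, coincide outside dimension four. -/
lemma IsAlternating.eq_of_lieAct_eq_zero {S T : Tensor4 ι} (hS : S.IsAlternating)
    (hT : T.IsAlternating) (hST : ∀ a b, lieAct (curvature S a b) T = 0)
    (hTS : ∀ a b, lieAct (curvature T a b) S = 0) (hcard : Fintype.card ι ≠ 4) : S = T := by
  -- The traced invariance expresses `(4 - N) T` through contractions of `S` with `T`.
  have key : ∀ {S T : Tensor4 ι}, S.IsAlternating → T.IsAlternating →
      (∀ a b, lieAct (curvature S a b) T = 0) → ∀ a j k l,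
      (4 - (Fintype.card ι : ℂ)) * T (a, j, k, l) = pairContract S T a j k l -
        pairContract S T a k j l + pairContract S T a l j k := by
    intro S T hS hT h a j k l
    have := sum_lieAct_curvature hS hT a j k l
    simp only [h, PiLp.zero_apply, Finset.sum_const_zero] at this
    linear_combination -this
  -- Exchanging `S` and `T` amounts to exchanging the two free index pairs.
  have symm : ∀ i j k l, pairContract T S i j k l = pairContract S T k l i j := by
    intro i j k l
    rw [pairContract, pairContract]
    refine Finset.sum_congr rfl fun p _ => Finset.sum_congr rfl fun q _ => ?_
    rw [hT.swap_pairs, hS.swap_pairs, mul_comm]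
  have anti1 : ∀ i j k l, pairContract S T j i k l = -pairContract S T i j k l := by
    intro i j k l
    simp only [pairContract, hS.swap_one_two i j, neg_mul, Finset.sum_neg_distrib]
  have anti2 : ∀ i j k l, pairContract S T i j l k = -pairContract S T i j k l := by
    intro i j k l
    simp only [pairContract, hT.swap_three_four _ _ k l, mul_neg, Finset.sum_neg_distrib]
  have full : ∀ {T : Tensor4 ι}, T.IsAlternating → ∀ a j k l, T (j, a, k, l) = -T (a, j, k, l) ∧
      T (k, a, j, l) = T (a, j, k, l) ∧ T (l, a, j, k) = -T (a, j, k, l) := by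
    intro T hT a j k l
    have e : ∀ a j k l, T (k, a, j, l) = T (a, j, k, l) := fun a j k l => by
      rw [hT.swap_one_two a k j l, hT.swap_two_three a j k l, neg_neg]
    exact ⟨hT.swap_one_two _ _ _ _, e a j k l, by
      rw [e a j l k, hT.swap_three_four a j k l]⟩
  ext ⟨a, j, k, l⟩
  obtain ⟨t1, t2, t3⟩ := full hT a j k l
  obtain ⟨s1, s2, s3⟩ := full hS a j k l
  have kT := key hS hT hST
  have kS := key hT hS hTS
  have a1 := kT a j k l
  have a2 := kT j a k l
  have a3 := kT k a j l
  have a4 := kT l a j k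
  have b1 := kS a j k l
  have b2 := kS j a k l
  have b3 := kS k a j l
  have b4 := kS l a j k
  simp only [symm] at b1 b2 b3 b4
  rw [t1] at a2; rw [t2] at a3; rw [t3] at a4
  rw [s1] at b2; rw [s2] at b3; rw [s3] at b4
  have hc : (4 - (Fintype.card ι : ℂ)) ≠ 0 := by
    rw [sub_ne_zero]
    exact_mod_cast hcard.symm
  -- The factor `4` counts the choices of the index put first. The signed sum over these choices
  -- antisymmetrizes the contraction over all splittings of the indices into two pairs; that
  -- expression is unchanged when the pairs are exchanged, hence is the same for `(S, T)` and `(T,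
  -- S)`.
  refine mul_left_cancel₀ hc (mul_left_cancel₀ (by norm_num : (4 : ℂ) ≠ 0) ?_)
  have anti3 := fun c d i j => anti2 i j c d
  rw [anti1 a j] at a2
  rw [anti1 a k, anti1 j k] at a3
  rw [anti1 a l, anti1 j l, anti1 k l] at a4
  rw [anti3 a j] at b2
  rw [anti3 a k, anti3 j k] at b3
  rw [anti3 a l, anti3 j l, anti3 k l] at b4
  linear_combination b1 - b2 + b3 - b4 - (a1 - a2 + a3 - a4)

end Form

end Tensor4

namespace Tensor4

set_option linter.unusedSectionVars false

variable {ι : Type*} [Fintype ι] [DecidableEq ι]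

/-! ### The complex orthogonal action and tensors of minimal norm -/

section Calculus

open scoped Matrix.Norms.Operator

lemma slotOne_one (T : Tensor4 ι) : slotOne 1 T = T := by
  ext x
  simp [Matrix.one_apply]

lemma slotTwo_one (T : Tensor4 ι) : slotTwo 1 T = T := by
  ext x
  simp [Matrix.one_apply]

lemma slotThree_one (T : Tensor4 ι) : slotThree 1 T = T := by
  ext x
  simp [Matrix.one_apply]

lemma slotFour_one (T : Tensor4 ι) : slotFour 1 T = T := by
  ext x
  simp [Matrix.one_apply]

lemma act_one (T : Tensor4 ι) : act 1 T = T := by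
  simp only [act, slotOne_one, slotTwo_one, slotThree_one, slotFour_one]

/-- The Leibniz rule at a point where the matrix is the identity, which removes the factor `B (g
x)`; one use per slot differentiates the full action. -/
lemma hasStrictFDerivAt_slot {X : Type*} [NormedAddCommGroup X] [NormedSpace ℂ X]
    {B : Matrix ι ι ℂ →ₗ[ℂ] Tensor4 ι →ₗ[ℂ] Tensor4 ι} (hB : ∀ T, B 1 T = T)
    {g : X → Matrix ι ι ℂ} {g' : X →L[ℂ] Matrix ι ι ℂ} {h : X → Tensor4 ι}
    {h' : X →L[ℂ] Tensor4 ι} {x : X} (hg : HasStrictFDerivAt g g' x) (hgx : g x = 1)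
    (hh : HasStrictFDerivAt h h' x) :
    HasStrictFDerivAt (fun y => B (g y) (h y))
      (h' + ((LinearMap.toContinuousBilinearMap B).flip (h x)).comp g') x := by
  refine ((LinearMap.toContinuousBilinearMap B).hasStrictFDerivAt_of_bilinear hg hh).congr_fderiv ?_
  ext1 v
  change B (g x) (h' v) + B (g' v) (h x) = h' v + B (g' v) (h x)
  rw [hgx, hB]

/-- The derivative at the identity of the action of matrices on four-tensors. -/
lemma hasStrictFDerivAt_act {X : Type*} [NormedAddCommGroup X] [NormedSpace ℂ X]
    {g : X → Matrix ι ι ℂ} {g' : X →L[ℂ] Matrix ι ι ℂ} {h : X → Tensor4 ι}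
    {h' : X →L[ℂ] Tensor4 ι} {x : X} (hg : HasStrictFDerivAt g g' x) (hgx : g x = 1)
    (hh : HasStrictFDerivAt h h' x) :
    HasStrictFDerivAt (fun y => act (g y) (h y))
      (h' + ((LinearMap.toContinuousBilinearMap lieAct).flip (h x)).comp g') x := by
  have h4 := hasStrictFDerivAt_slot slotFour_one hg hgx hh
  have h3 := hasStrictFDerivAt_slot slotThree_one hg hgx h4
  have h2 := hasStrictFDerivAt_slot slotTwo_one hg hgx h3
  refine (hasStrictFDerivAt_slot slotOne_one hg hgx h2).congr_fderiv ?_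
  ext1 v
  change h' v + slotFour (g' v) (h x) + slotThree (g' v) (slotFour (g x) (h x)) +
    slotTwo (g' v) (slotThree (g x) (slotFour (g x) (h x))) +
    slotOne (g' v) (slotTwo (g x) (slotThree (g x) (slotFour (g x) (h x)))) =
    h' v + lieAct (g' v) (h x)
  rw [lieAct_eq, hgx, slotFour_one, slotThree_one, slotTwo_one]
  abel

lemma exp_mul_transpose {A : Matrix ι ι ℂ} (hA : A.transpose = -A) :
    NormedSpace.exp A * (NormedSpace.exp A).transpose = 1 := by
  rw [← Matrix.exp_transpose, hA, ← Matrix.exp_add_of_commute _ _ (Commute.neg_right (Commute.refl A))]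
  simp

lemma continuous_act (g : Matrix ι ι ℂ) : Continuous (act g) :=
  ((slotOne g).comp ((slotTwo g).comp ((slotThree g).comp (slotFour g)))).continuous_of_finiteDimensional

lemma hasStrictFDerivAt_exp {X : Type*} [NormedAddCommGroup X] [NormedSpace ℂ X]
    (f : X →L[ℂ] Matrix ι ι ℂ) : HasStrictFDerivAt (fun z => NormedSpace.exp (f z)) f 0 := by
  have h := hasStrictFDerivAt_exp_zero (𝕂 := ℂ) (𝔸 := Matrix ι ι ℂ)
  rw [← map_zero f] at h
  exact HasStrictFDerivAt.comp (0 : X) h f.hasStrictFDerivAt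

/-- A vector of minimal norm in its complex orthogonal orbit is orthogonal to the tangent space
of that orbit. -/
lemma inner_lieAct_eq_zero {T : Tensor4 ι}
    (hT : ∀ g : Matrix ι ι ℂ, g * g.transpose = 1 → ‖T‖ ≤ ‖act g T‖) {A : Matrix ι ι ℂ}
    (hA : A.transpose = -A) : inner ℂ T (lieAct A T) = 0 := by
  -- First variation: `‖exp(tA) T‖²` is minimal at `t = 0` over real `t`, and its derivative there
  -- is `2 Re ⟨T, A T⟩`.
  have re_zero : ∀ A : Matrix ι ι ℂ, A.transpose = -A → (inner ℂ T (lieAct A T)).re = 0 := by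
    intro A hA
    have hexp := hasStrictFDerivAt_exp ((ContinuousLinearMap.id ℂ ℂ).smulRight A)
    have hd := (hasStrictFDerivAt_act hexp (by simp)
      (hasStrictFDerivAt_const T (0 : ℂ))).hasFDerivAt.hasDerivAt
    rw [← Complex.ofReal_zero] at hd
    have hr := HasDerivAt.scomp (0 : ℝ) hd Complex.ofRealCLM.hasDerivAt
    have hr : HasDerivAt (fun t : ℝ => act (NormedSpace.exp ((t : ℂ) • A)) T) (lieAct A T) 0 := by
      refine hr.congr_deriv ?_
      change Complex.ofRealCLM 1 • ((0 : Tensor4 ι) + lieAct ((1 : ℂ) • A) T) = lieAct A T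
      rw [Complex.ofRealCLM_apply, Complex.ofReal_one, one_smul, one_smul, zero_add]
    have hn := Complex.reCLM.hasFDerivAt.comp_hasDerivAt (0 : ℝ) (hr.inner ℂ hr)
    have hmin : IsLocalMin (Complex.reCLM ∘ fun t : ℝ =>
        inner ℂ (act (NormedSpace.exp ((t : ℂ) • A)) T) (act (NormedSpace.exp ((t : ℂ) • A)) T))
        0 := by
      refine Filter.Eventually.of_forall fun t => ?_
      have ht := hT _ (exp_mul_transpose (A := (t : ℂ) • A)
        (by rw [Matrix.transpose_smul, hA, smul_neg]))
      simp only [Function.comp_apply, Complex.reCLM_apply, inner_self_eq_norm_sq_to_K,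
        Complex.ofReal_zero, zero_smul, NormedSpace.exp_zero, act_one]
      norm_cast
      exact pow_le_pow_left₀ (norm_nonneg _) ht 2
    have h0 := hmin.hasDerivAt_eq_zero hn
    simp only [Complex.reCLM_apply, Complex.add_re, Complex.ofReal_zero, zero_smul,
      NormedSpace.exp_zero, act_one] at h0
    rw [← inner_conj_symm (lieAct A T) T, Complex.conj_re] at h0
    linarith
  refine Complex.ext (re_zero A hA) ?_
  -- Skew-symmetric matrices form a complex space, so `iA` is allowed and yields the imaginary part.
  have := re_zero (Complex.I • A) (by rw [Matrix.transpose_smul, hA, smul_neg])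
  simpa using this

end Calculus

/-- The subspace of alternating tensors. -/
def alternatingSubmodule (ι : Type*) : Submodule ℂ (Tensor4 ι) where
  carrier := {T | T.IsAlternating}
  add_mem' hS hT := ⟨fun i j k l => by simp [hS.1 i j, hT.1 i j]; ring,
    fun i j k l => by simp [hS.2 i j k, hT.2 i j k]; ring,
    fun i j k l => by simp [hS.3 i j k, hT.3 i j k]; ring⟩
  zero_mem' := ⟨by simp, by simp, by simp⟩
  smul_mem' c _ hT := ⟨fun i j k l => by simp [hT.1 i j], fun i j k l => by simp [hT.2 i j k],
    fun i j k l => by simp [hT.3 i j k]⟩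

lemma isClosed_isAlternating : IsClosed {T : Tensor4 ι | T.IsAlternating} :=
  (alternatingSubmodule ι).closed_of_finiteDimensional

/-- The equations are polynomial in the coordinates of `T`, quadratic because the curvature itself
involves `T`. Closedness lets invariance pass to the minimal tensor in the closure. -/
lemma isClosed_isInvariant : IsClosed {T : Tensor4 ι | T.IsInvariant} := by
  have : {T : Tensor4 ι | T.IsInvariant} =
      ⋂ (a) (b) (i) (j) (k) (l), {T | lieAct (curvature T a b) T (i, j, k, l) = 0} := by
    ext T
    simp only [IsInvariant, Set.mem_ofPred_eq, Set.mem_iInter]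
    refine forall₂_congr fun a b => ⟨fun h i j k l => by rw [h]; rfl, fun h => ?_⟩
    ext ⟨i, j, k, l⟩
    exact h i j k l
  rw [this]
  simp only [lieAct_apply, curvature_apply]
  refine isClosed_iInter fun a => isClosed_iInter fun b => isClosed_iInter fun i =>
    isClosed_iInter fun j => isClosed_iInter fun k => isClosed_iInter fun l =>
    isClosed_eq (by fun_prop) continuous_const

lemma IsAlternating.conj {T : Tensor4 ι} (hT : T.IsAlternating) : (conj T).IsAlternating :=
  ⟨fun i j k l => by simp [hT.1 i j], fun i j k l => by simp [hT.2 i j k],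
    fun i j k l => by simp [hT.3 i j k]⟩

lemma conj_conj (T : Tensor4 ι) : conj (conj T) = T := by
  ext x
  simp

lemma map_conj_curvature (T : Tensor4 ι) (a b : ι) :
    (curvature T a b).map (starRingEnd ℂ) = curvature (conj T) a b := by
  ext k l
  simp [curvature_apply, apply_ite (starRingEnd ℂ)]

/-- An invariant four-form of minimal norm in its complex orthogonal orbit is real outside
dimension four. -/
lemma IsAlternating.conj_eq_of_minimal {T : Tensor4 ι} (hT : T.IsAlternating)
    (hinv : T.IsInvariant) (hmin : ∀ g : Matrix ι ι ℂ, g * g.transpose = 1 → ‖T‖ ≤ ‖act g T‖)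
    (hcard : Fintype.card ι ≠ 4) : Tensor4.conj T = T := by
  have key : ∀ a b, lieAct (curvature (Tensor4.conj T) a b) T = 0 := by
    intro a b
    set A := curvature T a b with hA
    have hAt : A.transpose = -A := hT.transpose_curvature a b
    -- Since `A` is skew-symmetric, its adjoint is minus its complex conjugate, and the wedge part
    -- of the curvature is real.
    have hAh : A.conjTranspose = -curvature (Tensor4.conj T) a b := by
      rw [← map_conj_curvature, Matrix.conjTranspose, hAt]
      ext k l
      simp [hA]
    set C := A.conjTranspose with hC
    have hCt : C.transpose = -C := by
      rw [hAh, Matrix.transpose_neg, hT.conj.transpose_curvature]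
    have h1 : lieAct A T = 0 := hinv a b
    -- As `A T = 0`, one has `‖C T‖² = ⟨T, A C T⟩ = ⟨T, [A, C] T⟩`; this vanishes because `[A, C]`
    -- is skew-symmetric and `T` is minimal.
    have h2 : lieAct (A * C - C * A) T = lieAct A (lieAct C T) := by
      rw [lieAct_lie, h1, map_zero, sub_zero]
    have h3 : inner ℂ T (lieAct (A * C - C * A) T) = 0 := by
      refine inner_lieAct_eq_zero hmin ?_
      rw [Matrix.transpose_sub, Matrix.transpose_mul, Matrix.transpose_mul, hAt, hCt]
      simp
    have h4 : inner ℂ (lieAct C T) (lieAct C T) = (0 : ℂ) := by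
      rw [inner_lieAct, hC, Matrix.conjTranspose_conjTranspose, ← hC, ← h2, h3]
    rw [inner_self_eq_zero] at h4
    rw [hAh, map_neg, LinearMap.neg_apply, neg_eq_zero] at h4
    exact h4
  refine hT.conj.eq_of_lieAct_eq_zero hT key (fun a b => ?_) hcard
  -- Conjugating the relation just proved gives the one with `T` and its conjugate exchanged, as
  -- rigidity requires.
  have := congrArg Tensor4.conj (key a b)
  rw [conj_lieAct, map_conj_curvature, conj_conj] at this
  rw [this]
  ext x
  simp

/-- The tangent space to the complex orthogonal orbit of a four-tensor. -/
def tangentSpace (T : Tensor4 ι) : Submodule ℂ (Tensor4 ι) :=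
  LinearMap.range (lieAct.flip T ∘ₗ
    (LinearMap.id - (Matrix.transposeLinearEquiv ι ι ℂ ℂ).toLinearMap))

lemma lieAct_mem_tangentSpace (T : Tensor4 ι) {A : Matrix ι ι ℂ} (hA : A.transpose = -A) :
    lieAct A T ∈ tangentSpace T := by
  -- The tangent space is parametrized by `A - Aᵀ`, which is `2A` on skew-symmetric matrices.
  refine ⟨(1 / 2 : ℂ) • A, ?_⟩
  change lieAct ((1 / 2 : ℂ) • A - ((1 / 2 : ℂ) • A).transpose) T = lieAct A T
  congr 2
  rw [Matrix.transpose_smul, hA, smul_neg, sub_neg_eq_add, ← add_smul]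
  norm_num

/-- Infinitesimal rigidity of a real invariant four-form outside dimension four. -/
lemma IsAlternating.eq_zero_of_linearized {T S : Tensor4 ι} (hT : T.IsAlternating)
    (hinv : T.IsInvariant) (hreal : Tensor4.conj T = T) (hcard : Fintype.card ι ≠ 4)
    (hS : S.IsAlternating) (hperp : S ∈ (tangentSpace T)ᗮ)
    (hlin : ∀ a b, lieAct (formMatrix S a b) T + lieAct (curvature T a b) S = 0) : S = 0 := by
  have hP : ∀ a b, (curvature T a b).conjTranspose = -curvature T a b := fun a b => by
    have h : (curvature T a b).map (starRingEnd ℂ) = curvature T a b := by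
      rw [map_conj_curvature, hreal]
    conv_rhs => rw [← h]
    rw [Matrix.conjTranspose, hT.transpose_curvature]
    ext k l
    simp
  -- Write `R` for the curvature operator, skew-Hermitian because `T` is real, and `F` for the form
  -- matrix of `S`. Then `‖R S‖² = -⟨R S, F T⟩ = ⟨S, R F T⟩ = ⟨S, [R, F] T⟩ = 0`, by `R T = 0` and
  -- the orthogonality of `S` to the orbit directions.
  have h1 : ∀ a b, lieAct (curvature T a b) S = 0 := by
    intro a b
    have e : lieAct (curvature T a b) S = -lieAct (formMatrix S a b) T :=
      eq_neg_of_add_eq_zero_right (hlin a b)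
    have hF := hS.transpose_formMatrix a b
    rw [← inner_self_eq_zero (𝕜 := ℂ)]
    nth_rewrite 2 [e]
    rw [inner_lieAct, hP, map_neg, map_neg, LinearMap.neg_apply, neg_neg]
    have h2 : lieAct (curvature T a b) (lieAct (formMatrix S a b) T) =
        lieAct (curvature T a b * formMatrix S a b - formMatrix S a b * curvature T a b) T := by
      rw [lieAct_lie, hinv a b, map_zero, sub_zero]
    rw [h2]
    refine (Submodule.mem_orthogonal' _ _).1 hperp _ (lieAct_mem_tangentSpace T ?_)
    rw [Matrix.transpose_sub, Matrix.transpose_mul, Matrix.transpose_mul, hF,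
      hT.transpose_curvature]
    simp
  have h2 : ∀ a b, lieAct (formMatrix S a b) T = 0 := fun a b => by
    have := hlin a b
    rwa [h1, add_zero] at this
  have hcurv : ∀ a b, curvature (T + S) a b = curvature T a b + formMatrix S a b := by
    intro a b
    ext k l
    simp [curvature_apply, formMatrix, add_assoc]
  -- Both halves of the linearized equation vanish, so `T` and `T + S` annihilate each other in the
  -- sense of the rigidity identity.
  have hTS : T = T + S := by
    refine hT.eq_of_lieAct_eq_zero ((alternatingSubmodule ι).add_mem hT hS) (fun a b => ?_)
      (fun a b => ?_) hcard
    · rw [map_add, hinv, h1, add_zero]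
    · rw [hcurv, map_add, LinearMap.add_apply, hinv, h2, add_zero]
  exact (add_eq_left.1 hTS.symm)

lemma curvature_add (T S : Tensor4 ι) (a b : ι) :
    curvature (T + S) a b = curvature T a b + formMatrix S a b := by
  ext k l
  simp [curvature_apply, formMatrix, add_assoc]

/-- Local rigidity: near a real invariant four-form, the slice transversal to the orbit contains no
other invariant four-form, outside dimension four. -/
lemma IsAlternating.exists_slice {T : Tensor4 ι} (hT : T.IsAlternating)
    (hinv : T.IsInvariant) (hreal : Tensor4.conj T = T) (hcard : Fintype.card ι ≠ 4) :
    ∃ δ > 0, ∀ S : Tensor4 ι, S.IsAlternating → S ∈ (tangentSpace T)ᗮ → ‖S‖ < δ →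
      (T + S).IsInvariant → S = 0 := by
  let K : Submodule ℂ (Tensor4 ι) := alternatingSubmodule ι ⊓ (tangentSpace T)ᗮ
  let F : K → ι × ι → Tensor4 ι := fun S x =>
    lieAct (curvature (T + (S : Tensor4 ι)) x.1 x.2) (T + (S : Tensor4 ι))
  let form : ι × ι → Tensor4 ι →ₗ[ℂ] Matrix ι ι ℂ := fun x =>
    { toFun := fun S => formMatrix S x.1 x.2
      map_add' := fun _ _ => rfl
      map_smul' := fun _ _ => rfl }
  let F' : K →ₗ[ℂ] ι × ι → Tensor4 ι := LinearMap.pi fun x =>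
    (lieAct.flip T ∘ₗ form x + lieAct (curvature T x.1 x.2)) ∘ₗ K.subtype
  -- The curvature is affine in `S`, so `F` is quadratic; its derivative at `0` is the linearized
  -- invariance equation.
  have hF : HasFDerivAt F (LinearMap.toContinuousLinearMap F') 0 := by
    rw [hasFDerivAt_pi']
    intro x
    have h1 : HasFDerivAt (fun S : K => T + (S : Tensor4 ι)) K.subtypeL 0 :=
      K.subtypeL.hasFDerivAt.const_add T
    have h2 := (LinearMap.toContinuousBilinearMap (lieAct ∘ₗ form x)).hasFDerivAt_of_bilinear
      K.subtypeL.hasFDerivAt h1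
    have h3 := (LinearMap.toContinuousLinearMap
      (lieAct (curvature T x.1 x.2))).hasFDerivAt.comp (0 : K) h1
    have h4 : (fun S : K => F S x) = fun S : K =>
        lieAct (formMatrix (S : Tensor4 ι) x.1 x.2) (T + (S : Tensor4 ι)) +
          lieAct (curvature T x.1 x.2) (T + (S : Tensor4 ι)) := by
      funext S
      simp only [F, curvature_add, map_add, LinearMap.add_apply]
      abel
    rw [h4]
    refine (h2.add h3).congr_fderiv ?_
    ext1 S
    change (lieAct (formMatrix (0 : Tensor4 ι) x.1 x.2) (S : Tensor4 ι) +
      lieAct (formMatrix (S : Tensor4 ι) x.1 x.2) (T + 0)) +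
        lieAct (curvature T x.1 x.2) (S : Tensor4 ι) =
      lieAct (formMatrix (S : Tensor4 ι) x.1 x.2) T + lieAct (curvature T x.1 x.2) (S : Tensor4 ι)
    have h0 : formMatrix (0 : Tensor4 ι) x.1 x.2 = 0 := rfl
    rw [h0, map_zero, LinearMap.zero_apply, zero_add, add_zero]
  have hker : LinearMap.ker F' = ⊥ := by
    rw [LinearMap.ker_eq_bot']
    intro S hS
    refine Subtype.ext (hT.eq_zero_of_linearized hinv hreal hcard S.2.1 S.2.2 fun a b => ?_)
    exact congrFun hS (a, b)
  -- An injective linear map in finite dimension is bounded below, so `F` has no zero in a punctured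
  -- neighbourhood of `0`.
  obtain ⟨C, -, hC⟩ := F'.exists_antilipschitzWith hker
  have hev := hF.eventually_ne (c := 0) ⟨C, hC⟩
  rw [eventually_nhdsWithin_iff, Metric.eventually_nhds_iff] at hev
  obtain ⟨δ, hδ, h⟩ := hev
  refine ⟨δ, hδ, fun S hS hperp hnorm hTS => ?_⟩
  by_contra hne
  refine h (y := ⟨S, hS, hperp⟩) (by simpa using hnorm) (fun h0 => hne (congrArg Subtype.val h0)) ?_
  exact funext fun x => hTS x.1 x.2

/-! ### Existence of a real tensor in a stable set of invariant forms -/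

section Orbit

open scoped Matrix.Norms.Operator

/-- A nonempty set of invariant four-forms, stable under the complex orthogonal group, contains a
real one, outside dimension four. -/
theorem exists_conj_eq {O : Set (Tensor4 ι)} (hne : O.Nonempty)
    (hact : ∀ g : Matrix ι ι ℂ, g * g.transpose = 1 → ∀ T ∈ O, act g T ∈ O)
    (halt : ∀ T ∈ O, T.IsAlternating) (hinv : ∀ T ∈ O, T.IsInvariant)
    (hcard : Fintype.card ι ≠ 4) : ∃ T ∈ O, conj T = T := by
  -- A point nearest to the origin exists in the closure; that it lies in `O` itself is shown at the
  -- end.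
  obtain ⟨T, hTO, hTmin⟩ := isClosed_closure.exists_infDist_eq_dist hne.closure (0 : Tensor4 ι)
  have hTalt : T.IsAlternating := closure_minimal halt isClosed_isAlternating hTO
  have hTinv : T.IsInvariant := closure_minimal hinv isClosed_isInvariant hTO
  have hreal : conj T = T := by
    refine hTalt.conj_eq_of_minimal hTinv (fun g hg => ?_) hcard
    have hmem : act g T ∈ closure O :=
      map_mem_closure (continuous_act g) hTO fun S hS => hact g hg S hS
    have := Metric.infDist_le_dist_of_mem (x := (0 : Tensor4 ι)) hmem
    rwa [hTmin, dist_zero_left, dist_zero_left] at this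
  obtain ⟨δ, hδ, hslice⟩ := hTalt.exists_slice hTinv hreal hcard
  let π : Tensor4 ι →L[ℂ] Tensor4 ι := (tangentSpace T)ᗮ.starProjection
  let skew : Matrix ι ι ℂ →L[ℂ] Matrix ι ι ℂ :=
    LinearMap.toContinuousLinearMap
      (LinearMap.id - (Matrix.transposeLinearEquiv ι ι ℂ ℂ).toLinearMap)
  -- Motion along the orbit combined with displacement in the orthogonal slice.
  let Φ : Matrix ι ι ℂ × Tensor4 ι → Tensor4 ι := fun x =>
    act (NormedSpace.exp (skew x.1)) (T + π x.2)
  have hΦ := hasStrictFDerivAt_act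
    (hasStrictFDerivAt_exp (skew.comp (ContinuousLinearMap.fst ℂ (Matrix ι ι ℂ) (Tensor4 ι))))
    (by simp)
    ((π.comp (ContinuousLinearMap.snd ℂ (Matrix ι ι ℂ) (Tensor4 ι))).hasStrictFDerivAt.const_add T
      (x := 0))
  -- The tangent space and its orthogonal complement span everything, so `Φ` is a submersion at `0`
  -- and is open there.
  have hsurj := hΦ.map_nhds_eq_of_surj (by
    rw [LinearMap.range_eq_top]
    intro S
    obtain ⟨A, hA⟩ := (tangentSpace T).starProjection_apply_mem S
    refine ⟨(A, S), ?_⟩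
    change π S + lieAct (skew A) (T + π 0) = S
    rw [map_zero, add_zero]
    change π S + (lieAct.flip T ∘ₗ
      (LinearMap.id - (Matrix.transposeLinearEquiv ι ι ℂ ℂ).toLinearMap)) A = S
    rw [hA]
    simp [π])
  have hnear : {x : Matrix ι ι ℂ × Tensor4 ι | ‖π x.2‖ < δ} ∈ nhds 0 := by
    refine (isOpen_lt (by fun_prop) continuous_const).mem_nhds ?_
    simpa using hδ
  have himg : Φ '' {x | ‖π x.2‖ < δ} ∈ nhds T := by
    have h := Filter.image_mem_map (m := Φ) hnear
    have h0 : Φ 0 = T := by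
      change act (NormedSpace.exp (skew 0)) (T + π 0) = T
      rw [map_zero, map_zero, NormedSpace.exp_zero, act_one, add_zero]
    rw [← h0]
    exact hsurj ▸ h
  -- The image is a neighbourhood of `T`, hence meets `O`. Undoing the orthogonal motion leaves a
  -- slice point `T + π S` in `O`, which local rigidity identifies with `T`.
  obtain ⟨_, ⟨⟨A, S⟩, hS, rfl⟩, hO⟩ := mem_closure_iff_nhds.1 hTO _ himg
  have hskew : (skew A).transpose = -skew A := by
    change (A - A.transpose).transpose = -(A - A.transpose)
    simp
  have horth := exp_mul_transpose hskew
  have hback : act (NormedSpace.exp (skew A)).transpose (Φ (A, S)) = T + π S := by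
    change act _ (act _ _) = _
    rw [← act_mul, mul_eq_one_comm.1 horth, act_one]
  have hmem : T + π S ∈ O := by
    rw [← hback]
    refine hact _ ?_ _ hO
    rw [Matrix.transpose_transpose]
    exact mul_eq_one_comm.1 horth
  have hzero : π S = 0 := by
    refine hslice _ ?_ ((tangentSpace T)ᗮ.starProjection_apply_mem S) hS (hinv _ hmem)
    have := (alternatingSubmodule ι).sub_mem (halt _ hmem) hTalt
    rwa [add_sub_cancel_left] at this
  rw [hzero, add_zero] at hmem
  exact ⟨T, hmem, hreal⟩

end Orbit

end Tensor4

namespace LieSuperalgebra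

variable {V : Type*} [AddCommGroup V] [Module ℂ V] {G : LieSuperalgebra V}

/-! ### Bracket identities -/

lemma exists_add_eq (G : LieSuperalgebra V) (v : V) : ∃ a ∈ G.part 0, ∃ b ∈ G.part 1, a + b = v :=
  Submodule.mem_sup.1 (G.isCompl.sup_eq_top ▸ Submodule.mem_top)

lemma eq_zero_of_mem_parts {a : V} (h0 : a ∈ G.part 0) (h1 : a ∈ G.part 1) : a = 0 :=
  Submodule.disjoint_def.1 G.isCompl.disjoint a h0 h1

lemma jacobi_even {a : V} (ha : a ∈ G.part 0) (b c : V) : G.bracket a (G.bracket b c) =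
    G.bracket (G.bracket a b) c + G.bracket b (G.bracket a c) := by
  obtain ⟨b0, hb0, b1, hb1, rfl⟩ := G.exists_add_eq b
  obtain ⟨c0, hc0, c1, hc1, rfl⟩ := G.exists_add_eq c
  have h00 := G.jacobi 0 0 0 a b0 c0 ha hb0 hc0
  have h01 := G.jacobi 0 0 1 a b0 c1 ha hb0 hc1
  have h10 := G.jacobi 0 1 0 a b1 c0 ha hb1 hc0
  have h11 := G.jacobi 0 1 1 a b1 c1 ha hb1 hc1
  simp only [superSign, zero_ne_one, false_and, if_false, one_smul] at h00 h01 h10 h11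
  simp only [map_add, LinearMap.add_apply, h00, h01, h10, h11]
  abel

lemma jacobi_odd {a b : V} (ha : a ∈ G.part 1) (hb : b ∈ G.part 1) (c : V) :
    G.bracket a (G.bracket b c) = G.bracket (G.bracket a b) c - G.bracket b (G.bracket a c) := by
  obtain ⟨c0, hc0, c1, hc1, rfl⟩ := G.exists_add_eq c
  have h0 := G.jacobi 1 1 0 a b c0 ha hb hc0
  have h1 := G.jacobi 1 1 1 a b c1 ha hb hc1
  simp only [superSign, and_self, if_true, neg_smul, one_smul] at h0 h1
  simp only [map_add, h0, h1]
  abel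

lemma skew_even {a : V} (ha : a ∈ G.part 0) (b : V) : G.bracket a b = -G.bracket b a := by
  obtain ⟨b0, hb0, b1, hb1, rfl⟩ := G.exists_add_eq b
  have h0 := G.skew 0 0 a b0 ha hb0
  have h1 := G.skew 0 1 a b1 ha hb1
  simp only [superSign, zero_ne_one, false_and, if_false, one_smul] at h0 h1
  rw [map_add, h0, h1, map_add, LinearMap.add_apply, neg_add]

lemma symm_odd {a b : V} (ha : a ∈ G.part 1) (hb : b ∈ G.part 1) :
    G.bracket a b = G.bracket b a := by
  simpa [superSign] using G.skew 1 1 a b ha hb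

lemma even_odd_mem {a b : V} (ha : a ∈ G.part 0) (hb : b ∈ G.part 1) :
    G.bracket a b ∈ G.part 1 := by
  simpa using G.bracket_mem 0 1 a b ha hb

lemma odd_odd_mem {a b : V} (ha : a ∈ G.part 1) (hb : b ∈ G.part 1) :
    G.bracket a b ∈ G.part 0 := by
  simpa [show (1 : ZMod 2) + 1 = 0 from rfl] using G.bracket_mem 1 1 a b ha hb

/-! ### Minimal `sl₂`-triples splitting the even part -/

/-- A minimal `sl₂`-triple with `𝔤_even = 𝔰 ⊕ 𝔤^♮`. -/
structure IsMinimalSplit (G : LieSuperalgebra V) (e x f : V) : Prop where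
  triple : G.IsSl2Triple e x f
  split : G.EvenSplits e x f
  minimal : G.IsMinimal x f

variable {e x f : V}

/-- The adjoint action as an endomorphism. -/
def ad (G : LieSuperalgebra V) (a : V) : Module.End ℂ V := G.bracket a

@[simp] lemma ad_apply (a v : V) : G.ad a v = G.bracket a v := rfl

lemma even_self {a : V} (ha : a ∈ G.part 0) : G.bracket a a = 0 := by
  have h := skew_even ha a
  have h2 : (2 : ℂ) • G.bracket a a = 0 := by
    rw [two_smul]
    nth_rewrite 1 [h]
    exact neg_add_cancel _
  exact (smul_eq_zero.1 h2).resolve_left two_ne_zero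

lemma mem_gNatural_iff {a : V} : a ∈ G.gNatural e x f ↔
    G.bracket e a = 0 ∧ G.bracket x a = 0 ∧ G.bracket f a = 0 := by
  constructor
  · intro ha
    exact ⟨ha e (Submodule.subset_span (by simp)), ha x (Submodule.subset_span (by simp)),
      ha f (Submodule.subset_span (by simp))⟩
  · rintro ⟨he, hx, hf⟩ s hs
    obtain ⟨α, β, γ, rfl⟩ := Submodule.mem_span_triple.1 hs
    simp [he, hx, hf]

namespace IsMinimalSplit

variable (h : G.IsMinimalSplit e x f)
include h

lemma e_even : e ∈ G.part 0 := h.triple.e_mem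
lemma x_even : x ∈ G.part 0 := h.triple.x_mem
lemma f_even : f ∈ G.part 0 := h.triple.f_mem

lemma e_ne_zero : e ≠ 0 := fun h0 => h.triple.x_ne_zero (by
  rw [← h.triple.lie_e_f, h0, map_zero, LinearMap.zero_apply])

lemma f_ne_zero : f ≠ 0 := fun h0 => h.triple.x_ne_zero (by
  rw [← h.triple.lie_e_f, h0, map_zero])

lemma lie_e_x : G.bracket e x = -e := by
  rw [skew_even h.e_even, h.triple.lie_x_e]

lemma lie_f_x : G.bracket f x = f := by
  rw [skew_even h.f_even, h.triple.lie_x_f, neg_neg]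

lemma lie_f_e : G.bracket f e = -x := by
  rw [skew_even h.f_even, h.triple.lie_e_f]

lemma gNatural_even {a : V} (ha : a ∈ G.gNatural e x f) : a ∈ G.part 0 := by
  have : G.gNatural e x f ≤ G.even := h.split.2 ▸ le_sup_right
  exact this ha

lemma exists_even {a : V} (ha : a ∈ G.part 0) : ∃ α β γ : ℂ, ∃ b ∈ G.gNatural e x f,
    a = α • e + β • x + γ • f + b := by
  have : a ∈ tripleSpan e x f ⊔ G.gNatural e x f := h.split.2 ▸ ha
  obtain ⟨s, hs, b, hb, rfl⟩ := Submodule.mem_sup.1 this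
  obtain ⟨α, β, γ, rfl⟩ := Submodule.mem_span_triple.1 hs
  exact ⟨α, β, γ, b, hb, rfl⟩

lemma even_unique {α β γ : ℂ} {b : V} (hb : b ∈ G.gNatural e x f)
    (h0 : α • e + β • x + γ • f + b = 0) : α = 0 ∧ β = 0 ∧ γ = 0 ∧ b = 0 := by
  have hb0 : b = 0 := by
    refine Submodule.disjoint_def.1 h.split.1 b ?_ hb
    rw [← neg_eq_of_add_eq_zero_right h0]
    exact Submodule.neg_mem _ (Submodule.mem_span_triple.2 ⟨α, β, γ, rfl⟩)
  rw [hb0, add_zero] at h0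
  -- Applying `ad x` once and twice separates the weights `1` and `-1`.
  have h1 := congrArg (G.bracket x) h0
  simp only [map_add, map_smul, map_zero, h.triple.lie_x_e, h.triple.lie_x_f,
    even_self h.x_even, smul_zero, add_zero, smul_neg] at h1
  have h2 := congrArg (G.bracket x) h1
  simp only [map_add, map_smul, map_zero, map_neg, h.triple.lie_x_e, h.triple.lie_x_f,
    smul_neg, neg_neg] at h2
  have hα : (2 * α) • e = 0 := by
    linear_combination (norm := module) h1 + h2
  have hγ : (2 * γ) • f = 0 := by
    linear_combination (norm := module) h2 - h1
  have hα0 : α = 0 := by simpa [h.e_ne_zero] using hα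
  have hγ0 : γ = 0 := by simpa [h.f_ne_zero] using hγ
  rw [hα0, hγ0, zero_smul, zero_smul, add_zero, zero_add, smul_eq_zero] at h0
  exact ⟨hα0, h0.resolve_right h.triple.x_ne_zero, hγ0, hb0⟩

lemma weight_bracket_e {μ : ℂ} {v : V} (hv : G.bracket x v = μ • v) :
    G.bracket x (G.bracket e v) = (μ + 1) • G.bracket e v := by
  rw [jacobi_even h.x_even, h.triple.lie_x_e, hv, map_smul, add_smul, one_smul, add_comm]

lemma weight_bracket_f {μ : ℂ} {v : V} (hv : G.bracket x v = μ • v) :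
    G.bracket x (G.bracket f v) = (μ - 1) • G.bracket f v := by
  rw [jacobi_even h.x_even, h.triple.lie_x_f, hv, map_smul, map_neg, LinearMap.neg_apply, sub_smul,
    one_smul]
  abel

lemma eq_zero_of_weight {n : ℤ} (hn : 2 < |n|) {v : V} (hv : G.bracket x v = ((n : ℂ) / 2) • v) :
    v = 0 := by
  have := h.minimal.1 n hn
  rw [Submodule.eq_bot_iff] at this
  exact this v (Module.End.mem_eigenspace_iff.2 hv)

/-- Weight `-1` occurs only on the line of `f`, which is even. -/
lemma odd_eq_zero_of_weight_neg_one {v : V} (hodd : v ∈ G.part 1) (hv : G.bracket x v = -v) :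
    v = 0 := by
  have hmem : v ∈ Module.End.eigenspace (G.bracket x) (-1) :=
    Module.End.mem_eigenspace_iff.2 (by rw [hv, neg_one_smul])
  rw [h.minimal.2, Submodule.mem_span_singleton] at hmem
  obtain ⟨c, rfl⟩ := hmem
  exact eq_zero_of_mem_parts (Submodule.smul_mem _ _ h.f_even) hodd

variable [FiniteDimensional ℂ V]

/-- A primitive odd vector has weight `1/2`. -/
lemma weight_of_primitive {v : V} (hodd : v ∈ G.part 1) (hv : v ≠ 0) {μ : ℂ}
    (hx : G.bracket x v = μ • v) (he : G.bracket e v = 0) : μ = 1 / 2 := by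
  let _ : LieRing (Module.End ℂ V) := LieRing.ofAssociativeRing
  let _ : LieAlgebra ℂ (Module.End ℂ V) := LieAlgebra.ofAssociativeAlgebra
  -- The standard normalization `[h, e] = 2e`, `[e, f] = h` requires `h = 2x`, and then `f` must be
  -- doubled as well.
  have t : _root_.IsSl2Triple ((2 : ℂ) • G.ad x) (G.ad e) ((2 : ℂ) • G.ad f) :=
    { h_ne_zero := fun h0 => by
        have := LinearMap.congr_fun h0 e
        simp [h.triple.lie_x_e, h.e_ne_zero] at this
      lie_e_f := by
        ext v
        simp [Ring.lie_def, jacobi_even h.e_even f v, h.triple.lie_e_f, smul_add]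
      lie_h_e_nsmul := by
        ext v
        simp [Ring.lie_def, jacobi_even h.x_even e v, h.triple.lie_x_e, two_smul]
        abel
      lie_h_f_nsmul := by
        ext v
        simp [Ring.lie_def, jacobi_even h.x_even f v, h.triple.lie_x_f, smul_add, two_smul]
        abel }
  have P : t.HasPrimitiveVectorWith v (2 * μ) :=
    ⟨hv, by simp [hx, smul_smul], by simp [he]⟩
  obtain ⟨n, hn⟩ := P.exists_nat
  have hμ : μ = (n : ℂ) / 2 := by linear_combination hn / 2
  have hn2 : n ≤ 2 := by
    by_contra hlt
    exact hv (h.eq_zero_of_weight (n := n) (by rw [Nat.abs_cast]; exact_mod_cast not_le.1 hlt)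
      (by rw [hx, hμ]; simp))
  have hfodd : ∀ {w : V}, w ∈ G.part 1 → G.bracket f w ∈ G.part 1 :=
    fun hw => even_odd_mem h.f_even hw
  interval_cases n
  -- Weight `0`: `[f, v]` is odd of weight `-1`, hence zero, so `v` would centralize the triple; but
  -- `𝔤^♮` is even.
  · exfalso
    have hμ0 : μ = 0 := by simpa using hμ
    have hf : G.bracket f v = 0 := by
      refine h.odd_eq_zero_of_weight_neg_one (hfodd hodd) ?_
      rw [h.weight_bracket_f hx, hμ0]
      simp
    refine hv (eq_zero_of_mem_parts (h.gNatural_even (mem_gNatural_iff.2 ⟨he, ?_, hf⟩)) hodd)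
    rw [hx, hμ0, zero_smul]
  · simpa using hμ
  -- Weight `1`: `sl₂` theory gives `f² v ≠ 0`, but this vector is odd of weight `-1`.
  · exfalso
    have hμ1 : μ = 1 := by simpa using hμ
    refine P.pow_toEnd_f_ne_zero_of_eq_nat (n := 2) hn le_rfl ?_
    have hff : G.bracket f (G.bracket f v) = 0 := by
      refine h.odd_eq_zero_of_weight_neg_one (hfodd (hfodd hodd)) ?_
      rw [h.weight_bracket_f (h.weight_bracket_f hx), hμ1]
      simp
    simp [pow_two, hff]

/-- Odd weights are `±1/2`. -/
lemma odd_weight {v : V} (hodd : v ∈ G.part 1) (hv : v ≠ 0) {μ : ℂ}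
    (hx : G.bracket x v = μ • v) : μ = 1 / 2 ∨ μ = -(1 / 2) := by
  have hpow : ∀ k : ℕ, (G.ad e ^ k) v ∈ G.part 1 ∧
      G.bracket x ((G.ad e ^ k) v) = (μ + k) • (G.ad e ^ k) v := by
    intro k
    induction k with
    | zero => simpa using ⟨hodd, hx⟩
    | succ k ih =>
      rw [pow_succ', Module.End.mul_apply, ad_apply]
      refine ⟨even_odd_mem h.e_even ih.1, ?_⟩
      rw [h.weight_bracket_e ih.2]
      push_cast
      rw [add_assoc]
  -- Otherwise the vectors `eᵏ v` would be eigenvectors for infinitely many distinct weights.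
  have hzero : ∃ k, (G.ad e ^ k) v = 0 := by
    by_contra! contra
    have hinj : Function.Injective fun n : ℕ => μ + n := fun a b hab => by simpa using hab
    have aux (ν : Set.range fun n : ℕ => μ + n) : (G.ad x).HasEigenvector (ν : ℂ)
        ((G.ad e ^ ν.property.choose) v) := by
      refine ⟨Module.End.mem_eigenspace_iff.2 ?_, contra _⟩
      rw [ad_apply, (hpow _).2]
      exact congrArg (· • _) ν.property.choose_spec
    have := ((G.ad x).eigenvectors_linearIndependent _ _ aux).finite
    exact Set.infinite_range_of_injective hinj (Set.toFinite _)
  obtain ⟨k, hk, hk'⟩ := Nat.exists_not_and_succ_of_not_zero_of_exists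
   (p := fun k => (G.ad e ^ k) v = 0)
    (by simpa using hv) hzero
  have hμ := h.weight_of_primitive (hpow k).1 hk (hpow k).2
    (by rwa [pow_succ', Module.End.mul_apply, ad_apply] at hk')
  -- The last nonzero `eᵏ v` is primitive, so `μ = 1/2 - k`; for `k ≥ 2` this is excluded by
  -- minimality.
  have hk1 : k ≤ 1 := by
    by_contra hlt
    refine hv (h.eq_zero_of_weight (n := 1 - 2 * k) ?_ ?_)
    · rw [lt_abs]
      right
      push Not at hlt
      omega
    · rw [hx]
      push_cast
      congr 1
      linear_combination hμ
  interval_cases k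
  · left
    simpa using hμ
  · right
    push_cast at hμ
    linear_combination hμ

lemma odd_eq_zero_of_generalized {μ : ℂ} (h1 : μ ≠ 1 / 2) (h2 : μ ≠ -(1 / 2)) (k : ℕ) {v : V}
    (hodd : v ∈ G.part 1) (hk : ((G.ad x - μ • 1) ^ k) v = 0) : v = 0 := by
  induction k generalizing v with
  | zero => simpa using hk
  | succ k ih =>
    rw [pow_succ, Module.End.mul_apply] at hk
    have h0 := ih (sub_mem (even_odd_mem h.x_even hodd) (Submodule.smul_mem _ _ hodd)) hk
    by_contra hv
    exact (h.odd_weight hodd hv (sub_eq_zero.1 h0)).elim h1 h2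

omit [FiniteDimensional ℂ V] in
lemma generalized_bracket_e {μ ν : ℂ} (hν : ν = μ + 1) (k : ℕ) {v : V}
    (hk : ((G.ad x - μ • 1) ^ k) v = 0) : ((G.ad x - ν • 1) ^ k) (G.bracket e v) = 0 := by
  induction k generalizing v with
  | zero => simpa using congrArg (G.bracket e) hk
  | succ k ih =>
    rw [pow_succ, Module.End.mul_apply] at hk ⊢
    rw [← ih hk, hν]
    congr 1
    simp only [LinearMap.sub_apply, ad_apply, LinearMap.smul_apply, Module.End.one_apply, map_sub,
      map_smul, jacobi_even h.x_even e v, h.triple.lie_x_e]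
    module

omit [FiniteDimensional ℂ V] in
lemma generalized_bracket_f {μ ν : ℂ} (hν : ν = μ - 1) (k : ℕ) {v : V}
    (hk : ((G.ad x - μ • 1) ^ k) v = 0) : ((G.ad x - ν • 1) ^ k) (G.bracket f v) = 0 := by
  induction k generalizing v with
  | zero => simpa using congrArg (G.bracket f) hk
  | succ k ih =>
    rw [pow_succ, Module.End.mul_apply] at hk ⊢
    rw [← ih hk, hν]
    congr 1
    simp only [LinearMap.sub_apply, ad_apply, LinearMap.smul_apply, Module.End.one_apply, map_sub,
      map_smul, jacobi_even h.x_even f v, h.triple.lie_x_f, map_neg, LinearMap.neg_apply]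
    module

/-- Put `w = [x, v] - v/2`. The weights leave no room for `[e, v]` and `[f, [f, v]]`, and the `sl₂`
relations then show that `e` and `f` kill `w`. Hence `x = [e, f]` kills `w`, and an odd vector of
weight `0` vanishes. -/
lemma weight_of_generalized_half (k : ℕ) {v : V} (hodd : v ∈ G.part 1)
    (hk : ((G.ad x - (1 / 2 : ℂ) • 1) ^ k) v = 0) : G.bracket x v = (1 / 2 : ℂ) • v := by
  have hf : G.bracket f (G.bracket f v) = 0 :=
    h.odd_eq_zero_of_generalized (μ := -(3 / 2)) (by norm_num) (by norm_num) k
      (even_odd_mem h.f_even (even_odd_mem h.f_even hodd))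
      (h.generalized_bracket_f (μ := -(1 / 2)) (by norm_num) k
        (h.generalized_bracket_f (by norm_num) k hk))
  have he : G.bracket e v = 0 :=
    h.odd_eq_zero_of_generalized (μ := 3 / 2) (by norm_num) (by norm_num) k
      (even_odd_mem h.e_even hodd) (h.generalized_bracket_e (by norm_num) k hk)
  have hx2 : G.bracket x (G.bracket x v - (1 / 2 : ℂ) • v) = 0 := by
    have h1 := jacobi_even h.e_even f (G.bracket f v)
    have h2 := jacobi_even h.e_even f v
    have h3 := jacobi_even h.x_even f v
    rw [h.triple.lie_e_f] at h1 h2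
    rw [hf, map_zero] at h1
    rw [he, map_zero, add_zero] at h2
    rw [h.triple.lie_x_f, map_neg, LinearMap.neg_apply] at h3
    rw [h2] at h1
    have h4 : G.bracket f (G.bracket x v - (1 / 2 : ℂ) • v) = 0 := by
      rw [map_sub, map_smul]
      linear_combination (norm := module) (-(1 / 2) : ℂ) • h3 - (1 / 2 : ℂ) • h1
    have h5 := jacobi_even h.e_even f (G.bracket x v - (1 / 2 : ℂ) • v)
    have h6 : G.bracket e (G.bracket x v - (1 / 2 : ℂ) • v) = 0 := by
      have := jacobi_even h.x_even e v
      rw [h.triple.lie_x_e, he, map_zero, zero_add] at this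
      rw [map_sub, map_smul, he, ← this, smul_zero, sub_zero]
    rw [h4, map_zero, h6, map_zero, add_zero, h.triple.lie_e_f] at h5
    exact h5.symm
  have hodd' : G.bracket x v - (1 / 2 : ℂ) • v ∈ G.part 1 :=
    sub_mem (even_odd_mem h.x_even hodd) (Submodule.smul_mem _ _ hodd)
  exact sub_eq_zero.1 (h.odd_eq_zero_of_generalized (μ := 0) (by norm_num) (by norm_num) 1 hodd'
    (by simpa using hx2))

/-- The mirror image of `weight_of_generalized_half`, with `e` and `f` exchanged. -/
lemma weight_of_generalized_neg_half (k : ℕ) {v : V} (hodd : v ∈ G.part 1)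
    (hk : ((G.ad x - (-(1 / 2) : ℂ) • 1) ^ k) v = 0) : G.bracket x v = (-(1 / 2) : ℂ) • v := by
  have he : G.bracket e (G.bracket e v) = 0 :=
    h.odd_eq_zero_of_generalized (μ := 3 / 2) (by norm_num) (by norm_num) k
      (even_odd_mem h.e_even (even_odd_mem h.e_even hodd))
      (h.generalized_bracket_e (μ := 1 / 2) (by norm_num) k
        (h.generalized_bracket_e (by norm_num) k hk))
  have hf : G.bracket f v = 0 :=
    h.odd_eq_zero_of_generalized (μ := -(3 / 2)) (by norm_num) (by norm_num) k
      (even_odd_mem h.f_even hodd) (h.generalized_bracket_f (by norm_num) k hk)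
  have hx2 : G.bracket x (G.bracket x v - (-(1 / 2) : ℂ) • v) = 0 := by
    have h1 := jacobi_even h.f_even e (G.bracket e v)
    have h2 := jacobi_even h.f_even e v
    have h3 := jacobi_even h.x_even e v
    rw [h.lie_f_e] at h1 h2
    rw [he, map_zero] at h1
    rw [hf, map_zero, add_zero] at h2
    rw [h.triple.lie_x_e] at h3
    rw [h2] at h1
    simp only [map_neg, LinearMap.neg_apply] at h1
    have h4 : G.bracket e (G.bracket x v - (-(1 / 2) : ℂ) • v) = 0 := by
      rw [map_sub, map_smul]
      linear_combination (norm := module) (-(1 / 2) : ℂ) • h3 + (1 / 2 : ℂ) • h1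
    have h5 := jacobi_even h.f_even e (G.bracket x v - (-(1 / 2) : ℂ) • v)
    have h6 : G.bracket f (G.bracket x v - (-(1 / 2) : ℂ) • v) = 0 := by
      have := jacobi_even h.x_even f v
      rw [h.triple.lie_x_f, hf, map_zero, map_neg, LinearMap.neg_apply, hf, neg_zero,
        zero_add] at this
      rw [map_sub, map_smul, hf, ← this, smul_zero, sub_zero]
    rw [h4, map_zero, h6, map_zero, add_zero, h.lie_f_e, map_neg, LinearMap.neg_apply] at h5
    exact neg_eq_zero.1 h5.symm
  have hodd' : G.bracket x v - (-(1 / 2) : ℂ) • v ∈ G.part 1 :=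
    sub_mem (even_odd_mem h.x_even hodd) (Submodule.smul_mem _ _ hodd)
  exact sub_eq_zero.1 (h.odd_eq_zero_of_generalized (μ := 0) (by norm_num) (by norm_num) 1 hodd'
    (by simpa using hx2))

/-- The square of `ad x` is `1/4` on the odd part. -/
lemma bracket_x_bracket_x {v : V} (hodd : v ∈ G.part 1) :
    G.bracket x (G.bracket x v) = (1 / 4 : ℂ) • v := by
  let X : Module.End ℂ (G.part 1) := (G.ad x).restrict fun w hw => even_odd_mem h.x_even hw
  have hcoe : ∀ (μ : ℂ) (k : ℕ) (w : G.part 1),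
      (((X - μ • 1) ^ k) w : V) = ((G.ad x - μ • 1) ^ k) (w : V) := by
    intro μ k
    induction k with
    | zero => exact fun w => rfl
    | succ k ih =>
      intro w
      rw [pow_succ, Module.End.mul_apply, ih, pow_succ, Module.End.mul_apply]
      rfl
  -- Over `ℂ` the generalized eigenspaces span, and those for `μ ≠ ±1/2` are zero.
  have hle : ⨆ μ, X.maxGenEigenspace μ ≤ LinearMap.ker (X * X - (1 / 4 : ℂ) • 1) := by
    refine iSup_le fun μ w hw => ?_
    obtain ⟨k, hk⟩ := (Module.End.mem_maxGenEigenspace X μ w).1 hw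
    have hk' : ((G.ad x - μ • 1) ^ k) (w : V) = 0 := by
      rw [← hcoe, hk, ZeroMemClass.coe_zero]
    rw [LinearMap.mem_ker]
    refine Subtype.ext ?_
    change G.bracket x (G.bracket x (w : V)) - (1 / 4 : ℂ) • (w : V) = 0
    by_cases h1 : μ = 1 / 2
    · subst h1
      have := h.weight_of_generalized_half k w.2 hk'
      rw [this, map_smul, this]
      module
    by_cases h2 : μ = -(1 / 2)
    · subst h2
      have := h.weight_of_generalized_neg_half k w.2 hk'
      rw [this, map_smul, this]
      module
    rw [h.odd_eq_zero_of_generalized h1 h2 k w.2 hk']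
    simp
  rw [Module.End.iSup_maxGenEigenspace_eq_top] at hle
  have := LinearMap.mem_ker.1 (hle (Submodule.mem_top (x := (⟨v, hodd⟩ : G.part 1))))
  exact sub_eq_zero.1 (congrArg Subtype.val this)

end IsMinimalSplit

end LieSuperalgebra

/-! ### The odd vectors of weight `1/2` and the four-form attached to them -/

namespace LieSuperalgebra

variable {V : Type*} [AddCommGroup V] [Module ℂ V] {G : LieSuperalgebra V} {e x f : V}

/-- The odd vectors of weight `1/2`. -/
noncomputable def halfSpace (G : LieSuperalgebra V) (x : V) : Submodule ℂ V :=
  G.part 1 ⊓ Module.End.eigenspace (G.ad x) (1 / 2)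

lemma mem_halfSpace {m : V} : m ∈ G.halfSpace x ↔
    m ∈ G.part 1 ∧ G.bracket x m = (1 / 2 : ℂ) • m := by
  rw [halfSpace, Submodule.mem_inf, Module.End.mem_eigenspace_iff, ad_apply]

lemma odd_of_mem_halfSpace {m : V} (hm : m ∈ G.halfSpace x) : m ∈ G.part 1 :=
  (mem_halfSpace.1 hm).1

/-- The bilinear form `l [m, n]`. -/
noncomputable def form (G : LieSuperalgebra V) (l : V →ₗ[ℂ] ℂ) : V →ₗ[ℂ] V →ₗ[ℂ] ℂ := G.bracket.compr₂ l

lemma form_apply (l : V →ₗ[ℂ] ℂ) (m n : V) : G.form l m n = l (G.bracket m n) := rfl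

/-- The bilinear map `4 [m, [f, n]] + 2 l [m, n] x`. -/
noncomputable def curv (G : LieSuperalgebra V) (l : V →ₗ[ℂ] ℂ) (x f : V) : V →ₗ[ℂ] V →ₗ[ℂ] V :=
  (4 : ℂ) • G.bracket.compl₂ (G.bracket f) +
    (2 : ℂ) • (G.form l).compr₂ (LinearMap.toSpanSingleton ℂ V x)

lemma curv_apply (l : V →ₗ[ℂ] ℂ) (m n : V) : G.curv l x f m n =
    (4 : ℂ) • G.bracket m (G.bracket f n) + (2 * G.form l m n) • x := by
  simp [curv, smul_smul]

/-- The four-linear form attached to a minimal `sl₂`-triple. -/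
noncomputable def fourForm (G : LieSuperalgebra V) (l : V →ₗ[ℂ] ℂ) (x f : V) (m n p q : V) : ℂ :=
  G.form l p (G.bracket (G.curv l x f m n) q) - G.form l m p * G.form l n q +
    G.form l m q * G.form l n p

namespace IsMinimalSplit

variable (h : G.IsMinimalSplit e x f)
include h

lemma gNatural_bracket {a : V} (ha : a ∈ G.gNatural e x f) :
    G.bracket a e = 0 ∧ G.bracket a x = 0 ∧ G.bracket a f = 0 := by
  have ha0 := h.gNatural_even ha
  obtain ⟨h1, h2, h3⟩ := mem_gNatural_iff.1 ha
  rw [skew_even ha0 e, skew_even ha0 x, skew_even ha0 f, h1, h2, h3, neg_zero]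
  exact ⟨rfl, rfl, rfl⟩

lemma gNatural_lie_mem {a b : V} (ha : a ∈ G.gNatural e x f) (hb : b ∈ G.gNatural e x f) :
    G.bracket a b ∈ G.gNatural e x f := by
  have hb' := mem_gNatural_iff.1 hb
  have ha' := mem_gNatural_iff.1 ha
  refine mem_gNatural_iff.2 ⟨?_, ?_, ?_⟩
  · rw [jacobi_even h.e_even, hb'.1, ha'.1]; simp
  · rw [jacobi_even h.x_even, hb'.2.1, ha'.2.1]; simp
  · rw [jacobi_even h.f_even, hb'.2.2, ha'.2.2]; simp

lemma gNatural_halfSpace {a m : V} (ha : a ∈ G.gNatural e x f) (hm : m ∈ G.halfSpace x) :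
    G.bracket a m ∈ G.halfSpace x := by
  obtain ⟨hm1, hm2⟩ := mem_halfSpace.1 hm
  refine mem_halfSpace.2 ⟨even_odd_mem (h.gNatural_even ha) hm1, ?_⟩
  rw [jacobi_even h.x_even, (mem_gNatural_iff.1 ha).2.1, hm2, map_smul]
  simp

lemma gNatural_lie_f {a : V} (ha : a ∈ G.gNatural e x f) (m : V) :
    G.bracket a (G.bracket f m) = G.bracket f (G.bracket a m) := by
  rw [jacobi_even (h.gNatural_even ha), (h.gNatural_bracket ha).2.2]
  simp

variable {m n : V}

lemma bracket_e_half (hm : m ∈ G.halfSpace x) : G.bracket e m = 0 := by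
  refine h.eq_zero_of_weight (n := 3) (by norm_num) ?_
  rw [h.weight_bracket_e (mem_halfSpace.1 hm).2]
  norm_num

lemma f_half_odd (hm : m ∈ G.halfSpace x) : G.bracket f m ∈ G.part 1 :=
  even_odd_mem h.f_even (odd_of_mem_halfSpace hm)

lemma bracket_x_f_half (hm : m ∈ G.halfSpace x) :
    G.bracket x (G.bracket f m) = (-(1 / 2) : ℂ) • G.bracket f m := by
  rw [h.weight_bracket_f (mem_halfSpace.1 hm).2]
  norm_num

lemma bracket_f_f_half (hm : m ∈ G.halfSpace x) : G.bracket f (G.bracket f m) = 0 := by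
  refine h.eq_zero_of_weight (n := -3) (by norm_num) ?_
  rw [h.weight_bracket_f (h.bracket_x_f_half hm)]
  norm_num

lemma bracket_e_f_half (hm : m ∈ G.halfSpace x) :
    G.bracket e (G.bracket f m) = (1 / 2 : ℂ) • m := by
  rw [jacobi_even h.e_even, h.triple.lie_e_f, h.bracket_e_half hm, (mem_halfSpace.1 hm).2]
  simp

lemma bracket_half_x (hm : m ∈ G.halfSpace x) : G.bracket m x = (-(1 / 2) : ℂ) • m := by
  have := skew_even h.x_even m
  rw [(mem_halfSpace.1 hm).2] at this
  rw [neg_smul, this, neg_neg]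

/-- The odd part is the sum of the vectors of weight `1/2` and their images under `f`. -/
lemma exists_odd [FiniteDimensional ℂ V] {v : V} (hv : v ∈ G.part 1) :
    ∃ m ∈ G.halfSpace x, ∃ n ∈ G.halfSpace x, v = m + G.bracket f n := by
  have hxx := h.bracket_x_bracket_x hv
  have hxv := even_odd_mem h.x_even hv
  set q := (1 / 2 : ℂ) • v - G.bracket x v with hq
  have hqodd : q ∈ G.part 1 := sub_mem (Submodule.smul_mem _ _ hv) hxv
  have hxq : G.bracket x q = (-(1 / 2) : ℂ) • q := by
    rw [hq, map_sub, map_smul, hxx]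
    module
  have hfq : G.bracket f q = 0 := by
    refine h.eq_zero_of_weight (n := -3) (by norm_num) ?_
    rw [h.weight_bracket_f hxq]
    norm_num
  refine ⟨(1 / 2 : ℂ) • v + G.bracket x v, mem_halfSpace.2 ⟨add_mem (Submodule.smul_mem _ _ hv) hxv,
    ?_⟩, (2 : ℂ) • G.bracket e q, mem_halfSpace.2 ⟨Submodule.smul_mem _ _
      (even_odd_mem h.e_even hqodd), ?_⟩, ?_⟩
  · rw [map_add, map_smul, hxx]
    module
  · rw [map_smul, h.weight_bracket_e hxq]
    module
  · have := jacobi_even h.f_even e q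
    rw [h.lie_f_e, hfq, map_zero, add_zero, map_neg, LinearMap.neg_apply, hxq] at this
    rw [map_smul, this, hq]
    module

lemma exists_functional : ∃ l : V →ₗ[ℂ] ℂ, l e = 1 := by
  obtain ⟨l, hl⟩ := LinearMap.exists_leftInverse_of_injective (LinearMap.toSpanSingleton ℂ V e)
    (LinearMap.ker_toSpanSingleton ℂ h.e_ne_zero)
  exact ⟨l, by simpa using LinearMap.congr_fun hl 1⟩

variable {l : V →ₗ[ℂ] ℂ} (hl : l e = 1)
include hl

/-- The bracket is even of weight `1`, where the splitting leaves only the line of `e`; `l` reads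
off the coefficient. -/
lemma bracket_half_half (hm : m ∈ G.halfSpace x) (hn : n ∈ G.halfSpace x) :
    G.bracket m n = G.form l m n • e := by
  obtain ⟨α, β, γ, b, hb, hmn⟩ :=
    h.exists_even (odd_odd_mem (odd_of_mem_halfSpace hm) (odd_of_mem_halfSpace hn))
  have hw : G.bracket x (G.bracket m n) = G.bracket m n := by
    rw [jacobi_even h.x_even, (mem_halfSpace.1 hm).2, (mem_halfSpace.1 hn).2, map_smul, map_smul,
      LinearMap.smul_apply]
    module
  rw [hmn, map_add, map_add, map_add, map_smul, map_smul, map_smul, h.triple.lie_x_e,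
    h.triple.lie_x_f, even_self h.x_even, (mem_gNatural_iff.1 hb).2.1] at hw
  obtain ⟨-, h1, h2, h3⟩ := h.even_unique (α := 0) (β := β) (γ := 2 * γ) hb (by
    linear_combination (norm := module) -hw)
  have hγ : γ = 0 := by simpa using h2
  rw [form_apply, hmn, h1, h3, hγ]
  simp [hl]

omit h hl in
lemma form_symm_half (hm : m ∈ G.halfSpace x) (hn : n ∈ G.halfSpace x) :
    G.form l m n = G.form l n m := by
  rw [form_apply, symm_odd (odd_of_mem_halfSpace hm) (odd_of_mem_halfSpace hn), form_apply]

omit h hl in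
lemma bracket_half_f_half (l : V →ₗ[ℂ] ℂ) (x f m n : V) : G.bracket m (G.bracket f n) =
    (1 / 4 : ℂ) • G.curv l x f m n - (1 / 2 * G.form l m n) • x := by
  rw [curv_apply]
  module

/-- An even vector of weight `0` lies in `ℂ x ⊕ 𝔤^♮`, and the multiple of `x` in `curv` is the one
that makes the result commute with `e`. -/
lemma curv_mem (hm : m ∈ G.halfSpace x) (hn : n ∈ G.halfSpace x) :
    G.curv l x f m n ∈ G.gNatural e x f := by
  have hm' := (mem_halfSpace.1 hm)
  have heven : G.curv l x f m n ∈ G.part 0 := by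
    rw [curv_apply]
    exact add_mem (Submodule.smul_mem _ _ (odd_odd_mem hm'.1 (h.f_half_odd hn)))
      (Submodule.smul_mem _ _ h.x_even)
  have hx : G.bracket x (G.curv l x f m n) = 0 := by
    rw [curv_apply, map_add, map_smul, map_smul, even_self h.x_even, jacobi_even h.x_even,
      h.bracket_x_f_half hn, hm'.2, map_smul, map_smul, LinearMap.smul_apply]
    module
  have he : G.bracket e (G.curv l x f m n) = 0 := by
    rw [curv_apply, map_add, map_smul, map_smul, h.lie_e_x, jacobi_even h.e_even,
      h.bracket_e_f_half hn, h.bracket_e_half hm, map_zero, LinearMap.zero_apply, map_smul,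
      h.bracket_half_half hl hm hn]
    module
  obtain ⟨α, β, γ, b, hb, hP⟩ := h.exists_even heven
  obtain ⟨hb1, hb2, -⟩ := mem_gNatural_iff.1 hb
  rw [hP, map_add, map_add, map_add, map_smul, map_smul, map_smul, h.triple.lie_x_e,
    h.triple.lie_x_f, even_self h.x_even, hb2] at hx
  rw [hP, map_add, map_add, map_add, map_smul, map_smul, map_smul, even_self h.e_even, h.lie_e_x,
    h.triple.lie_e_f, hb1] at he
  obtain ⟨h1, -, h2, -⟩ := h.even_unique (α := α) (β := 0) (γ := -γ) (zero_mem _) (by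
    linear_combination (norm := module) hx)
  obtain ⟨h3, -, -, -⟩ := h.even_unique (α := -β) (β := γ) (γ := 0) (zero_mem _) (by
    linear_combination (norm := module) he)
  rw [hP, h1, neg_eq_zero.1 h2, neg_eq_zero.1 h3]
  simpa using hb

/-- Apply `ad f` to `[m, n] = ⟨m, n⟩ e`: the symmetric part of `[m, [f, n]]` is a multiple of `x`,
cancelled by the correction. -/
lemma curv_antisymm (hm : m ∈ G.halfSpace x) (hn : n ∈ G.halfSpace x) :
    G.curv l x f n m = -G.curv l x f m n := by
  have h1 := jacobi_even h.f_even m n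
  rw [h.bracket_half_half hl hm hn, map_smul, h.lie_f_e,
    symm_odd (h.f_half_odd hm) (odd_of_mem_halfSpace hn)] at h1
  rw [curv_apply, curv_apply, form_symm_half hn hm]
  linear_combination (norm := module) (-4 : ℂ) • h1

lemma bracket_f_half_f_half (hm : m ∈ G.halfSpace x) (hn : n ∈ G.halfSpace x) :
    G.bracket (G.bracket f m) (G.bracket f n) = (-(1 / 2) * G.form l m n) • f := by
  have h1 := jacobi_even h.f_even m (G.bracket f n)
  rw [h.bracket_f_f_half hn, map_zero, add_zero, bracket_half_f_half l x f m n, map_sub, map_smul,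
    map_smul, (mem_gNatural_iff.1 (h.curv_mem hl hm hn)).2.2, h.lie_f_x] at h1
  rw [← h1]
  module

lemma form_invariant {a : V} (ha : a ∈ G.gNatural e x f) (hm : m ∈ G.halfSpace x)
    (hn : n ∈ G.halfSpace x) :
    G.form l (G.bracket a m) n + G.form l m (G.bracket a n) = 0 := by
  have h1 := jacobi_even (h.gNatural_even ha) m n
  rw [h.bracket_half_half hl hm hn, map_smul, (h.gNatural_bracket ha).1, smul_zero] at h1
  rw [form_apply, form_apply, ← map_add, ← h1, map_zero]

lemma bracket_curv {a : V} (ha : a ∈ G.gNatural e x f) (hm : m ∈ G.halfSpace x)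
    (hn : n ∈ G.halfSpace x) : G.bracket a (G.curv l x f m n) =
      G.curv l x f (G.bracket a m) n + G.curv l x f m (G.bracket a n) := by
  have h1 := eq_neg_of_add_eq_zero_left (h.form_invariant hl ha hm hn)
  simp only [curv_apply, h1]
  rw [map_add, map_smul, map_smul, (h.gNatural_bracket ha).2.1,
    jacobi_even (h.gNatural_even ha) m, h.gNatural_lie_f ha]
  module

/-- The Jacobi identity for the odd vectors `m`, `n`, `[f, p]`. It links the two index pairs of the
four-form. -/
lemma curv_triple {p : V} (hm : m ∈ G.halfSpace x) (hn : n ∈ G.halfSpace x)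
    (hp : p ∈ G.halfSpace x) :
    G.bracket (G.curv l x f m p) n + G.bracket (G.curv l x f n p) m =
      G.form l n p • m + G.form l m p • n - (2 * G.form l m n) • p := by
  have h1 := jacobi_odd (odd_of_mem_halfSpace hm) (odd_of_mem_halfSpace hn) (G.bracket f p)
  have h2 := skew_even (h.gNatural_even (h.curv_mem hl hn hp)) m
  have h3 := skew_even (h.gNatural_even (h.curv_mem hl hm hp)) n
  rw [bracket_half_f_half l x f n p, bracket_half_f_half l x f m p, h.bracket_half_half hl hm hn,
    map_sub, map_sub, map_smul, map_smul, map_smul, map_smul, map_smul, LinearMap.smul_apply,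
    h.bracket_e_f_half hp, h.bracket_half_x hm, h.bracket_half_x hn] at h1
  rw [h2, h3]
  linear_combination (norm := module) (-4 : ℂ) • h1

variable {p q : V}

lemma fourForm_swap_one_two (hm : m ∈ G.halfSpace x) (hn : n ∈ G.halfSpace x) :
    G.fourForm l x f n m p q = -G.fourForm l x f m n p q := by
  simp only [fourForm, h.curv_antisymm hl hm hn, map_neg, LinearMap.neg_apply]
  ring

lemma fourForm_swap_three_four (hm : m ∈ G.halfSpace x) (hn : n ∈ G.halfSpace x)
    (hp : p ∈ G.halfSpace x) (hq : q ∈ G.halfSpace x) :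
    G.fourForm l x f m n q p = -G.fourForm l x f m n p q := by
  have h1 := h.form_invariant hl (h.curv_mem hl hm hn) hp hq
  rw [form_symm_half (h.gNatural_halfSpace (h.curv_mem hl hm hn) hp) hq] at h1
  simp only [fourForm]
  linear_combination h1

/-- Pairing `curv_triple` with `p` computes the symmetric part of the curvature in these two
arguments, and the subtracted wedge terms cancel exactly this part. -/
lemma fourForm_swap_one_four (hm : m ∈ G.halfSpace x) (hn : n ∈ G.halfSpace x)
    (hp : p ∈ G.halfSpace x) (hq : q ∈ G.halfSpace x) :
    G.fourForm l x f q n p m = -G.fourForm l x f m n p q := by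
  have h1 := congrArg (G.form l p) (h.curv_triple hl hm hq hn)
  simp only [map_add, map_sub, map_smul, smul_eq_mul] at h1
  simp only [fourForm]
  rw [form_symm_half hp hm, form_symm_half hp hq, form_symm_half hp hn] at h1
  rw [form_symm_half hq hm, form_symm_half hn hm, form_symm_half hn hq]
  rw [form_symm_half hm hq, form_symm_half hm hn, form_symm_half hq hn] at *
  linear_combination h1

/-- The transposition `(2 3)` is `(1 4)` conjugated by `(1 2)(3 4)`. -/
lemma fourForm_swap_two_three (hm : m ∈ G.halfSpace x) (hn : n ∈ G.halfSpace x)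
    (hp : p ∈ G.halfSpace x) (hq : q ∈ G.halfSpace x) :
    G.fourForm l x f m p n q = -G.fourForm l x f m n p q := by
  rw [h.fourForm_swap_one_two hl hp hm, ← h.fourForm_swap_three_four hl hp hm hn hq,
    h.fourForm_swap_one_four hl hn hm hq hp, h.fourForm_swap_one_two hl hm hn, neg_neg,
    h.fourForm_swap_three_four hl hm hn hp hq]

/-- Both ingredients of the four-form, the symmetric form and the map `curv`, are equivariant under
`𝔤^♮`. -/
lemma fourForm_invariant {a : V} (ha : a ∈ G.gNatural e x f) (hm : m ∈ G.halfSpace x)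
    (hn : n ∈ G.halfSpace x) (hp : p ∈ G.halfSpace x) (hq : q ∈ G.halfSpace x) :
    G.fourForm l x f (G.bracket a m) n p q + G.fourForm l x f m (G.bracket a n) p q +
      G.fourForm l x f m n (G.bracket a p) q + G.fourForm l x f m n p (G.bracket a q) = 0 := by
  have hP := h.curv_mem hl hm hn
  have h1 := h.form_invariant hl ha hp (h.gNatural_halfSpace hP hq)
  rw [jacobi_even (h.gNatural_even ha), h.bracket_curv hl ha hm hn] at h1
  simp only [map_add, LinearMap.add_apply] at h1
  simp only [fourForm]
  linear_combination h1 - h.form_invariant hl ha hm hp * G.form l n q -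
    h.form_invariant hl ha hn hq * G.form l m p + h.form_invariant hl ha hm hq * G.form l n p +
    h.form_invariant hl ha hn hp * G.form l m q

end IsMinimalSplit

end LieSuperalgebra

namespace LieSuperalgebra

variable {V : Type*} [AddCommGroup V] [Module ℂ V] {G : LieSuperalgebra V} {e x f : V}

/-! ### Nondegeneracy, faithfulness, generation -/

lemma IsBasicForm.odd_even {β : V →ₗ[ℂ] V →ₗ[ℂ] ℂ} (hβ : G.IsBasicForm β) {a b : V}
    (ha : a ∈ G.part 1) (hb : b ∈ G.part 0) : β a b = 0 := by
  rw [hβ.supersymm 1 0 a b ha hb, hβ.even_form b hb a ha, mul_zero]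

lemma isIdeal_of_le_even {I : Submodule ℂ V} (h0 : I ≤ G.part 0)
    (h : ∀ a : V, ∀ b ∈ I, G.bracket a b ∈ I) : G.IsIdeal I :=
  ⟨le_sup_of_le_left (le_inf le_rfl h0), h⟩

namespace IsMinimalSplit

variable (h : G.IsMinimalSplit e x f)
include h

/-- Invariance of `β` gives `β(m, [f, n]) = -⟨m, n⟩ β(e, f)`, and `m` is `β`-orthogonal to vectors
of weight `1/2` and to even vectors. A vector in the radical of the form is thus in the radical of
`β`. -/
lemma form_nondegenerate [FiniteDimensional ℂ V] {β : V →ₗ[ℂ] V →ₗ[ℂ] ℂ} (hβ : G.IsBasicForm β)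
    {l : V →ₗ[ℂ] ℂ} (hl : l e = 1) {m : V} (hm : m ∈ G.halfSpace x)
    (h0 : ∀ n ∈ G.halfSpace x, G.form l m n = 0) : m = 0 := by
  have hodd := odd_of_mem_halfSpace hm
  refine hβ.nondegenerate m fun v => ?_
  obtain ⟨v0, hv0, v1, hv1, rfl⟩ := G.exists_add_eq v
  obtain ⟨n, hn, n', hn', rfl⟩ := h.exists_odd hv1
  have h1 : β m n = 0 := by
    have e1 : β (G.bracket m x) n = β m (G.bracket x n) := hβ.invariant m x n
    rw [h.bracket_half_x hm, (mem_halfSpace.1 hn).2, map_smul, map_smul, LinearMap.smul_apply,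
      smul_eq_mul, smul_eq_mul] at e1
    linear_combination -e1
  have h2 : β m (G.bracket f n') = 0 := by
    have e1 := hβ.invariant m n' f
    rw [h.bracket_half_half hl hm hn', h0 n' hn', zero_smul, map_zero, LinearMap.zero_apply] at e1
    rw [skew_even h.f_even, map_neg, ← e1, neg_zero]
  rw [map_add, map_add, hβ.odd_even hodd hv0, h1, h2, zero_add, add_zero]

lemma not_gNatural_e : e ∉ G.gNatural e x f := fun he =>
  h.e_ne_zero (by rw [← h.triple.lie_x_e, (mem_gNatural_iff.1 he).2.1])

/-- The kernel of the action on weight `1/2` also kills `[f, 𝔤_{1/2}]` and the triple, so it is an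
ideal; it does not contain `e`. -/
lemma gNatural_faithful [FiniteDimensional ℂ V] (hG : G.IsSimple) {a : V}
    (ha : a ∈ G.gNatural e x f) (h0 : ∀ m ∈ G.halfSpace x, G.bracket a m = 0) : a = 0 := by
  let I : Submodule ℂ V :=
    { carrier := {a | a ∈ G.gNatural e x f ∧ ∀ m ∈ G.halfSpace x, G.bracket a m = 0}
      add_mem' := fun ha hb => ⟨add_mem ha.1 hb.1, fun m hm => by
        rw [map_add, LinearMap.add_apply, ha.2 m hm, hb.2 m hm, add_zero]⟩
      zero_mem' := ⟨zero_mem _, fun m _ => by rw [map_zero, LinearMap.zero_apply]⟩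
      smul_mem' := fun c a ha => ⟨Submodule.smul_mem _ _ ha.1, fun m hm => by
        rw [map_smul, LinearMap.smul_apply, ha.2 m hm, smul_zero]⟩ }
  have hI : G.IsIdeal I := by
    refine isIdeal_of_le_even (fun a ha => h.gNatural_even ha.1) fun v b hb => ?_
    obtain ⟨v0, hv0, v1, hv1, rfl⟩ := G.exists_add_eq v
    obtain ⟨m, hm, n, hn, rfl⟩ := h.exists_odd hv1
    obtain ⟨α, β, γ, c, hc, rfl⟩ := h.exists_even hv0
    obtain ⟨h1, h2, h3⟩ := mem_gNatural_iff.1 hb.1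
    have hb0 := h.gNatural_even hb.1
    have hm0 : G.bracket m b = 0 := by
      rw [← neg_neg (G.bracket m b), ← skew_even hb0, hb.2 m hm, neg_zero]
    have hn0 : G.bracket (G.bracket f n) b = 0 := by
      rw [← neg_neg (G.bracket (G.bracket f n) b), ← skew_even hb0, h.gNatural_lie_f hb.1,
        hb.2 n hn, map_zero, neg_zero]
    have : G.bracket (α • e + β • x + γ • f + c + (m + G.bracket f n)) b = G.bracket c b := by
      simp [h1, h2, h3, hm0, hn0]
    rw [this]
    refine ⟨h.gNatural_lie_mem hc hb.1, fun p hp => ?_⟩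
    have := jacobi_even (h.gNatural_even hc) b p
    rw [hb.2 p hp, hb.2 _ (h.gNatural_halfSpace hc hp), map_zero, add_zero] at this
    exact this.symm
  rcases hG.2 I hI with hbot | htop
  · exact (Submodule.eq_bot_iff _).1 hbot a ⟨ha, h0⟩
  · exact absurd (htop ▸ Submodule.mem_top : e ∈ I).1 h.not_gNatural_e

/-- The span of the elements `curv m n` of `𝔤^♮`. -/
lemma gNatural_le_span [FiniteDimensional ℂ V] (hG : G.IsSimple) {l : V →ₗ[ℂ] ℂ} (hl : l e = 1) :
    G.gNatural e x f ≤ Submodule.span ℂ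
      {a | ∃ m ∈ G.halfSpace x, ∃ n ∈ G.halfSpace x, G.curv l x f m n = a} := by
  set P := Submodule.span ℂ {a | ∃ m ∈ G.halfSpace x, ∃ n ∈ G.halfSpace x, G.curv l x f m n = a}
    with hP
  have hPnat : P ≤ G.gNatural e x f := by
    refine Submodule.span_le.2 ?_
    rintro _ ⟨m, hm, n, hn, rfl⟩
    exact h.curv_mem hl hm hn
  have hs0 : tripleSpan e x f ≤ G.part 0 := Submodule.span_le.2 (by
    rintro v (rfl | rfl | rfl)
    exacts [h.e_even, h.x_even, h.f_even])
  -- The aim is that `E` together with the odd part is an ideal; by simplicity it is then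
  -- everything.
  let E := tripleSpan e x f ⊔ P
  have he : e ∈ E := Submodule.mem_sup_left (Submodule.subset_span (by simp))
  have hx : x ∈ E := Submodule.mem_sup_left (Submodule.subset_span (by simp))
  have hf : f ∈ E := Submodule.mem_sup_left (Submodule.subset_span (by simp))
  have hcurv : ∀ {m n}, m ∈ G.halfSpace x → n ∈ G.halfSpace x → G.curv l x f m n ∈ E :=
    fun hm hn => Submodule.mem_sup_right (Submodule.subset_span ⟨_, hm, _, hn, rfl⟩)
  have hE0 : E ≤ G.part 0 := sup_le hs0 fun a ha => h.gNatural_even (hPnat ha)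
  have hEE : ∀ v ∈ G.part 0, ∀ b ∈ E, G.bracket v b ∈ E := by
    intro v hv b hb
    obtain ⟨s, hs, p, hp, rfl⟩ := Submodule.mem_sup.1 hb
    obtain ⟨α', β', γ', rfl⟩ := Submodule.mem_span_triple.1 hs
    obtain ⟨α, β, γ, c, hc, rfl⟩ := h.exists_even hv
    obtain ⟨p1, p2, p3⟩ := mem_gNatural_iff.1 (hPnat hp)
    obtain ⟨c1, c2, c3⟩ := h.gNatural_bracket hc
    have hcp : G.bracket c p ∈ P := by
      refine Submodule.span_induction (p := fun p _ => G.bracket c p ∈ P) ?_ ?_ ?_ ?_ hp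
      · rintro _ ⟨m, hm, n, hn, rfl⟩
        rw [h.bracket_curv hl hc hm hn]
        exact add_mem
          (Submodule.subset_span ⟨_, h.gNatural_halfSpace hc hm, _, hn, rfl⟩)
          (Submodule.subset_span ⟨_, hm, _, h.gNatural_halfSpace hc hn, rfl⟩)
      · rw [map_zero]
        exact zero_mem _
      · intro a b _ _ ha hb
        rw [map_add]
        exact add_mem ha hb
      · intro t a _ ha
        rw [map_smul]
        exact Submodule.smul_mem _ _ ha
    have hcp' : G.bracket c p ∈ E := Submodule.mem_sup_right hcp
    simp only [map_add, map_smul, LinearMap.add_apply, LinearMap.smul_apply, p1, p2, p3, c1, c2, c3,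
      even_self h.e_even, even_self h.x_even, even_self h.f_even, h.lie_e_x, h.triple.lie_e_f,
      h.triple.lie_x_e, h.triple.lie_x_f, h.lie_f_e, h.lie_f_x]
    repeat' first
      | exact he
      | exact hx
      | exact hf
      | exact hcp'
      | apply zero_mem
      | apply add_mem
      | apply Submodule.smul_mem
      | apply neg_mem
  have hodd : ∀ v ∈ G.part 1, ∀ b ∈ G.part 1, G.bracket v b ∈ E := by
    intro v hv b hb
    obtain ⟨m, hm, n, hn, rfl⟩ := h.exists_odd hv
    obtain ⟨m', hm', n', hn', rfl⟩ := h.exists_odd hb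
    rw [map_add, map_add, LinearMap.add_apply, LinearMap.add_apply, h.bracket_half_half hl hm hm',
      h.bracket_f_half_f_half hl hn hn', bracket_half_f_half l x f m n',
      symm_odd (h.f_half_odd hn) (odd_of_mem_halfSpace hm'), bracket_half_f_half l x f m' n]
    have h1 := hcurv hm hn'
    have h2 := hcurv hm' hn
    repeat' first
      | exact he
      | exact hx
      | exact hf
      | exact h1
      | exact h2
      | apply add_mem
      | apply sub_mem
      | apply Submodule.smul_mem
  have hJ : G.IsIdeal (E ⊔ G.part 1) := by
    refine ⟨sup_le ?_ ?_, fun v b hb => ?_⟩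
    · exact le_sup_of_le_left (le_inf le_sup_left hE0)
    · exact le_sup_of_le_right (le_inf le_sup_right le_rfl)
    · obtain ⟨v0, hv0, v1, hv1, rfl⟩ := G.exists_add_eq v
      obtain ⟨b0, hb0, b1, hb1, rfl⟩ := Submodule.mem_sup.1 hb
      rw [map_add, map_add, LinearMap.add_apply, LinearMap.add_apply]
      refine add_mem (add_mem (Submodule.mem_sup_left (hEE v0 hv0 b0 hb0))
        (Submodule.mem_sup_right ?_)) (add_mem (Submodule.mem_sup_right
        (even_odd_mem hv0 hb1)) (Submodule.mem_sup_left (hodd v1 hv1 b1 hb1)))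
      rw [← neg_neg (G.bracket v1 b0), ← skew_even (hE0 hb0)]
      exact neg_mem (even_odd_mem (hE0 hb0) hv1)
  rcases hG.2 _ hJ with hbot | htop
  · exact absurd ((Submodule.eq_bot_iff _).1 hbot e (Submodule.mem_sup_left he)) h.e_ne_zero
  -- Comparing even parts, and then the components in `𝔰 ⊕ 𝔤^♮`, places `a` in `P`.
  · intro a ha
    have ha' : a ∈ E ⊔ G.part 1 := htop ▸ Submodule.mem_top
    obtain ⟨b, hb, c, hc, hbc⟩ := Submodule.mem_sup.1 ha'
    have hc0 : c = 0 := by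
      refine eq_zero_of_mem_parts ?_ hc
      rw [← add_sub_cancel_left b c, hbc]
      exact sub_mem (h.gNatural_even ha) (hE0 hb)
    obtain ⟨s, hs, p, hp, rfl⟩ := Submodule.mem_sup.1 hb
    obtain ⟨α, β, γ, rfl⟩ := Submodule.mem_span_triple.1 hs
    obtain ⟨-, -, -, h4⟩ := h.even_unique (sub_mem (hPnat hp) ha) (α := α) (β := β) (γ := γ) (by
      rw [← hbc, hc0]
      abel)
    rw [← sub_eq_zero.1 h4]
    exact hp

end IsMinimalSplit

/-! ### Orthonormal frames -/

/-- An orthonormal basis of the space of odd vectors of weight `1/2`. -/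
structure IsFrame (G : LieSuperalgebra V) (l : V →ₗ[ℂ] ℂ) (x : V) {ι : Type*} [DecidableEq ι]
    (b : ι → V) : Prop where
  mem : ∀ i, b i ∈ G.halfSpace x
  ortho : ∀ i j, G.form l (b i) (b j) = if i = j then 1 else 0
  span : G.halfSpace x ≤ Submodule.span ℂ (Set.range b)

/-- The coordinates of the four-linear form in a frame. -/
noncomputable def frameTensor (G : LieSuperalgebra V) (l : V →ₗ[ℂ] ℂ) (x f : V) {ι : Type*}
    (b : ι → V) : Tensor4 ι :=
  WithLp.toLp 2 fun y => G.fourForm l x f (b y.1) (b y.2.1) (b y.2.2.1) (b y.2.2.2)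

lemma frameTensor_apply (l : V →ₗ[ℂ] ℂ) (x f : V) {ι : Type*} (b : ι → V) (i j k p : ι) :
    G.frameTensor l x f b (i, j, k, p) = G.fourForm l x f (b i) (b j) (b k) (b p) := rfl

section Multilinear

variable {ι : Type*} [Fintype ι] (l : V →ₗ[ℂ] ℂ) (x f : V) (c : ι → ℂ) (b : ι → V) (m n p q : V)

lemma fourForm_sum_one : G.fourForm l x f (∑ i, c i • b i) n p q =
    ∑ i, c i * G.fourForm l x f (b i) n p q := by
  simp only [fourForm, map_sum, map_smul, LinearMap.sum_apply, LinearMap.smul_apply, smul_eq_mul,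
    Finset.sum_mul, mul_add, mul_sub, Finset.sum_add_distrib, Finset.sum_sub_distrib, mul_assoc]

lemma fourForm_sum_two : G.fourForm l x f m (∑ i, c i • b i) p q =
    ∑ i, c i * G.fourForm l x f m (b i) p q := by
  simp only [fourForm, map_sum, map_smul, LinearMap.sum_apply, LinearMap.smul_apply, smul_eq_mul,
    Finset.mul_sum, mul_add, mul_sub, Finset.sum_add_distrib, Finset.sum_sub_distrib, mul_left_comm]

lemma fourForm_sum_three : G.fourForm l x f m n (∑ i, c i • b i) q =
    ∑ i, c i * G.fourForm l x f m n (b i) q := by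
  simp only [fourForm, map_sum, map_smul, LinearMap.sum_apply, LinearMap.smul_apply, smul_eq_mul,
    Finset.mul_sum, Finset.sum_mul, mul_add, mul_sub, Finset.sum_add_distrib,
    Finset.sum_sub_distrib, mul_assoc, mul_left_comm]

lemma fourForm_sum_four : G.fourForm l x f m n p (∑ i, c i • b i) =
    ∑ i, c i * G.fourForm l x f m n p (b i) := by
  simp only [fourForm, map_sum, map_smul, smul_eq_mul,
    Finset.mul_sum, Finset.sum_mul, mul_add, mul_sub, Finset.sum_add_distrib,
    Finset.sum_sub_distrib, mul_assoc, mul_left_comm]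

/-- Together with `IsFrame.orthogonal`, this makes the set of frame tensors stable under the complex
orthogonal group. -/
lemma frameTensor_sum (g : Matrix ι ι ℂ) : G.frameTensor l x f (fun i => ∑ p, g i p • b p) =
    Tensor4.act g (G.frameTensor l x f b) := by
  ext ⟨i, j, k, p⟩
  rw [frameTensor_apply, fourForm_sum_one]
  simp only [fourForm_sum_two]
  simp only [fourForm_sum_three]
  simp only [fourForm_sum_four]
  rfl

end Multilinear

namespace IsFrame

variable {ι : Type*} [Fintype ι] [DecidableEq ι] {l : V →ₗ[ℂ] ℂ} {b : ι → V}

lemma eq_sum (hb : G.IsFrame l x b) {m : V} (hm : m ∈ G.halfSpace x) :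
    m = ∑ i, G.form l (b i) m • b i := by
  obtain ⟨c, rfl⟩ := (Submodule.mem_span_range_iff_exists_fun ℂ).1 (hb.span hm)
  refine Finset.sum_congr rfl fun i _ => ?_
  simp [hb.ortho]

lemma orthogonal (hb : G.IsFrame l x b) {g : Matrix ι ι ℂ} (hg : g * g.transpose = 1) :
    G.IsFrame l x fun i => ∑ p, g i p • b p where
  mem i := Submodule.sum_mem _ fun p _ => Submodule.smul_mem _ _ (hb.mem p)
  ortho i j := by
    have := congrFun (congrFun hg i) j
    rw [Matrix.mul_apply, Matrix.one_apply] at this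
    rw [← this]
    simp [hb.ortho, mul_comm]
  span := by
    refine hb.span.trans (Submodule.span_le.2 ?_)
    rintro _ ⟨p, rfl⟩
    have : b p = ∑ i, g i p • ∑ q, g i q • b q := by
      simp only [Finset.smul_sum, smul_smul]
      rw [Finset.sum_comm]
      have hg' := mul_eq_one_comm.1 hg
      have e : ∀ q, ∑ i, (g i p * g i q) • b q = (if p = q then (1 : ℂ) else 0) • b q := by
        intro q
        have := congrFun (congrFun hg' p) q
        rw [Matrix.mul_apply, Matrix.one_apply] at this
        rw [← Finset.sum_smul, ← this]
        rfl
      simp [e]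
    rw [this]
    exact Submodule.sum_mem _ fun i _ => Submodule.smul_mem _ _
      (Submodule.subset_span ⟨i, rfl⟩)

lemma curvature_apply (hb : G.IsFrame l x b) (i j k p : ι) :
    Tensor4.curvature (G.frameTensor l x f b) i j k p =
      G.form l (b k) (G.bracket (G.curv l x f (b i) (b j)) (b p)) := by
  rw [Tensor4.curvature_apply, frameTensor_apply, fourForm, hb.ortho, hb.ortho, hb.ortho, hb.ortho]
  simp only [@eq_comm ι j k]
  ring

variable (h : G.IsMinimalSplit e x f) (hl : l e = 1)
include h hl

lemma isAlternating (hb : G.IsFrame l x b) : (G.frameTensor l x f b).IsAlternating where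
  swap_one_two i j _ _ := h.fourForm_swap_one_two hl (hb.mem i) (hb.mem j)
  swap_two_three i j k p :=
    h.fourForm_swap_two_three hl (hb.mem i) (hb.mem j) (hb.mem k) (hb.mem p)
  swap_three_four i j k p :=
    h.fourForm_swap_three_four hl (hb.mem i) (hb.mem j) (hb.mem k) (hb.mem p)

/-- In a frame, the curvature matrices are those of `R(b i, b j)`, which lie in `𝔤^♮`; invariance
under `𝔤^♮` applies to them. -/
lemma isInvariant (hb : G.IsFrame l x b) : (G.frameTensor l x f b).IsInvariant := by
  intro i j
  set a := G.curv l x f (b i) (b j) with ha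
  have hmem : a ∈ G.gNatural e x f := h.curv_mem hl (hb.mem i) (hb.mem j)
  have hskew := (hb.isAlternating h hl).transpose_curvature i j
  -- Skew-symmetry passes from columns, which express `ad a` on the frame, to rows, which enter
  -- `lieAct`; this costs a sign.
  have hab : ∀ p, G.bracket a (b p) =
      -∑ k, Tensor4.curvature (G.frameTensor l x f b) i j p k • b k := by
    intro p
    rw [hb.eq_sum (h.gNatural_halfSpace hmem (hb.mem p)), ← Finset.sum_neg_distrib]
    refine Finset.sum_congr rfl fun k _ => ?_
    have := congrFun (congrFun hskew p) k
    rw [Matrix.transpose_apply, Matrix.neg_apply] at this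
    rw [← hb.curvature_apply, this, neg_smul]
  ext ⟨p, q, r, s⟩
  have := h.fourForm_invariant hl hmem (hb.mem p) (hb.mem q) (hb.mem r) (hb.mem s)
  simp only [hab, ← Finset.sum_neg_distrib, ← neg_smul, fourForm_sum_one, fourForm_sum_two,
    fourForm_sum_three, fourForm_sum_four, neg_mul] at this
  simp only [Finset.sum_neg_distrib] at this
  rw [Tensor4.lieAct_apply]
  simp only [frameTensor_apply, PiLp.zero_apply]
  linear_combination -this

end IsFrame

/-- Orthonormal frames exist. -/
lemma IsMinimalSplit.exists_frame [FiniteDimensional ℂ V] (h : G.IsMinimalSplit e x f)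
    {β : V →ₗ[ℂ] V →ₗ[ℂ] ℂ} (hβ : G.IsBasicForm β) {l : V →ₗ[ℂ] ℂ} (hl : l e = 1) :
    ∃ (N : ℕ) (b : Fin N → V), G.IsFrame l x b := by
  let B : LinearMap.BilinForm ℂ (G.halfSpace x) :=
    (G.form l).domRestrict₁₂ (G.halfSpace x) (G.halfSpace x)
  have hB : ∀ m n : G.halfSpace x, B m n = G.form l m n := fun _ _ => rfl
  have hsymm : LinearMap.IsSymm B := ⟨fun m n => form_symm_half m.2 n.2⟩
  obtain ⟨v, hv⟩ := LinearMap.BilinForm.exists_orthogonal_basis hsymm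
  have hne : ∀ i, B (v i) (v i) ≠ 0 := by
    intro i h0
    refine v.ne_zero i (Subtype.ext (h.form_nondegenerate hβ hl (v i).2 fun n hn => ?_))
    have h1 : B (v i) = 0 := v.ext fun j => by
      by_cases hij : i = j
      · rw [← hij, h0, LinearMap.zero_apply]
      · exact hv hij
    exact LinearMap.congr_fun h1 ⟨n, hn⟩
  -- Nondegeneracy makes every diagonal value nonzero, so square roots in `ℂ` normalize the
  -- orthogonal basis.
  choose c hc using fun i => IsAlgClosed.exists_pow_nat_eq (B (v i) (v i)) (n := 2) two_pos
  have hc0 : ∀ i, c i ≠ 0 := fun i h0 => hne i (by rw [← hc, h0]; norm_num)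
  refine ⟨_, fun i => (c i)⁻¹ • (v i : V), fun i => Submodule.smul_mem _ _ (v i).2,
    fun i j => ?_, fun m hm => ?_⟩
  · rw [map_smul, map_smul, LinearMap.smul_apply, ← hB, smul_eq_mul, smul_eq_mul]
    split_ifs with hij
    · rw [← hij, ← hc]
      have := hc0 i
      field_simp
    · have h0 : B (v i) (v j) = 0 := hv hij
      rw [h0, mul_zero, mul_zero]
  · have h1 := congrArg Subtype.val (v.sum_repr ⟨m, hm⟩)
    change _ = m at h1
    rw [← h1, AddSubmonoidClass.coe_finsetSum]
    refine Submodule.sum_mem _ fun i _ => ?_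
    rw [Submodule.coe_smul]
    refine Submodule.smul_mem _ _ ?_
    have h2 : (v i : V) = c i • (c i)⁻¹ • (v i : V) := by rw [smul_inv_smul₀ (hc0 i)]
    rw [h2]
    exact Submodule.smul_mem _ _ (Submodule.subset_span ⟨i, rfl⟩)

end LieSuperalgebra

/-! ### The coordinate model -/

/-- Coordinates on `𝔰 ⊕ 𝔤^♮ ⊕ 𝔤_{1/2} ⊕ 𝔤_{-1/2}`, where `𝔤^♮` is represented by matrices. -/
abbrev Model (ι : Type*) : Type _ := (Fin 3 → ℂ) × Matrix ι ι ℂ × (ι → ℂ) × (ι → ℂ)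

namespace Model

variable {ι : Type*} [Fintype ι] [DecidableEq ι]

/-- The bracket in coordinates, with respect to the basis `e, x, f` of `𝔰`. -/
noncomputable def bracket (T : Tensor4 ι) (X Y : Model ι) : Model ι :=
  (![X.1 1 * Y.1 0 - X.1 0 * Y.1 1 + X.2.2.1 ⬝ᵥ Y.2.2.1,
      X.1 0 * Y.1 2 - X.1 2 * Y.1 0 - (X.2.2.1 ⬝ᵥ Y.2.2.2 + Y.2.2.1 ⬝ᵥ X.2.2.2) / 2,
      X.1 2 * Y.1 1 - X.1 1 * Y.1 2 - X.2.2.2 ⬝ᵥ Y.2.2.2 / 2],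
    X.2.1 * Y.2.1 - Y.2.1 * X.2.1 + (1 / 4 : ℂ) •
      ∑ i, ∑ j, (X.2.2.1 i * Y.2.2.2 j + Y.2.2.1 i * X.2.2.2 j) • T.curvature i j,
    X.2.1.mulVec Y.2.2.1 + (1 / 2 * X.1 1) • Y.2.2.1 + (1 / 2 * X.1 0) • Y.2.2.2 -
      (Y.2.1.mulVec X.2.2.1 + (1 / 2 * Y.1 1) • X.2.2.1 + (1 / 2 * Y.1 0) • X.2.2.2),
    X.2.1.mulVec Y.2.2.2 - (1 / 2 * X.1 1) • Y.2.2.2 + X.1 2 • Y.2.2.1 -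
      (Y.2.1.mulVec X.2.2.2 - (1 / 2 * Y.1 1) • X.2.2.2 + Y.1 2 • X.2.2.1))

end Model

/-! ### From the superalgebra to the coordinate model -/

namespace LieSuperalgebra

variable {V : Type*} [AddCommGroup V] [Module ℂ V] {G : LieSuperalgebra V} {e x f : V}

/-- The bracket in terms of the decomposition `𝔤 = 𝔰 ⊕ 𝔤^♮ ⊕ 𝔤_{1/2} ⊕ [f, 𝔤_{1/2}]`. -/
lemma IsMinimalSplit.bracket_decomposition (h : G.IsMinimalSplit e x f) {l : V →ₗ[ℂ] ℂ}
    (hl : l e = 1) {a a' m n m' n' : V} (ha : a ∈ G.gNatural e x f) (ha' : a' ∈ G.gNatural e x f)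
    (hm : m ∈ G.halfSpace x) (hn : n ∈ G.halfSpace x) (hm' : m' ∈ G.halfSpace x)
    (hn' : n' ∈ G.halfSpace x) (s s' : Fin 3 → ℂ) :
    G.bracket (s 0 • e + s 1 • x + s 2 • f + (a + (m + G.bracket f n)))
      (s' 0 • e + s' 1 • x + s' 2 • f + (a' + (m' + G.bracket f n'))) =
    (s 1 * s' 0 - s 0 * s' 1 + G.form l m m') • e +
      (s 0 * s' 2 - s 2 * s' 0 - (G.form l m n' + G.form l m' n) / 2) • x +
      (s 2 * s' 1 - s 1 * s' 2 - G.form l n n' / 2) • f +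
    ((G.bracket a a' + (1 / 4 : ℂ) • (G.curv l x f m n' + G.curv l x f m' n)) +
      ((G.bracket a m' + (1 / 2 * s 1) • m' + (1 / 2 * s 0) • n' -
        (G.bracket a' m + (1 / 2 * s' 1) • m + (1 / 2 * s' 0) • n)) +
      G.bracket f (G.bracket a n' - (1 / 2 * s 1) • n' + s 2 • m' -
        (G.bracket a' n - (1 / 2 * s' 1) • n + s' 2 • m)))) := by
  obtain ⟨a1, a2, a3⟩ := h.gNatural_bracket ha
  obtain ⟨b1, b2, b3⟩ := mem_gNatural_iff.1 ha'
  have ha0 := h.gNatural_even ha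
  have ha0' := h.gNatural_even ha'
  have c1 : ∀ v, G.bracket v a' = -G.bracket a' v := fun v => by
    rw [skew_even ha0' v, neg_neg]
  have c2 : ∀ v, G.bracket v e = -G.bracket e v := fun v => by rw [skew_even h.e_even v, neg_neg]
  have c3 : ∀ v, G.bracket v x = -G.bracket x v := fun v => by rw [skew_even h.x_even v, neg_neg]
  have c4 : ∀ v, G.bracket v f = -G.bracket f v := fun v => by rw [skew_even h.f_even v, neg_neg]
  have d1 := h.gNatural_lie_f ha
  have d2 := h.gNatural_lie_f ha'
  have q1 := h.bracket_half_half hl hm hm'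
  have q2 := bracket_half_f_half (G := G) l x f m n'
  have q3 : G.bracket (G.bracket f n) m' = _ :=
    (symm_odd (h.f_half_odd hn) (odd_of_mem_halfSpace hm')).trans (bracket_half_f_half l x f m' n)
  have q4 := h.bracket_f_half_f_half hl hn hn'
  have e1 := h.bracket_e_half hm'
  have e2 := h.bracket_e_f_half hn'
  have e3 := (mem_halfSpace.1 hm').2
  have e4 := h.bracket_x_f_half hn'
  have e5 := h.bracket_f_f_half hn'
  have e6 : G.bracket m e = 0 := by rw [c2, h.bracket_e_half hm, neg_zero]
  have e7 : G.bracket (G.bracket f n) e = _ := (c2 _).trans (by rw [h.bracket_e_f_half hn])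
  have e8 : G.bracket m x = _ := (c3 _).trans (by rw [(mem_halfSpace.1 hm).2])
  have e9 : G.bracket (G.bracket f n) x = _ := (c3 _).trans (by rw [h.bracket_x_f_half hn])
  have e10 : G.bracket m f = _ := c4 _
  have e11 : G.bracket (G.bracket f n) f = _ := (c4 _).trans (by rw [h.bracket_f_f_half hn])
  have f1 : G.bracket m a' = _ := c1 m
  have f2 : G.bracket (G.bracket f n) a' = _ := (c1 _).trans (by rw [d2])
  simp only [map_add, map_sub, map_smul, LinearMap.add_apply, LinearMap.smul_apply, a1, a2, a3, b1,
    b2, b3, even_self h.e_even, even_self h.x_even, even_self h.f_even, h.lie_e_x, h.triple.lie_e_f,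
    h.triple.lie_x_e, h.triple.lie_x_f, h.lie_f_e, h.lie_f_x, q1, q2, q3, q4, e1, e2, e3, e4, e5,
    e6, e7, e8, e9, e10, e11, f1, f2, d1]
  module

/-- The matrix of `ad a` on the odd vectors of weight `1/2`, in an orthonormal frame. -/
noncomputable def frameMatrix (G : LieSuperalgebra V) (l : V →ₗ[ℂ] ℂ) {ι : Type*} (b : ι → V) :
    V →ₗ[ℂ] Matrix ι ι ℂ where
  toFun a := Matrix.of fun k p => G.form l (b k) (G.bracket a (b p))
  map_add' a a' := by
    ext k p
    simp
  map_smul' c a := by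
    ext k p
    simp

lemma frameMatrix_apply {l : V →ₗ[ℂ] ℂ} {ι : Type*} (b : ι → V) (a : V) (k p : ι) :
    G.frameMatrix l b a k p = G.form l (b k) (G.bracket a (b p)) := rfl

/-- `Ψ` identifies `𝔤` with a subalgebra of the coordinate model given by the four-form `T`. -/
structure IsModel (G : LieSuperalgebra V) (e x f : V) {ι : Type*} [Fintype ι] [DecidableEq ι]
    (T : Tensor4 ι) (Ψ : V →ₗ[ℂ] Model ι) : Prop where
  injective : Function.Injective Ψ
  map_bracket : ∀ v w, Ψ (G.bracket v w) = Model.bracket T (Ψ v) (Ψ w)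
  even_iff : ∀ v, v ∈ G.part 0 ↔ (Ψ v).2.2.1 = 0 ∧ (Ψ v).2.2.2 = 0
  odd_iff : ∀ v, v ∈ G.part 1 ↔ (Ψ v).1 = 0 ∧ (Ψ v).2.1 = 0
  map_e : Ψ e = (![1, 0, 0], 0, 0, 0)
  map_x : Ψ x = (![0, 1, 0], 0, 0, 0)
  map_f : Ψ f = (![0, 0, 1], 0, 0, 0)
  gNatural_iff : ∀ v, v ∈ G.gNatural e x f ↔ (Ψ v).1 = 0 ∧ (Ψ v).2.2.1 = 0 ∧ (Ψ v).2.2.2 = 0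
  mem_range_iff : ∀ X, X ∈ LinearMap.range Ψ ↔
    X.2.1 ∈ Submodule.span ℂ (Set.range fun p : ι × ι => T.curvature p.1 p.2)

namespace IsFrame

variable {ι : Type*} [Fintype ι] [DecidableEq ι] {l : V →ₗ[ℂ] ℂ} {b : ι → V}

lemma combination_mem (hb : G.IsFrame l x b) (u : ι → ℂ) :
    Fintype.linearCombination ℂ b u ∈ G.halfSpace x := by
  rw [Fintype.linearCombination_apply]
  exact Submodule.sum_mem _ fun i _ => Submodule.smul_mem _ _ (hb.mem i)

lemma form_combination (hb : G.IsFrame l x b) (u v : ι → ℂ) :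
    G.form l (Fintype.linearCombination ℂ b u) (Fintype.linearCombination ℂ b v) = u ⬝ᵥ v := by
  simp [Fintype.linearCombination_apply, hb.ortho, dotProduct, mul_comm]

lemma form_left_combination (hb : G.IsFrame l x b) (u : ι → ℂ) (i : ι) :
    G.form l (b i) (Fintype.linearCombination ℂ b u) = u i := by
  simp [Fintype.linearCombination_apply, hb.ortho]

lemma exists_combination (hb : G.IsFrame l x b) {m : V} (hm : m ∈ G.halfSpace x) :
    ∃ u, Fintype.linearCombination ℂ b u = m :=
  ⟨fun i => G.form l (b i) m, by rw [Fintype.linearCombination_apply, ← hb.eq_sum hm]⟩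

variable (h : G.IsMinimalSplit e x f)
include h

lemma bracket_combination (hb : G.IsFrame l x b) {a : V} (ha : a ∈ G.gNatural e x f) (u : ι → ℂ) :
    G.bracket a (Fintype.linearCombination ℂ b u) =
      Fintype.linearCombination ℂ b ((G.frameMatrix l b a).mulVec u) := by
  rw [hb.eq_sum (h.gNatural_halfSpace ha (hb.combination_mem u)),
    Fintype.linearCombination_apply ℂ b ((G.frameMatrix l b a).mulVec u)]
  refine Finset.sum_congr rfl fun i _ => ?_
  congr 1
  simp [Fintype.linearCombination_apply, Matrix.mulVec, dotProduct, frameMatrix_apply, mul_comm]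

lemma frameMatrix_lie (hb : G.IsFrame l x b) {a a' : V} (ha : a ∈ G.gNatural e x f)
    (ha' : a' ∈ G.gNatural e x f) : G.frameMatrix l b (G.bracket a a') =
      G.frameMatrix l b a * G.frameMatrix l b a' - G.frameMatrix l b a' * G.frameMatrix l b a := by
  have key : ∀ {a a' : V}, a ∈ G.gNatural e x f → a' ∈ G.gNatural e x f → ∀ k p,
      G.form l (b k) (G.bracket a (G.bracket a' (b p))) =
        (G.frameMatrix l b a * G.frameMatrix l b a') k p := by
    intro a a' ha ha' k p
    have hp : b p = Fintype.linearCombination ℂ b (Pi.single p 1) := by simp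
    rw [hp, hb.bracket_combination h ha', hb.bracket_combination h ha, Matrix.mulVec_mulVec,
      hb.form_left_combination]
    simp
  ext k p
  have := jacobi_even (h.gNatural_even ha) a' (b p)
  rw [Matrix.sub_apply, ← key ha ha', ← key ha' ha, this, frameMatrix_apply, map_add]
  ring

omit h in
lemma frameMatrix_curv (hb : G.IsFrame l x b) (u v : ι → ℂ) :
    G.frameMatrix l b (G.curv l x f (Fintype.linearCombination ℂ b u)
      (Fintype.linearCombination ℂ b v)) =
    ∑ i, ∑ j, (u i * v j) • (G.frameTensor l x f b).curvature i j := by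
  have : ∀ i j, (G.frameTensor l x f b).curvature i j =
      G.frameMatrix l b (G.curv l x f (b i) (b j)) := by
    intro i j
    ext k p
    rw [hb.curvature_apply, frameMatrix_apply]
  simp only [this, Fintype.linearCombination_apply, map_sum, map_smul, LinearMap.sum_apply,
    LinearMap.smul_apply, Finset.smul_sum, smul_smul]
  rw [Finset.sum_comm]
  simp only [mul_comm]

/-- A frame produces a coordinate model. -/
theorem exists_isModel [FiniteDimensional ℂ V] (hb : G.IsFrame l x b) (hG : G.IsSimple)
    (hl : l e = 1) : ∃ Ψ : V →ₗ[ℂ] Model ι, G.IsModel e x f (G.frameTensor l x f b) Ψ := by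
  set K := G.gNatural e x f with hK
  let c := Fintype.linearCombination ℂ b
  have hc : ∀ u, c u ∈ G.halfSpace x := hb.combination_mem
  -- Here `𝔤^♮` is still abstract; `Ψ` will be the inverse of `Θ`, followed by the faithful matrix
  -- representation of `𝔤^♮`.
  let Θ : ((Fin 3 → ℂ) × K × (ι → ℂ) × (ι → ℂ)) →ₗ[ℂ] V :=
    (Fintype.linearCombination ℂ ![e, x, f]).coprod
      (K.subtype.coprod (c.coprod (G.bracket f ∘ₗ c)))
  have hΘ : ∀ s (a : K) u w, Θ (s, a, u, w) =
      s 0 • e + s 1 • x + s 2 • f + ((a : V) + (c u + G.bracket f (c w))) := by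
    intro s a u w
    simp [Θ, Fintype.linearCombination_apply, Fin.sum_univ_three]
  have heven : ∀ s : Fin 3 → ℂ, ∀ a : K, s 0 • e + s 1 • x + s 2 • f + (a : V) ∈ G.part 0 :=
    fun s a => add_mem (add_mem (add_mem (Submodule.smul_mem _ _ h.e_even)
      (Submodule.smul_mem _ _ h.x_even)) (Submodule.smul_mem _ _ h.f_even)) (h.gNatural_even a.2)
  have hodd : ∀ u w, c u + G.bracket f (c w) ∈ G.part 1 :=
    fun u w => add_mem (odd_of_mem_halfSpace (hc u)) (h.f_half_odd (hc w))
  have hevenz : ∀ (s : Fin 3 → ℂ) (a : K), s 0 • e + s 1 • x + s 2 • f + (a : V) = 0 →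
      s = 0 ∧ a = 0 := by
    intro s a h0
    obtain ⟨h1, h2, h3, h4⟩ := h.even_unique a.2 h0
    refine ⟨?_, Subtype.ext h4⟩
    ext i
    fin_cases i <;> assumption
  have hcz : ∀ u, c u = 0 → u = 0 := by
    intro u h0
    ext i
    rw [← hb.form_left_combination u i]
    change G.form l (b i) (c u) = 0
    rw [h0, map_zero]
  have hoddz : ∀ u w, c u + G.bracket f (c w) = 0 → u = 0 ∧ w = 0 := by
    intro u w h0
    -- `ad e` kills the first summand and sends `[f, c w]` to half of `c w`.
    have h1 := congrArg (G.bracket e) h0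
    rw [map_add, h.bracket_e_half (hc u), h.bracket_e_f_half (hc w), zero_add, map_zero,
      smul_eq_zero] at h1
    have hw := hcz w (h1.resolve_left (by norm_num))
    rw [hw, map_zero, map_zero, add_zero] at h0
    exact ⟨hcz u h0, hw⟩
  have hsplit : ∀ s (a : K) u w, (Θ (s, a, u, w) ∈ G.part 0 ↔ u = 0 ∧ w = 0) ∧
      (Θ (s, a, u, w) ∈ G.part 1 ↔ s = 0 ∧ a = 0) := by
    intro s a u w
    rw [hΘ, ← add_assoc]
    refine ⟨⟨fun h0 => hoddz u w ?_, ?_⟩, ⟨fun h1 => hevenz s a ?_, ?_⟩⟩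
    · exact eq_zero_of_mem_parts (by simpa using sub_mem h0 (heven s a)) (hodd u w)
    · rintro ⟨rfl, rfl⟩
      simpa using heven s a
    · exact eq_zero_of_mem_parts (heven s a) (by simpa using sub_mem h1 (hodd u w))
    · rintro ⟨rfl, rfl⟩
      simpa using hodd u w
  have hinj : Function.Injective Θ := by
    rw [injective_iff_map_eq_zero]
    rintro ⟨s, a, u, w⟩ h0
    obtain ⟨rfl, rfl⟩ := (hsplit s a u w).1.1 (h0 ▸ zero_mem _)
    obtain ⟨rfl, rfl⟩ := (hsplit s a 0 0).2.1 (h0 ▸ zero_mem _)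
    rfl
  have hsurj : Function.Surjective Θ := by
    intro v
    obtain ⟨v0, hv0, v1, hv1, rfl⟩ := G.exists_add_eq v
    obtain ⟨α, β, γ, a, ha, rfl⟩ := h.exists_even hv0
    obtain ⟨m, hm, n, hn, rfl⟩ := h.exists_odd hv1
    obtain ⟨u, rfl⟩ := hb.exists_combination hm
    obtain ⟨w, rfl⟩ := hb.exists_combination hn
    refine ⟨(![α, β, γ], ⟨a, ha⟩, u, w), ?_⟩
    rw [hΘ]
    simp [c, add_assoc]
  let Θe := LinearEquiv.ofBijective Θ ⟨hinj, hsurj⟩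
  let μ : K →ₗ[ℂ] Matrix ι ι ℂ := G.frameMatrix l b ∘ₗ K.subtype
  have hμ : ∀ a : K, μ a = G.frameMatrix l b a := fun _ => rfl
  have hμz : ∀ a : K, μ a = 0 → a = 0 := by
    intro a h0
    refine Subtype.ext (h.gNatural_faithful hG a.2 fun m hm => ?_)
    obtain ⟨u, rfl⟩ := hb.exists_combination hm
    rw [hb.bracket_combination h a.2, ← hμ, h0, Matrix.zero_mulVec, map_zero]
  let Ψ : V →ₗ[ℂ] Model ι :=
    (LinearMap.prodMap LinearMap.id (LinearMap.prodMap μ LinearMap.id)) ∘ₗ Θe.symm.toLinearMap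
  have hΨ : ∀ s (a : K) u w, Ψ (Θ (s, a, u, w)) = (s, μ a, u, w) := by
    intro s a u w
    have : Θe.symm (Θ (s, a, u, w)) = (s, a, u, w) := Θe.symm_apply_apply _
    simp [Ψ, this]
  -- Both inclusions compare `𝔤^♮` with the span of the `R(m, n)`; the nontrivial one comes from
  -- simplicity.
  have hμrange : LinearMap.range μ = Submodule.span ℂ
      (Set.range fun p : ι × ι => (G.frameTensor l x f b).curvature p.1 p.2) := by
    have hmap : LinearMap.range μ = K.map (G.frameMatrix l b) := by
      rw [LinearMap.range_comp, Submodule.range_subtype]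
    rw [hmap]
    apply le_antisymm
    · refine (Submodule.map_mono (h.gNatural_le_span hG hl)).trans ?_
      rw [Submodule.map_span, Submodule.span_le]
      rintro _ ⟨_, ⟨m, hm, n, hn, rfl⟩, rfl⟩
      obtain ⟨u, rfl⟩ := hb.exists_combination hm
      obtain ⟨w, rfl⟩ := hb.exists_combination hn
      rw [hb.frameMatrix_curv]
      exact Submodule.sum_mem _ fun i _ => Submodule.sum_mem _ fun j _ =>
        Submodule.smul_mem _ _ (Submodule.subset_span ⟨(i, j), rfl⟩)
    · rw [Submodule.span_le]
      rintro _ ⟨⟨i, j⟩, rfl⟩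
      refine ⟨G.curv l x f (b i) (b j), h.curv_mem hl (hb.mem i) (hb.mem j), ?_⟩
      ext k p
      exact (hb.curvature_apply i j k p).symm
  refine ⟨Ψ, ?_, ?_, ?_, ?_, ?_, ?_, ?_, ?_, ?_⟩
  · rw [injective_iff_map_eq_zero]
    intro v hv
    obtain ⟨⟨s, a, u, w⟩, rfl⟩ := hsurj v
    rw [hΨ] at hv
    simp only [Prod.mk_eq_zero] at hv
    rw [hv.1, hμz a hv.2.1, hv.2.2.1, hv.2.2.2]
    exact map_zero Θ
  · intro v v'
    obtain ⟨⟨s, a, u, w⟩, rfl⟩ := hsurj v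
    obtain ⟨⟨s', a', u', w'⟩, rfl⟩ := hsurj v'
    rw [hΨ, hΨ, hΘ, hΘ, h.bracket_decomposition hl a.2 a'.2 (hc u) (hc w) (hc u') (hc w')]
    have hmem : G.bracket a a' + (1 / 4 : ℂ) • (G.curv l x f (c u) (c w') +
        G.curv l x f (c u') (c w)) ∈ K :=
      add_mem (h.gNatural_lie_mem a.2 a'.2) (Submodule.smul_mem _ _
        (add_mem (h.curv_mem hl (hc u) (hc w')) (h.curv_mem hl (hc u') (hc w))))
    have hform : ∀ u v, G.form l (c u) (c v) = u ⬝ᵥ v := hb.form_combination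
    have hact : ∀ (a : K) u, G.bracket a (c u) = c ((μ a).mulVec u) :=
      fun a u => hb.bracket_combination h a.2 u
    have hcurv : ∀ u v, G.frameMatrix l b (G.curv l x f (c u) (c v)) = _ :=
      fun u v => hb.frameMatrix_curv u v
    have := hΨ ![s 1 * s' 0 - s 0 * s' 1 + u ⬝ᵥ u',
      s 0 * s' 2 - s 2 * s' 0 - (u ⬝ᵥ w' + u' ⬝ᵥ w) / 2,
      s 2 * s' 1 - s 1 * s' 2 - w ⬝ᵥ w' / 2] ⟨_, hmem⟩
      ((μ a).mulVec u' + (1 / 2 * s 1) • u' + (1 / 2 * s 0) • w' -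
        ((μ a').mulVec u + (1 / 2 * s' 1) • u + (1 / 2 * s' 0) • w))
      ((μ a).mulVec w' - (1 / 2 * s 1) • w' + s 2 • u' -
        ((μ a').mulVec w - (1 / 2 * s' 1) • w + s' 2 • u))
    rw [hΘ] at this
    simp only [map_add, map_sub, map_smul, Matrix.cons_val_zero, Matrix.cons_val_one,
      Matrix.cons_val] at this
    simp only [map_add, map_sub, map_smul, hform, hact]
    rw [this]
    refine Prod.ext rfl (Prod.ext ?_ rfl)
    simp only [Model.bracket, hμ, map_add, map_smul, hcurv, hb.frameMatrix_lie h a.2 a'.2, add_smul,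
      Finset.sum_add_distrib]
  · intro v
    obtain ⟨⟨s, a, u, w⟩, rfl⟩ := hsurj v
    rw [hΨ, (hsplit s a u w).1]
  · intro v
    obtain ⟨⟨s, a, u, w⟩, rfl⟩ := hsurj v
    rw [hΨ, (hsplit s a u w).2]
    exact and_congr_right fun _ => ⟨fun h0 => by rw [h0, map_zero], hμz a⟩
  · have := hΨ ![1, 0, 0] 0 0 0
    rw [hΘ] at this
    simpa using this
  · have := hΨ ![0, 1, 0] 0 0 0
    rw [hΘ] at this
    simpa using this
  · have := hΨ ![0, 0, 1] 0 0 0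
    rw [hΘ] at this
    simpa using this
  · intro v
    constructor
    · intro hv
      have := hΨ 0 ⟨v, hv⟩ 0 0
      rw [hΘ] at this
      simp only [Pi.zero_apply, zero_smul, map_zero, add_zero, zero_add] at this
      rw [this]
      exact ⟨rfl, rfl, rfl⟩
    · obtain ⟨⟨s, a, u, w⟩, rfl⟩ := hsurj v
      rw [hΨ]
      rintro ⟨rfl, rfl, rfl⟩
      rw [hΘ]
      simp
  · intro X
    rw [← hμrange]
    constructor
    · rintro ⟨v, rfl⟩
      obtain ⟨⟨s, a, u, w⟩, rfl⟩ := hsurj v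
      rw [hΨ]
      exact ⟨a, rfl⟩
    · rintro ⟨a, ha⟩
      refine ⟨Θ (X.1, a, X.2.2.1, X.2.2.2), ?_⟩
      rw [hΨ, ha]

end IsFrame

end LieSuperalgebra

/-! ### The involution attached to a real four-form -/

namespace Model

variable {ι : Type*}

/-- Complex conjugation of the coordinates. -/
def conj (X : Model ι) : Model ι :=
  (fun i => starRingEnd ℂ (X.1 i), X.2.1.map (starRingEnd ℂ), fun i => starRingEnd ℂ (X.2.2.1 i),
    fun i => starRingEnd ℂ (X.2.2.2 i))

lemma conj_eq_zero {κ : Type*} {u : κ → ℂ} (h : u = 0) : (fun i => starRingEnd ℂ (u i)) = 0 := by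
  subst h
  ext
  simp

lemma conj_conj (X : Model ι) : conj (conj X) = X := by
  refine Prod.ext ?_ (Prod.ext ?_ (Prod.ext ?_ ?_)) <;> ext <;> simp [conj]

lemma conj_add (X Y : Model ι) : conj (X + Y) = conj X + conj Y := by
  refine Prod.ext ?_ (Prod.ext ?_ (Prod.ext ?_ ?_)) <;> ext <;> simp [conj]

lemma conj_smul (c : ℂ) (X : Model ι) : conj (c • X) = starRingEnd ℂ c • conj X := by
  refine Prod.ext ?_ (Prod.ext ?_ (Prod.ext ?_ ?_)) <;> ext <;> simp [conj]

variable [Fintype ι]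

open scoped ComplexOrder

/-- The standard Hermitian form on the coordinate model. -/
noncomputable def hermitian (X Y : Model ι) : ℂ :=
  star X.1 ⬝ᵥ Y.1 + (X.2.1.conjTranspose * Y.2.1).trace + star X.2.2.1 ⬝ᵥ Y.2.2.1 +
    star X.2.2.2 ⬝ᵥ Y.2.2.2

lemma conj_star_dotProduct {κ : Type*} [Fintype κ] (u v : κ → ℂ) :
    starRingEnd ℂ (star u ⬝ᵥ v) = star v ⬝ᵥ u := by
  simp [dotProduct, mul_comm]

lemma conj_hermitian (X Y : Model ι) : starRingEnd ℂ (hermitian Y X) = hermitian X Y := by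
  have h2 : ∀ A B : Matrix ι ι ℂ, starRingEnd ℂ (A.conjTranspose * B).trace =
      (B.conjTranspose * A).trace := fun A B => by
    rw [starRingEnd_apply, ← Matrix.trace_conjTranspose, Matrix.conjTranspose_mul,
      Matrix.conjTranspose_conjTranspose]
  simp only [hermitian, map_add, h2]
  rw [conj_star_dotProduct, conj_star_dotProduct, conj_star_dotProduct]

lemma hermitian_add_left (X Y Z : Model ι) :
    hermitian (X + Y) Z = hermitian X Z + hermitian Y Z := by
  simp only [hermitian, Prod.fst_add, Prod.snd_add, star_add, add_dotProduct,
    Matrix.conjTranspose_add, Matrix.add_mul, Matrix.trace_add]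
  ring

lemma hermitian_smul_left (c : ℂ) (X Y : Model ι) :
    hermitian (c • X) Y = starRingEnd ℂ c * hermitian X Y := by
  simp only [hermitian, Prod.smul_fst, Prod.smul_snd, star_smul, smul_dotProduct,
    Matrix.conjTranspose_smul, Matrix.smul_mul, Matrix.trace_smul, smul_eq_mul, starRingEnd_apply]
  ring

lemma hermitian_self_nonneg (X : Model ι) : 0 ≤ hermitian X X :=
  add_nonneg (add_nonneg (add_nonneg (dotProduct_star_self_nonneg _)
    (Matrix.posSemidef_conjTranspose_mul_self _).trace_nonneg) (dotProduct_star_self_nonneg _))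
    (dotProduct_star_self_nonneg _)

lemma eq_zero_of_hermitian_self (X : Model ι) (h : hermitian X X = 0) : X = 0 := by
  have n1 : 0 ≤ star X.1 ⬝ᵥ X.1 := dotProduct_star_self_nonneg _
  have n2 := (Matrix.posSemidef_conjTranspose_mul_self X.2.1).trace_nonneg
  have n3 : 0 ≤ star X.2.2.1 ⬝ᵥ X.2.2.1 := dotProduct_star_self_nonneg _
  have n4 : 0 ≤ star X.2.2.2 ⬝ᵥ X.2.2.2 := dotProduct_star_self_nonneg _
  obtain ⟨h123, h4⟩ := (add_eq_zero_iff_of_nonneg (add_nonneg (add_nonneg n1 n2) n3) n4).1 h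
  obtain ⟨h12, h3⟩ := (add_eq_zero_iff_of_nonneg (add_nonneg n1 n2) n3).1 h123
  obtain ⟨h1, h2⟩ := (add_eq_zero_iff_of_nonneg n1 n2).1 h12
  exact Prod.ext (dotProduct_star_self_eq_zero.1 h1)
    (Prod.ext (Matrix.trace_conjTranspose_mul_self_eq_zero_iff.1 h2)
    (Prod.ext (dotProduct_star_self_eq_zero.1 h3) (dotProduct_star_self_eq_zero.1 h4)))

variable [DecidableEq ι]

/-- Apart from the entries of the curvature operators, which are real when `T` is, all structure
constants are rational. -/
lemma conj_bracket {T : Tensor4 ι} (hT : T.conj = T) (X Y : Model ι) :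
    conj (bracket T X Y) = bracket T (conj X) (conj Y) := by
  have hc : ∀ i j k l, starRingEnd ℂ (T.curvature i j k l) = T.curvature i j k l := by
    intro i j k l
    have := congrFun (congrFun (Tensor4.map_conj_curvature T i j) k) l
    rwa [hT] at this
  have c2 : starRingEnd ℂ 2 = 2 := map_ofNat _ 2
  have c4 : starRingEnd ℂ 4 = 4 := map_ofNat _ 4
  refine Prod.ext ?_ (Prod.ext ?_ (Prod.ext ?_ ?_))
  · ext i
    fin_cases i <;> simp [conj, bracket, dotProduct, c2]
  · ext i j
    simp [conj, bracket, Matrix.mul_apply, Matrix.sum_apply, hc, c4]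
  · ext i
    simp [conj, bracket, Matrix.mulVec, dotProduct, c2]
  · ext i
    simp [conj, bracket, Matrix.mulVec, dotProduct, c2]

lemma bracket_matrix (T : Tensor4 ι) (A : Matrix ι ι ℂ) (Y : Model ι) :
    bracket T (0, A, 0, 0) Y =
      (0, A * Y.2.1 - Y.2.1 * A, A.mulVec Y.2.2.1, A.mulVec Y.2.2.2) := by
  refine Prod.ext ?_ (Prod.ext ?_ (Prod.ext ?_ ?_))
  · ext i
    fin_cases i <;> simp [bracket]
  · simp [bracket]
  · simp [bracket]
  · simp [bracket]

/-- Such an `A` acts by zero on `𝔰`, by a commutator on matrices and by itself on the two odd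
summands; each of these is skew-Hermitian. -/
lemma hermitian_bracket (T : Tensor4 ι) {A : Matrix ι ι ℂ} (hA : A.conjTranspose = -A)
    (X Y : Model ι) :
    hermitian (bracket T (0, A, 0, 0) X) Y = -hermitian X (bracket T (0, A, 0, 0) Y) := by
  have h1 : ∀ u v : ι → ℂ, star (A.mulVec u) ⬝ᵥ v = -(star u ⬝ᵥ A.mulVec v) := by
    intro u v
    rw [Matrix.star_mulVec, hA, ← Matrix.dotProduct_mulVec, Matrix.neg_mulVec, dotProduct_neg]
  have h2 : ∀ B C : Matrix ι ι ℂ, ((A * B - B * A).conjTranspose * C).trace =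
      -(B.conjTranspose * (A * C - C * A)).trace := by
    intro B C
    rw [Matrix.conjTranspose_sub, Matrix.conjTranspose_mul, Matrix.conjTranspose_mul, hA,
      Matrix.sub_mul, Matrix.mul_sub, Matrix.trace_sub, Matrix.trace_sub,
      ← Matrix.mul_assoc B.conjTranspose C A, Matrix.trace_mul_comm (B.conjTranspose * C) A,
      Matrix.mul_neg, Matrix.neg_mul, Matrix.neg_mul, Matrix.neg_mul, Matrix.trace_neg,
      Matrix.trace_neg, Matrix.mul_assoc, Matrix.mul_assoc]
    ring
  rw [bracket_matrix, bracket_matrix, hermitian, hermitian]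
  simp only [h1, h2, star_zero, zero_dotProduct, dotProduct_zero]
  ring

end Model

namespace LieSuperalgebra

variable {V : Type*} [AddCommGroup V] [Module ℂ V] {G : LieSuperalgebra V} {e x f : V}
  {ι : Type*} [Fintype ι] [DecidableEq ι] {T : Tensor4 ι} {Ψ : V →ₗ[ℂ] Model ι}

namespace IsModel

/-- The range is cut out by a condition on the matrix component alone: membership in a span of real
matrices. -/
lemma conj_mem_range (h : G.IsModel e x f T Ψ) (hT : T.conj = T) (v : V) :
    ∃ w, Ψ w = Model.conj (Ψ v) := by
  refine (h.mem_range_iff _).2 ?_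
  have hv : (Ψ v).2.1 ∈ _ := (h.mem_range_iff (Ψ v)).1 ⟨v, rfl⟩
  change (Ψ v).2.1.map (starRingEnd ℂ) ∈ _
  refine Submodule.span_induction (p := fun A _ => A.map (starRingEnd ℂ) ∈ Submodule.span ℂ
    (Set.range fun p : ι × ι => T.curvature p.1 p.2)) ?_ ?_ ?_ ?_ hv
  · rintro _ ⟨⟨i, j⟩, rfl⟩
    change (T.curvature i j).map (starRingEnd ℂ) ∈ _
    rw [Tensor4.map_conj_curvature, hT]
    exact Submodule.subset_span ⟨(i, j), rfl⟩
  · rw [Matrix.map_zero _ (map_zero _)]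
    exact zero_mem _
  · intro A B _ _ hA hB
    rw [Matrix.map_add _ (map_add _)]
    exact add_mem hA hB
  · intro c A _ hA
    have : (c • A).map (starRingEnd ℂ) = starRingEnd ℂ c • A.map (starRingEnd ℂ) := by
      ext
      simp
    rw [this]
    exact Submodule.smul_mem _ _ hA

lemma transpose_matrix (h : G.IsModel e x f T Ψ) (hT : T.IsAlternating) (v : V) :
    (Ψ v).2.1.transpose = -(Ψ v).2.1 := by
  have hv : (Ψ v).2.1 ∈ _ := (h.mem_range_iff (Ψ v)).1 ⟨v, rfl⟩
  refine Submodule.span_induction (p := fun A _ => A.transpose = -A) ?_ ?_ ?_ ?_ hv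
  · rintro _ ⟨⟨i, j⟩, rfl⟩
    exact hT.transpose_curvature i j
  · simp
  · intro A B _ _ hA hB
    rw [Matrix.transpose_add, hA, hB, neg_add]
  · intro c A _ hA
    rw [Matrix.transpose_smul, hA, smul_neg]

/-- The pull-back of the standard Hermitian form. -/
@[reducible]
noncomputable def innerCore (h : G.IsModel e x f T Ψ) : InnerProductSpace.Core ℂ V where
  inner v w := Model.hermitian (Ψ v) (Ψ w)
  conj_inner_symm v w := Model.conj_hermitian _ _
  re_inner_nonneg v := (Complex.le_def.1 (Model.hermitian_self_nonneg (Ψ v))).1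
  add_left u v w := by
    rw [map_add]
    exact Model.hermitian_add_left _ _ _
  smul_left v w c := by
    rw [map_smul]
    exact Model.hermitian_smul_left _ _ _
  definite v hv := h.injective (by rw [Model.eq_zero_of_hermitian_self _ hv, map_zero])

/-- A model with a real four-form has an almost compact involution. -/
theorem exists_isAlmostCompact (h : G.IsModel e x f T Ψ) (hT : T.IsAlternating)
    (hreal : T.conj = T) : ∃ φ : V →ₛₗ[starRingEnd ℂ] V, G.IsAlmostCompact e x f φ := by
  -- `φ` is conjugation transported through the injective map `Ψ`; all identities are checked after
  -- `Ψ`.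
  choose φ hφ using h.conj_mem_range hreal
  let φl : V →ₛₗ[starRingEnd ℂ] V :=
    { toFun := φ
      map_add' := fun v w => h.injective (by
        rw [hφ, map_add, Model.conj_add, map_add, hφ, hφ])
      map_smul' := fun c v => h.injective (by
        rw [hφ, map_smul, Model.conj_smul, map_smul, hφ]) }
  have hφl : ∀ v, Ψ (φl v) = Model.conj (Ψ v) := hφ
  have hnat : ∀ a ∈ G.gNatural e x f, φl a ∈ G.gNatural e x f := by
    intro a ha
    obtain ⟨h1, h2, h3⟩ := (h.gNatural_iff a).1 ha
    rw [h.gNatural_iff, hφl]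
    exact ⟨Model.conj_eq_zero h1, Model.conj_eq_zero h2, Model.conj_eq_zero h3⟩
  refine ⟨φl, ⟨fun v => h.injective ?_, fun i v hv => ?_, fun v w => h.injective ?_⟩,
    h.injective ?_, h.injective ?_, h.injective ?_, hnat, h.innerCore, fun a ha hfix u v => ?_⟩
  · rw [hφl, hφl, Model.conj_conj]
  · rcases D21.mem_part_cases i with rfl | rfl
    · rw [h.even_iff] at hv ⊢
      rw [hφl]
      exact ⟨Model.conj_eq_zero hv.1, Model.conj_eq_zero hv.2⟩
    · rw [h.odd_iff] at hv ⊢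
      rw [hφl]
      refine ⟨Model.conj_eq_zero hv.1, ?_⟩
      change (Ψ v).2.1.map (starRingEnd ℂ) = 0
      rw [hv.2, Matrix.map_zero _ (map_zero _)]
  · rw [hφl, h.map_bracket, Model.conj_bracket hreal, h.map_bracket, hφl, hφl]
  · rw [hφl, h.map_e]
    refine Prod.ext ?_ (Prod.ext ?_ (Prod.ext ?_ ?_)) <;> ext i <;> try simp [Model.conj]
    fin_cases i <;> simp
  · rw [hφl, h.map_x]
    refine Prod.ext ?_ (Prod.ext ?_ (Prod.ext ?_ ?_)) <;> ext i <;> try simp [Model.conj]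
    fin_cases i <;> simp
  · rw [hφl, h.map_f]
    refine Prod.ext ?_ (Prod.ext ?_ (Prod.ext ?_ ?_)) <;> ext i <;> try simp [Model.conj]
    fin_cases i <;> simp
  · change Model.hermitian (Ψ (G.bracket a u)) (Ψ v) = -Model.hermitian (Ψ u) (Ψ (G.bracket a v))
    obtain ⟨h1, h2, h3⟩ := (h.gNatural_iff a).1 ha
    have ha' : Ψ a = (0, (Ψ a).2.1, 0, 0) := Prod.ext h1 (Prod.ext rfl (Prod.ext h2 h3))
    have hstar : (Ψ a).2.1.map (starRingEnd ℂ) = (Ψ a).2.1 := by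
      have := hφl a
      rw [hfix] at this
      exact (congrArg (fun X : Model ι => X.2.1) this).symm
    -- A fixed element has a real matrix, and real skew-symmetric matrices are skew-Hermitian.
    have hA : (Ψ a).2.1.conjTranspose = -(Ψ a).2.1 := by
      rw [← h.transpose_matrix hT a, Matrix.conjTranspose, Matrix.transpose_map]
      exact congrArg Matrix.transpose hstar
    rw [h.map_bracket, h.map_bracket, ha']
    exact Model.hermitian_bracket T hA _ _

end IsModel

end LieSuperalgebra

/-! ### Alternating four-forms in dimension four -/

namespace Tensor4

/-- An alternating function of four indices in `Fin 4` is determined by its value at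
`(0, 1, 2, 3)`. -/
lemma eq_zero_of_alternating {D : Fin 4 → Fin 4 → Fin 4 → Fin 4 → ℂ}
    (h12 : ∀ i j k l, D i j k l = -D j i k l) (h23 : ∀ i j k l, D i j k l = -D i k j l)
    (h34 : ∀ i j k l, D i j k l = -D i j l k) (h : D 0 1 2 3 = 0) (i j k l : Fin 4) :
    D i j k l = 0 := by
  have s12 : ∀ i j k l, D j i k l = 0 → D i j k l = 0 := fun i j k l h => by rw [h12, h, neg_zero]
  have s23 : ∀ i j k l, D i k j l = 0 → D i j k l = 0 := fun i j k l h => by rw [h23, h, neg_zero]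
  have s34 : ∀ i j k l, D i j l k = 0 → D i j k l = 0 := fun i j k l h => by rw [h34, h, neg_zero]
  -- A weakly increasing quadruple either repeats an index or is `(0, 1, 2, 3)`; `l2` and `l3` sort
  -- the remaining cases by insertion.
  have l1 : ∀ i j k l : Fin 4, i ≤ j → j ≤ k → k ≤ l → D i j k l = 0 := by
    intro i j k l hij hjk hkl
    rcases hij.eq_or_lt with rfl | hij
    · exact self_eq_neg.1 (h12 i i k l)
    rcases hjk.eq_or_lt with rfl | hjk
    · exact self_eq_neg.1 (h23 i j j l)
    rcases hkl.eq_or_lt with rfl | hkl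
    · exact self_eq_neg.1 (h34 i j k k)
    obtain rfl : i = 0 := by omega
    obtain rfl : j = 1 := by omega
    obtain rfl : k = 2 := by omega
    obtain rfl : l = 3 := by omega
    exact h
  have l2 : ∀ i j k l : Fin 4, i ≤ j → j ≤ k → D i j k l = 0 := by
    intro i j k l hij hjk
    rcases le_total k l with h1 | h1
    · exact l1 _ _ _ _ hij hjk h1
    refine s34 _ _ _ _ ?_
    rcases le_total j l with h2 | h2
    · exact l1 _ _ _ _ hij h2 h1
    refine s23 _ _ _ _ ?_
    rcases le_total i l with h3 | h3
    · exact l1 _ _ _ _ h3 h2 hjk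
    exact s12 _ _ _ _ (l1 _ _ _ _ h3 hij hjk)
  have l3 : ∀ i j k l : Fin 4, i ≤ j → D i j k l = 0 := by
    intro i j k l hij
    rcases le_total j k with h1 | h1
    · exact l2 _ _ _ _ hij h1
    refine s23 _ _ _ _ ?_
    rcases le_total i k with h2 | h2
    · exact l2 _ _ _ _ h2 h1
    exact s12 _ _ _ _ (l2 _ _ _ _ h2 hij)
  rcases le_total i j with h1 | h1
  · exact l3 _ _ _ _ h1
  · exact s12 _ _ _ _ (l3 _ _ _ _ h1)

/-- The sign of a sequence of four indices, as a normalized Vandermonde product. -/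
noncomputable def leviCivita (i j k l : Fin 4) : ℂ :=
  ((j : ℕ) - (i : ℕ)) * ((k : ℕ) - (i : ℕ)) * ((l : ℕ) - (i : ℕ)) * ((k : ℕ) - (j : ℕ)) *
    ((l : ℕ) - (j : ℕ)) * ((l : ℕ) - (k : ℕ)) / 12

lemma IsAlternating.apply_eq {T : Tensor4 (Fin 4)} (hT : T.IsAlternating) (i j k l : Fin 4) :
    T (i, j, k, l) = T (0, 1, 2, 3) * leviCivita i j k l := by
  refine sub_eq_zero.1 (eq_zero_of_alternating
    (D := fun i j k l => T (i, j, k, l) - T (0, 1, 2, 3) * leviCivita i j k l)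
    (fun i j k l => ?_) (fun i j k l => ?_) (fun i j k l => ?_) ?_ i j k l)
  · rw [hT.swap_one_two, leviCivita, leviCivita]
    ring
  · rw [hT.swap_two_three, leviCivita, leviCivita]
    ring
  · rw [hT.swap_three_four, leviCivita, leviCivita]
    ring
  · norm_num [leviCivita]

lemma IsAlternating.conj_eq_of_im_eq_zero {T : Tensor4 (Fin 4)} (hT : T.IsAlternating)
    (h : (T (0, 1, 2, 3)).im = 0) : T.conj = T := by
  ext ⟨i, j, k, l⟩
  have h12 : starRingEnd ℂ 12 = 12 := map_ofNat _ 12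
  rw [conj_apply, hT.apply_eq]
  simp [leviCivita, Complex.conj_eq_iff_im.2 h, h12]

end Tensor4

/-! ### The coordinate model of `D(2,1;a)` -/

namespace D21

/-- Orthogonal coordinates on `ℂ² ⊗ ℂ²`, up to a factor `κ`; here `J² = -1`. -/
def coord (κ J : ℂ) (m : Fin 2 → Fin 2 → ℂ) : Fin 4 → ℂ :=
  ![κ * (m 0 0 + m 1 1), κ * J * (m 0 0 - m 1 1), κ * J * (m 0 1 + m 1 0), κ * (m 0 1 - m 1 0)]

/-- The action of `sl₂ × sl₂` on `ℂ² ⊗ ℂ²` in orthogonal coordinates. -/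
noncomputable def rot (J : ℂ) (B C : Matrix (Fin 2) (Fin 2) ℂ) : Matrix (Fin 4) (Fin 4) ℂ :=
  !![0, -J * (B 0 0 + C 0 0), -J * (B 0 1 + B 1 0 + C 0 1 + C 1 0) / 2,
        (C 0 1 - C 1 0 - B 0 1 + B 1 0) / 2;
    J * (B 0 0 + C 0 0), 0, (B 0 1 - B 1 0 + C 0 1 - C 1 0) / 2,
        J * (C 0 1 + C 1 0 - B 0 1 - B 1 0) / 2;
    J * (B 0 1 + B 1 0 + C 0 1 + C 1 0) / 2, -(B 0 1 - B 1 0 + C 0 1 - C 1 0) / 2, 0,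
        J * (B 0 0 - C 0 0);
    -(C 0 1 - C 1 0 - B 0 1 + B 1 0) / 2, -J * (C 0 1 + C 1 0 - B 0 1 - B 1 0) / 2,
        -J * (B 0 0 - C 0 0), 0]

/-- The invariant symmetric form on `ℂ² ⊗ ℂ²`. -/
def pairing (m n : Fin 2 → Fin 2 → ℂ) : ℂ :=
  m 0 0 * n 1 1 - m 0 1 * n 1 0 - m 1 0 * n 0 1 + m 1 1 * n 0 0

/-- The form `ω ⊗ ω` is a sum of hyperbolic planes, diagonalized with `J² = -1`. The scale `κ` stays
free, to be matched with the odd bracket. -/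
lemma coord_dotProduct {κ J : ℂ} (hJ : J * J = -1) (m n : Fin 2 → Fin 2 → ℂ) :
    coord κ J m ⬝ᵥ coord κ J n = 2 * (κ * κ) * pairing m n := by
  simp only [coord, dotProduct, Fin.sum_univ_four, Matrix.cons_val, pairing]
  linear_combination (κ * κ * ((m 0 0 - m 1 1) * (n 0 0 - n 1 1) +
    (m 0 1 + m 1 0) * (n 0 1 + n 1 0))) * hJ

lemma coord_add (κ J : ℂ) (m n : Fin 2 → Fin 2 → ℂ) :
    coord κ J (m + n) = coord κ J m + coord κ J n := by
  ext i
  fin_cases i <;> simp [coord] <;> ring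

lemma coord_smul (κ J c : ℂ) (m : Fin 2 → Fin 2 → ℂ) :
    coord κ J (c • m) = c • coord κ J m := by
  ext i
  fin_cases i <;> simp [coord] <;> ring

lemma rot_add (J : ℂ) (B C B' C' : Matrix (Fin 2) (Fin 2) ℂ) :
    rot J (B + B') (C + C') = rot J B C + rot J B' C' := by
  ext i j
  fin_cases i <;> fin_cases j <;> simp [rot] <;> ring

lemma rot_smul (J c : ℂ) (B C : Matrix (Fin 2) (Fin 2) ℂ) :
    rot J (c • B) (c • C) = c • rot J B C := by
  ext i j
  fin_cases i <;> fin_cases j <;> simp [rot] <;> ring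

lemma transpose_rot (J : ℂ) (B C : Matrix (Fin 2) (Fin 2) ℂ) :
    (rot J B C).transpose = -rot J B C := by
  ext i j
  fin_cases i <;> fin_cases j <;> simp [rot] <;> ring

/-- The infinitesimal action of a pair of matrices on `ℂ² ⊗ ℂ²`. -/
def pairAct (B C : Matrix (Fin 2) (Fin 2) ℂ) (m : Fin 2 → Fin 2 → ℂ) : Fin 2 → Fin 2 → ℂ :=
  fun j k => ∑ t, (B j t * m t k + C k t * m j t)

/-- This is the isomorphism `sl₂ × sl₂ ≅ so(4)`, written in orthogonal coordinates. -/
lemma rot_mulVec {κ J : ℂ} (hJ : J * J = -1) {B C : Matrix (Fin 2) (Fin 2) ℂ}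
    (hB : B 1 1 = -B 0 0) (hC : C 1 1 = -C 0 0) (m : Fin 2 → Fin 2 → ℂ) :
    (rot J B C).mulVec (coord κ J m) = coord κ J (pairAct B C m) := by
  ext i
  fin_cases i <;>
    simp only [rot, coord, pairAct, Matrix.mulVec, dotProduct, Fin.sum_univ_four,
      Fin.sum_univ_two, Matrix.of_apply, Matrix.cons_val, hB, hC, Fin.zero_eta, Fin.mk_one,
      Fin.reduceFinMk] <;>
    grind

lemma rot_commutator {J : ℂ} (hJ : J * J = -1) {B C B' C' : Matrix (Fin 2) (Fin 2) ℂ}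
    (hB : B 1 1 = -B 0 0) (hC : C 1 1 = -C 0 0) (hB' : B' 1 1 = -B' 0 0)
    (hC' : C' 1 1 = -C' 0 0) :
    rot J B C * rot J B' C' - rot J B' C' * rot J B C =
      rot J (B * B' - B' * B) (C * C' - C' * C) := by
  ext i j
  fin_cases i <;> fin_cases j <;>
    simp only [rot, Matrix.sub_apply, Matrix.mul_apply, Fin.sum_univ_four,
      Fin.sum_univ_two, Matrix.of_apply, Matrix.cons_val, hB, hC, hB', hC', Fin.zero_eta,
      Fin.mk_one, Fin.reduceFinMk] <;>
    grind

/-- Contraction of the second tensor factors. -/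
def contractRight (m n : Fin 2 → Fin 2 → ℂ) : Matrix (Fin 2) (Fin 2) ℂ := fun p q =>
  ∑ t, ε t q * (m p 0 * n t 1 - m p 1 * n t 0 + n p 1 * m t 0 - n p 0 * m t 1)

/-- Contraction of the first tensor factors. -/
def contractLeft (m n : Fin 2 → Fin 2 → ℂ) : Matrix (Fin 2) (Fin 2) ℂ := fun p q =>
  ∑ t, ε t q * (m 0 p * n 1 t - m 1 p * n 0 t + n 1 p * m 0 t - n 0 p * m 1 t)

-- On two-forms the curvature is the identity plus `c` times the Hodge star, so it scales the two
-- `sl₂` ideals of `so(4)` by `1 - c` and `1 + c`. The hypotheses `h1`, `h2` match these scales with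
-- the coefficients `1` and `a` of `D(2,1;a)`.
open Tensor4 in
lemma sum_curvature {T : Tensor4 (Fin 4)} (hT : T.IsAlternating) {κ J a : ℂ} (hJ : J * J = -1)
    (h1 : κ * κ * (1 - T (0, 1, 2, 3)) = -4) (h2 : κ * κ * (1 + T (0, 1, 2, 3)) = -(4 * a))
    (m n : Fin 2 → Fin 2 → ℂ) :
    ∑ i, ∑ j, (coord κ J m i * coord κ J n j) • T.curvature i j =
      (4 : ℂ) • rot J (contractRight m n) (a • contractLeft m n) := by
  obtain rfl : a = -(κ * κ + 2) / 2 := by linear_combination (h1 + h2) / 4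
  generalize hc : T (0, 1, 2, 3) = c at h1 h2
  have hcurv : ∀ i j k l, T.curvature i j k l = (if i = k then 1 else 0) * (if j = l then 1 else 0)
      - (if i = l then 1 else 0) * (if j = k then 1 else 0) + c * leviCivita i j k l := by
    intro i j k l
    rw [curvature_apply, hT.apply_eq, hc]
  ext k l
  fin_cases k <;> fin_cases l <;>
    simp [hcurv, Matrix.sum_apply, Fin.sum_univ_four, leviCivita, coord, rot, contractRight,
      contractLeft, ε, Fin.sum_univ_two] <;>
    norm_num
  all_goals grind

/-- The coordinate model of `D(2,1;a)`. -/
noncomputable def toModel (κ J : ℂ) : Even × Odd →ₗ[ℂ] Model (Fin 4) where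
  -- The triple sits in the first `sl₂` as `e = E₀₁/2`, `x = (E₀₀ - E₁₁)/2`, `f = E₁₀`, which
  -- explains the factors `2`.
  toFun X := (![2 * (X.1 0).1 0 1, 2 * (X.1 0).1 0 0, (X.1 0).1 1 0], rot J (X.1 1).1 (X.1 2).1,
    coord κ J (X.2 0), coord κ J (X.2 1))
  map_add' X Y := by
    refine Prod.ext ?_ (Prod.ext (rot_add _ _ _ _ _) (Prod.ext (coord_add _ _ _ _)
      (coord_add _ _ _ _)))
    ext i
    fin_cases i <;> simp <;> ring
  map_smul' c X := by
    refine Prod.ext ?_ (Prod.ext (rot_smul _ _ _ _) (Prod.ext (coord_smul _ _ _ _)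
      (coord_smul _ _ _ _)))
    ext i
    fin_cases i <;> simp <;> ring

lemma toModel_apply (κ J : ℂ) (A : Even) (v : Odd) : toModel κ J (A, v) =
    (![2 * (A 0).1 0 1, 2 * (A 0).1 0 0, (A 0).1 1 0], rot J (A 1).1 (A 2).1,
      coord κ J (v 0), coord κ J (v 1)) := rfl

lemma oddMat₀_swap₁ (v w : Odd) : oddMat₀ (swap₁ v) (swap₁ w) =
    contractRight (v 0) (w 1) + contractRight (w 0) (v 1) := by
  ext p q
  simp only [oddMat₀_apply, swap₁, contractRight, Matrix.add_apply, ← Finset.sum_add_distrib]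
  exact Finset.sum_congr rfl fun _ _ => by ring

lemma oddMat₀_swap₂ (v w : Odd) : oddMat₀ (swap₂ v) (swap₂ w) =
    contractLeft (v 0) (w 1) + contractLeft (w 0) (v 1) := by
  ext p q
  simp only [oddMat₀_apply, swap₂, contractLeft, Matrix.add_apply, ← Finset.sum_add_distrib]
  exact Finset.sum_congr rfl fun _ _ => by ring

lemma act_eq (A : Even) (v : Odd) (i : Fin 2) : act A v i =
    pairAct (A 1).1 (A 2).1 (v i) + (A 0).1 i 0 • v 0 + (A 0).1 i 1 • v 1 := by
  ext j k
  simp [act, pairAct, Fin.sum_univ_two]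
  ring

lemma toModel_bracket {T : Tensor4 (Fin 4)} (hT : T.IsAlternating) {κ J a : ℂ} (hJ : J * J = -1)
    (h1 : κ * κ * (1 - T (0, 1, 2, 3)) = -4) (h2 : κ * κ * (1 + T (0, 1, 2, 3)) = -(4 * a))
    (X Y : Even × Odd) :
    toModel κ J (brFun a X Y) = Model.bracket T (toModel κ J X) (toModel κ J Y) := by
  obtain ⟨A, v⟩ := X
  obtain ⟨B, w⟩ := Y
  -- This is twice `σ₀ = -1 - a`, as the `𝔰`-component of the odd bracket requires.
  have hκ : κ * κ = -(2 * (1 + a)) := by linear_combination (h1 + h2) / 2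
  rw [brFun, toModel_apply, toModel_apply, toModel_apply]
  refine Prod.ext ?_ (Prod.ext ?_ (Prod.ext ?_ ?_))
  · have hA := sl_val_one_one (A 0)
    have hB := sl_val_one_one (B 0)
    ext i
    fin_cases i <;>
      simp [Model.bracket, coord_dotProduct hJ, hκ, oddBr, oddSl, oddMat₀_apply, pairing, ε,
        LieRing.of_associative_ring_bracket, Matrix.mul_apply, Fin.sum_univ_two, hA, hB] <;>
      ring
  · have hs : ∀ m n m' n' : Fin 2 → Fin 2 → ℂ,
        ∑ i, ∑ j, (coord κ J m i * coord κ J n j + coord κ J m' i * coord κ J n' j) •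
          T.curvature i j = (4 : ℂ) • rot J (contractRight m n + contractRight m' n')
            (a • (contractLeft m n + contractLeft m' n')) := by
      intro m n m' n'
      simp only [add_smul, Finset.sum_add_distrib, sum_curvature hT hJ h1 h2, smul_add, rot_add]
    simp only [Model.bracket, hs]
    rw [rot_commutator hJ (sl_val_one_one _) (sl_val_one_one _) (sl_val_one_one _)
      (sl_val_one_one _), smul_smul, ← oddMat₀_swap₁, ← oddMat₀_swap₂]
    norm_num
    rw [← rot_add]
    rfl
  · simp only [Model.bracket, rot_mulVec hJ (sl_val_one_one _) (sl_val_one_one _), Pi.sub_apply,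
      act_eq, Matrix.cons_val, sub_eq_add_neg, ← neg_one_smul ℂ (_ : Fin 2 → Fin 2 → ℂ),
      ← neg_one_smul ℂ (_ : Fin 4 → ℂ), coord_add, coord_smul]
    module
  · simp only [Model.bracket, rot_mulVec hJ (sl_val_one_one _) (sl_val_one_one _), Pi.sub_apply,
      act_eq, Matrix.cons_val, sub_eq_add_neg, ← neg_one_smul ℂ (_ : Fin 2 → Fin 2 → ℂ),
      ← neg_one_smul ℂ (_ : Fin 4 → ℂ), coord_add, coord_smul, sl_val_one_one]
    module

/-- The traceless matrix with given entries. -/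
def slMk (p q r : ℂ) : LieAlgebra.SpecialLinear.sl (Fin 2) ℂ :=
  ⟨!![p, q; r, -p], by
    rw [LieAlgebra.SpecialLinear.sl]
    exact (by simp [Matrix.trace_fin_two] : (!![p, q; r, -p]).trace = 0)⟩

/-- The inverse of `coord`. -/
noncomputable def ofCoord (κ J : ℂ) (y : Fin 4 → ℂ) : Fin 2 → Fin 2 → ℂ :=
  ![![(y 0 - J * y 1) / (2 * κ), (y 3 - J * y 2) / (2 * κ)],
    ![(-y 3 - J * y 2) / (2 * κ), (y 0 + J * y 1) / (2 * κ)]]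

lemma ofCoord_zero (κ J : ℂ) : ofCoord κ J 0 = 0 := by
  ext i j
  fin_cases i <;> fin_cases j <;> simp [ofCoord]

/-- The inverse of `toModel`. -/
noncomputable def ofModel (κ J : ℂ) (X : Model (Fin 4)) : Even × Odd :=
  (![slMk (X.1 1 / 2) (X.1 0 / 2) (X.1 2),
      slMk (J * (X.2.1 0 1 - X.2.1 2 3) / 2)
        ((J * (X.2.1 0 2 + X.2.1 1 3) + X.2.1 1 2 - X.2.1 0 3) / 2)
        ((J * (X.2.1 0 2 + X.2.1 1 3) - X.2.1 1 2 + X.2.1 0 3) / 2),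
      slMk (J * (X.2.1 0 1 + X.2.1 2 3) / 2)
        ((J * (X.2.1 0 2 - X.2.1 1 3) + X.2.1 1 2 + X.2.1 0 3) / 2)
        ((J * (X.2.1 0 2 - X.2.1 1 3) - X.2.1 1 2 - X.2.1 0 3) / 2)],
    ![ofCoord κ J X.2.2.1, ofCoord κ J X.2.2.2])

lemma ofCoord_coord {κ J : ℂ} (hκ : κ ≠ 0) (hJ : J * J = -1) (m : Fin 2 → Fin 2 → ℂ) :
    ofCoord κ J (coord κ J m) = m := by
  ext i j
  fin_cases i <;> fin_cases j <;> simp [ofCoord, coord] <;> field_simp <;> grind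

lemma coord_ofCoord {κ J : ℂ} (hκ : κ ≠ 0) (hJ : J * J = -1) (y : Fin 4 → ℂ) :
    coord κ J (ofCoord κ J y) = y := by
  ext i
  fin_cases i <;> simp [ofCoord, coord] <;> field_simp <;> grind

lemma ofModel_toModel {κ J : ℂ} (hκ : κ ≠ 0) (hJ : J * J = -1) (X : Even × Odd) :
    ofModel κ J (toModel κ J X) = X := by
  obtain ⟨A, v⟩ := X
  refine Prod.ext (funext fun i => Subtype.ext ?_) (funext fun i => ?_)
  · have hA := sl_val_one_one (A i)
    ext p q
    fin_cases i <;> fin_cases p <;> fin_cases q <;>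
      simp [ofModel, toModel_apply, slMk, rot] at hA ⊢ <;> grind
  · fin_cases i <;> simp [ofModel, toModel_apply, ofCoord_coord hκ hJ]

lemma toModel_ofModel {κ J : ℂ} (hκ : κ ≠ 0) (hJ : J * J = -1) {X : Model (Fin 4)}
    (hX : X.2.1.transpose = -X.2.1) : toModel κ J (ofModel κ J X) = X := by
  have hs : ∀ i j, X.2.1 j i = -X.2.1 i j := fun i j => congrFun (congrFun hX i) j
  rw [ofModel, toModel_apply]
  refine Prod.ext ?_ (Prod.ext ?_ (Prod.ext ?_ ?_))
  · ext i
    fin_cases i <;> simp [slMk] <;> ring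
  · have d : ∀ i, X.2.1 i i = 0 := fun i => self_eq_neg.1 (hs i i)
    have s1 := hs 0 1
    have s2 := hs 0 2
    have s3 := hs 0 3
    have s4 := hs 1 2
    have s5 := hs 1 3
    have s6 := hs 2 3
    ext i j
    fin_cases i <;> fin_cases j <;> simp [slMk, rot, d] <;> grind
  · exact coord_ofCoord hκ hJ _
  · exact coord_ofCoord hκ hJ _

end D21

namespace Tensor4

/-- In dimension four the curvature operators span the skew-symmetric matrices unless the
four-form is special. -/
lemma IsAlternating.mem_span_curvature {T : Tensor4 (Fin 4)} (hT : T.IsAlternating)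
    (h1 : 1 - T (0, 1, 2, 3) ≠ 0) (h2 : 1 + T (0, 1, 2, 3) ≠ 0) {M : Matrix (Fin 4) (Fin 4) ℂ}
    (hM : M.transpose = -M) :
    M ∈ Submodule.span ℂ (Set.range fun p : Fin 4 × Fin 4 => T.curvature p.1 p.2) := by
  have hs : ∀ i j, M j i = -M i j := fun i j => congrFun (congrFun hM i) j
  have d : ∀ i, M i i = 0 := fun i => self_eq_neg.1 (hs i i)
  have s1 := hs 0 1
  have s2 := hs 0 2
  have s3 := hs 0 3
  have s4 := hs 1 2
  have s5 := hs 1 3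
  have s6 := hs 2 3
  generalize hc : T (0, 1, 2, 3) = c at h1 h2
  have hcurv : ∀ i j k l, T.curvature i j k l = (if i = k then 1 else 0) * (if j = l then 1 else 0)
      - (if i = l then 1 else 0) * (if j = k then 1 else 0) + c * leviCivita i j k l := by
    intro i j k l
    rw [curvature_apply, hT.apply_eq, hc]
  -- With `*` the Hodge star, `(1 + c*)(1 - c*) = 1 - c²`; the coefficients are the entries of `M -
  -- c*M`.
  have key : ((1 - c) * (1 + c)) • M = (M 0 1 - c * M 2 3) • T.curvature 0 1 +
      (M 0 2 + c * M 1 3) • T.curvature 0 2 + (M 0 3 - c * M 1 2) • T.curvature 0 3 +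
      (M 1 2 - c * M 0 3) • T.curvature 1 2 + (M 1 3 + c * M 0 2) • T.curvature 1 3 +
      (M 2 3 - c * M 0 1) • T.curvature 2 3 := by
    ext k l
    fin_cases k <;> fin_cases l <;> simp [hcurv, leviCivita, d] <;> norm_num <;> grind
  have hmem : ∀ i j, T.curvature i j ∈
      Submodule.span ℂ (Set.range fun p : Fin 4 × Fin 4 => T.curvature p.1 p.2) :=
    fun i j => Submodule.subset_span ⟨(i, j), rfl⟩
  rw [← Submodule.smul_mem_iff _ (mul_ne_zero h1 h2), key]
  exact add_mem (add_mem (add_mem (add_mem (add_mem (Submodule.smul_mem _ _ (hmem _ _))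
    (Submodule.smul_mem _ _ (hmem _ _))) (Submodule.smul_mem _ _ (hmem _ _)))
    (Submodule.smul_mem _ _ (hmem _ _))) (Submodule.smul_mem _ _ (hmem _ _)))
    (Submodule.smul_mem _ _ (hmem _ _))

end Tensor4

/-! ### Identification with `D(2,1;a)` and conclusion -/

namespace LieSuperalgebra

variable {V : Type*} [AddCommGroup V] [Module ℂ V] {G : LieSuperalgebra V} {e x f : V}

/-- A four-dimensional model is `D(2,1;a)` unless its four-form is special. -/
theorem IsModel.isomorphic_D21 {T : Tensor4 (Fin 4)} {Ψ : V →ₗ[ℂ] Model (Fin 4)}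
    (h : G.IsModel e x f T Ψ) (hT : T.IsAlternating) (h1 : 1 - T (0, 1, 2, 3) ≠ 0)
    (h2 : 1 + T (0, 1, 2, 3) ≠ 0) :
    G.Isomorphic (D21 ((1 + T (0, 1, 2, 3)) / (1 - T (0, 1, 2, 3)))) := by
  set c := T (0, 1, 2, 3) with hc
  set a := (1 + c) / (1 - c) with ha
  -- The square of `κ` is dictated by the scale `1 - c` of the first ideal; the scale `1 + c` of the
  -- second then fixes `a`.
  obtain ⟨κ, hκ⟩ := IsAlgClosed.exists_pow_nat_eq (-4 / (1 - c)) two_pos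
  have k1 : κ * κ * (1 - c) = -4 := by
    rw [← sq, hκ, div_mul_cancel₀ _ h1]
  have k2 : κ * κ * (1 + c) = -(4 * a) := by
    rw [← sq, hκ, ha]
    ring
  have hκ0 : κ ≠ 0 := by
    rintro rfl
    norm_num at k1
  have hJ := Complex.I_mul_I
  let χ := D21.toModel κ Complex.I
  have hχ : ∀ v, χ (D21.ofModel κ Complex.I (Ψ v)) = Ψ v := fun v =>
    D21.toModel_ofModel hκ0 hJ (h.transpose_matrix hT v)
  have hΨ : ∀ X, ∃ v, Ψ v = χ X := fun X =>
    (h.mem_range_iff _).2 (hT.mem_span_curvature h1 h2 (D21.transpose_rot _ _ _))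
  have hinj : Function.Injective χ :=
    Function.LeftInverse.injective (D21.ofModel_toModel hκ0 hJ)
  let ψ : V →ₗ[ℂ] D21.Even × D21.Odd :=
    { toFun := fun v => D21.ofModel κ Complex.I (Ψ v)
      map_add' := fun v w => hinj (by rw [map_add χ, hχ, hχ, hχ, map_add])
      map_smul' := fun t v => hinj (by rw [map_smul χ, hχ, hχ, map_smul]; rfl) }
  have hψ : ∀ v, χ (ψ v) = Ψ v := hχ
  refine ⟨LinearEquiv.ofBijective ψ ⟨fun v w hvw => h.injective ?_, fun X => ?_⟩,
    fun v w => hinj ?_, fun i v hv => ?_⟩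
  · rw [← hψ, hvw, hψ]
  · obtain ⟨v, hv⟩ := hΨ X
    exact ⟨v, hinj (by rw [hψ, hv])⟩
  · change χ (ψ _) = χ (D21.brFun a (ψ v) (ψ w))
    rw [hψ, h.map_bracket, D21.toModel_bracket hT hJ k1 k2, ← hψ v, ← hψ w]
  · change ψ v ∈ D21.part i
    rcases D21.mem_part_cases i with rfl | rfl
    · obtain ⟨z1, z2⟩ := (h.even_iff v).1 hv
      rw [D21.mem_part_zero]
      ext i : 1
      change ![D21.ofCoord κ Complex.I (Ψ v).2.2.1, D21.ofCoord κ Complex.I (Ψ v).2.2.2] i = 0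
      rw [z1, z2]
      fin_cases i <;> exact D21.ofCoord_zero _ _
    · obtain ⟨z1, z2⟩ := (h.odd_iff v).1 hv
      rw [D21.mem_part_one]
      refine funext fun i => Subtype.ext ?_
      ext p q
      fin_cases i <;> fin_cases p <;> fin_cases q <;> simp [ψ, D21.ofModel, z1, z2, D21.slMk]

end LieSuperalgebra

theorem proposition3p2 {V : Type*} [AddCommGroup V] [Module ℂ V] [FiniteDimensional ℂ V]
    (G : LieSuperalgebra V) (hG : G.IsBasicSimple)
    (hD : ∀ a : ℂ, G.Isomorphic (D21 a) → a.im = 0)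
    (e x f : V) (htriple : G.IsSl2Triple e x f) (hsplit : G.EvenSplits e x f)
    (hmin : G.IsMinimal x f) :
    ∃ φ : V →ₛₗ[starRingEnd ℂ] V, G.IsAlmostCompact e x f φ := by
  obtain ⟨β, hβ⟩ := hG.exists_form
  have h : G.IsMinimalSplit e x f := ⟨htriple, hsplit, hmin⟩
  obtain ⟨l, hl⟩ := h.exists_functional
  obtain ⟨N, b, hb⟩ := h.exists_frame hβ hl
  by_cases hN : N = 4
  · subst hN
    have hT := hb.isAlternating h hl
    obtain ⟨Ψ, hΨ⟩ := hb.exists_isModel h hG.simple hl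
    by_cases hc : (G.frameTensor l x f b (0, 1, 2, 3)).im = 0
    · exact hΨ.exists_isAlmostCompact hT (hT.conj_eq_of_im_eq_zero hc)
    · set c := G.frameTensor l x f b (0, 1, 2, 3)
      -- The special values `c = ±1` are real, so they are excluded here.
      have h1 : 1 - c ≠ 0 := fun h0 => hc (by rw [← sub_eq_zero.1 h0, Complex.one_im])
      have h2 : 1 + c ≠ 0 := fun h0 => hc (by
        rw [← neg_eq_of_add_eq_zero_right h0, Complex.neg_im, Complex.one_im, neg_zero])
      have him := Complex.conj_eq_iff_im.2 (hD _ (hΨ.isomorphic_D21 hT h1 h2))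
      have h1' : 1 - starRingEnd ℂ c ≠ 0 := by
        rw [← map_one (starRingEnd ℂ), ← map_sub]
        exact (map_ne_zero _).2 h1
      refine absurd (Complex.conj_eq_iff_im.1 ?_) hc
      change starRingEnd ℂ ((1 + c) / (1 - c)) = (1 + c) / (1 - c) at him
      -- `a` is a fractional linear function of `c` with real coefficients, so a real `a` forces a
      -- real `c`.
      rw [map_div₀, map_add, map_sub, map_one, div_eq_div_iff h1' h1] at him
      linear_combination him / 2
  -- `O` consists of the coordinate tensors in all frames, so a real member of `O` is a frame in
  -- which the four-form is real.
  · obtain ⟨T, ⟨b', hb', rfl⟩, hreal⟩ := Tensor4.exists_conj_eq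
      (O := {T : Tensor4 (Fin N) | ∃ b, G.IsFrame l x b ∧ T = G.frameTensor l x f b})
      ⟨_, b, hb, rfl⟩
      (by
        rintro g hg _ ⟨b, hb, rfl⟩
        exact ⟨_, hb.orthogonal hg, (LieSuperalgebra.frameTensor_sum _ _ _ _ g).symm⟩)
      (by
        rintro _ ⟨b, hb, rfl⟩
        exact hb.isAlternating h hl)
      (by
        rintro _ ⟨b, hb, rfl⟩
        exact hb.isInvariant h hl)
      (by rwa [Fintype.card_fin])
    obtain ⟨Ψ, hΨ⟩ := hb'.exists_isModel h hG.simple hl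
    exact hΨ.exists_isAlmostCompact (hb'.isAlternating h hl) hreal
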